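/- \textbf{Theorem.} Let $(M,g)$ be a pseudo-Riemannian spin manifold of signature $(p,q)$ ($p$ plus and $q$ minus signs), $n=\dim M=p+q$, $s=p-q$, and let $(\hat M,\hat g)=(\mathbb{R}^+\times M,\ dr^2+r^2g)$ be the cone over it, of signature $(p+1,q)$, with the induced spin structure. (Spin structures are two-fold coverings of the bundle of strongly oriented orthonormal frames with group $\mathrm{Spin}_0(p,q)$; on $\hat M$ one takes the frames $(\partial_r,r^{-1}e_1,\dots,r^{-1}e_n)$ and pulls back the spin structure of $M$ along $\mathrm{Spin}_0(p,q)\subset\mathrm{Spin}_0(p+1,q)$.) The real (complex) Clifford algebra has the relation $XY+YX=-2g(X,Y)$; the real (complex) spinor bundle $S$ ($\mathbb{S}$) of $M$ is associated with an irreducible real (complex) module of the Clifford algebra $C\ell_{p,q}$, and $\hat S$ ($\hat{\mathbb{S}}$) is the bundle on $\hat M$ associated with an irreducible module of $C\ell_{p+1,q}$. If that module is a direct sum of two irreducible modules of the even Clifford algebra, the corresponding subbundles $\hat S^\pm$ ($\hat{\mathbb{S}}^\pm$) are called semi-spinor bundles. For a spinor bundle $\Sigma$ let $\Sigma(\lambda)$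 be the space of Killing spinors with Killing number $\lambda\in\mathbb{R}$, i.e. of smooth sections $\psi$ with $\nabla_X\psi=\lambda X\psi$ for all tangent vectors $X$; so $\Sigma(0)$ is the space of parallel sections. Sections over $\hat M$ are restricted to $M=\{1\}\times M$. If $\Sigma$ is one of $\hat S,\hat S^\pm$ (or $\hat{\mathbb S},\hat{\mathbb S}^\pm$) and $\delta\in\{1,-1\}$, then a $\delta$-identification is an isomorphism of $\Sigma|_M$ with $S$ (or $\mathbb S$) induced by an isomorphism of the underlying modules under which the action of $e_ie_0$ corresponds to the action of $\delta e_i$ ($e_0=\partial_r$, $i=1,\dots,n$). In each assertion below that restriction defines an isomorphism $\Sigma(0)\to S(\delta/2)$ (or $\mathbb{S}(\delta/2)$), it is claimed that $\delta$-identifications exist and that restriction composed with any of them is such an isomorphism. (i) If $s\equiv 2,4,5,6 \pmod 8$, then restriction defines isomorphisms $$\hat S(0)\to S(\tfrac12)\cong S(-\tfrac12).$$ If $s\equiv 0,1,3,7\pmod 8$, then semi-spinor bundles $\hat S^\pm$ exist, and for any choice of them restriction defines isomorphisms $$\hat S^\pm(0)\to S(\pm\tfrac{\varepsilon}{2})\quad\text{for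 some } \varepsilon\in\{1,-1\}.$$ If $s\equiv 0\pmod 8$, restriction moreover defines isomorphisms of $\hat S^+(0)$ and of $\hat S^-(0)$ onto $S(\tfrac12)$, and $S(\tfrac12)\cong S(-\tfrac12)$. (ii) If $n$ is even, then restriction defines isomorphisms $$\hat{\mathbb{S}}(0)\to \mathbb{S}(\tfrac12)\cong \mathbb{S}(-\tfrac12).$$ If $n$ is odd, then semi-spinor bundles $\hat{\mathbb{S}}^\pm$ exist, and for any choice of them restriction defines isomorphisms $$\hat{\mathbb{S}}^\pm(0)\to \mathbb{S}(\pm\tfrac{\varepsilon}{2})\quad\text{for some } \varepsilon\in\{1,-1\}.$$ -/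

import Mathlib

open scoped Manifold ContDiff

set_option linter.unusedSectionVars false

noncomputable section

namespace ConeSpin

/-! ## Clifford algebras, the group Spin₀(p,q), spinor modules -/

/-- Index set of an orthonormal basis of `ℝ^{p,q}`: first the `p` vectors with square norm `1`,
then the `q` vectors with square norm `-1`. -/
abbrev Idx (p q : ℕ) : Type := Fin p ⊕ Fin q

/-- The square norms of the basis vectors of `ℝ^{p,q}`. -/
def sgn {p q : ℕ} : Idx p q → ℝ := Sum.elim (fun _ => 1) (fun _ => -1)

/-- Minus the standard scalar square of `ℝ^{p,q}`, so that in the Clifford algebra of this form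
`X Y + Y X = -2 ⟨X, Y⟩`. -/
def cliffordForm (p q : ℕ) : QuadraticForm ℝ (Idx p q → ℝ) :=
  QuadraticMap.weightedSumSquares ℝ (fun i => -sgn i)

/-- The Clifford algebra of `ℝ^{p,q}`, with the sign convention `v² = -⟨v, v⟩`. -/
abbrev Cl (p q : ℕ) : Type := CliffordAlgebra (cliffordForm p q)

/-- Vectors of `ℝ^{p,q}` as elements of the Clifford algebra. -/
def vec {p q : ℕ} : (Idx p q → ℝ) →ₗ[ℝ] Cl p q := CliffordAlgebra.ι (cliffordForm p q)

/-- The generators of the Clifford algebra. -/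
def gen {p q : ℕ} (i : Idx p q) : Cl p q := vec (Pi.single i 1)

/-- The group `Spin₀(p,q)`, the two-fold cover of the identity component of `SO(p,q)`:
even products of vectors which have norm one for the norm `x ↦ x* x` (where `*` is the
anti-automorphism with `v* = -v` on vectors). -/
abbrev Spin₀ (p q : ℕ) : Submonoid (Cl p q) := spinGroup (cliffordForm p q)

/-- The index of `e_i` (`i = 1, …, n`) among the basis vectors `e_0, e_1, …, e_n` of
`ℝ^{p+1,q}`. -/
def succIdx {p q : ℕ} : Idx p q → Idx (p + 1) q := Sum.map Fin.succ id

/-- The index of the additional basis vector `e_0` of `ℝ^{p+1,q}`. -/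
def zeroIdx {p q : ℕ} : Idx (p + 1) q := Sum.inl 0

/-- A family indexed by the basis of `ℝ^{p+1,q}` from its value at `e_0` and at `e_1, …, e_n`. -/
def consIdx {α : Type*} {p q : ℕ} (a : α) (f : Idx p q → α) : Idx (p + 1) q → α :=
  Sum.elim (Fin.cons a fun i => f (Sum.inl i)) (fun j => f (Sum.inr j))

@[simp] theorem consIdx_zero {α : Type*} {p q : ℕ} (a : α) (f : Idx p q → α) :
    consIdx a f zeroIdx = a := rfl

@[simp] theorem consIdx_succ {α : Type*} {p q : ℕ} (a : α) (f : Idx p q → α) (i : Idx p q) :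
    consIdx a f (succIdx i) = f i := by
  cases i <;> rfl

@[simp] theorem sgn_zeroIdx {p q : ℕ} : sgn (zeroIdx : Idx (p + 1) q) = 1 := rfl

@[simp] theorem sgn_succIdx {p q : ℕ} (i : Idx p q) : sgn (succIdx i) = sgn i := by
  cases i <;> rfl

theorem idx_cases {p q : ℕ} {P : Idx (p + 1) q → Prop} (h0 : P zeroIdx)
    (hs : ∀ i, P (succIdx i)) (i : Idx (p + 1) q) : P i := by
  rcases i with i | j
  · exact Fin.cases h0 (fun i => hs (Sum.inl i)) i
  · exact hs (Sum.inr j)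

theorem succIdx_injective {p q : ℕ} : Function.Injective (succIdx : Idx p q → Idx (p + 1) q) :=
  Sum.map_injective.2 ⟨Fin.succ_injective _, Function.injective_id⟩

theorem zeroIdx_ne_succIdx {p q : ℕ} (i : Idx p q) : zeroIdx ≠ succIdx i := by
  cases i <;> simp [zeroIdx, succIdx, Fin.succ_ne_zero, eq_comm]

theorem sum_idx {β : Type*} [AddCommMonoid β] {p q : ℕ} (f : Idx (p + 1) q → β) :
    ∑ i, f i = f zeroIdx + ∑ i, f (succIdx i) := by
  simp [Fin.sum_univ_succ, zeroIdx, succIdx, add_assoc]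

theorem cliffordForm_apply {p q : ℕ} (v : Idx p q → ℝ) :
    cliffordForm p q v = ∑ i, -sgn i * (v i * v i) := by
  simp [cliffordForm, QuadraticMap.weightedSumSquares_apply]

/-- The isometric inclusion `ℝ^{p,q} → ℝ^{p+1,q}` as the orthogonal complement of `e_0`. -/
def inclVec (p q : ℕ) : cliffordForm p q →qᵢ cliffordForm (p + 1) q where
  toFun v := consIdx 0 v
  map_add' u v := by
    funext i; refine idx_cases (P := fun i => consIdx _ _ i = _) ?_ ?_ i <;> simp
  map_smul' c v := by
    funext i; refine idx_cases (P := fun i => consIdx _ _ i = _) ?_ ?_ i <;> simp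
  map_app' v := by
    rw [cliffordForm_apply, cliffordForm_apply, sum_idx]
    simp

/-- The inclusion `Cl_{p,q} ⊂ Cl_{p+1,q}`, `e_i ↦ e_i`. -/
def inclCl (p q : ℕ) : Cl p q →ₐ[ℝ] Cl (p + 1) q := CliffordAlgebra.map (inclVec p q)

theorem inclCl_vec {p q : ℕ} (v : Idx p q → ℝ) : inclCl p q (vec v) = vec (consIdx 0 v) :=
  CliffordAlgebra.map_apply_ι _ _

theorem inclCl_star {p q : ℕ} (x : Cl p q) : inclCl p q (star x) = star (inclCl p q x) := by
  induction x using CliffordAlgebra.induction with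
  | algebraMap r => simp [CliffordAlgebra.star_algebraMap]
  | ι v => 
    change inclCl p q (star (vec v)) = star (inclCl p q (vec v))
    rw [inclCl_vec]
    have h : ∀ {p q : ℕ} (v : Idx p q → ℝ), star (vec v) = -vec v :=
      fun v => CliffordAlgebra.star_ι v
    rw [h, h, map_neg, inclCl_vec]
  | mul a b ha hb => simp [star_mul, ha, hb]
  | add a b ha hb => simp [star_add, ha, hb]

theorem inclCl_mem_even {p q : ℕ} {x : Cl p q}
    (hx : x ∈ CliffordAlgebra.even (cliffordForm p q)) :
    inclCl p q x ∈ CliffordAlgebra.even (cliffordForm (p + 1) q) := by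
  change x ∈ CliffordAlgebra.evenOdd (cliffordForm p q) 0 at hx
  induction x, hx using CliffordAlgebra.even_induction with
  | algebraMap r => rw [AlgHom.commutes]; exact Subalgebra.algebraMap_mem _ r
  | add x y hx hy ihx ihy => rw [map_add]; exact Subalgebra.add_mem _ ihx ihy
  | ι_mul_ι_mul u v x hx ih =>
    change inclCl p q (vec u * vec v * x) ∈ _
    rw [map_mul, map_mul, inclCl_vec, inclCl_vec]
    exact Subalgebra.mul_mem _ (CliffordAlgebra.ι_mul_ι_mem_evenOdd_zero _ _ _) ih

/-- `Spin₀(p,q) ⊂ Spin₀(p+1,q)`. -/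
theorem inclCl_mem_spin {p q : ℕ} {x : Cl p q} (hx : x ∈ Spin₀ p q) :
    inclCl p q x ∈ Spin₀ (p + 1) q := by
  obtain ⟨⟨hl, hun⟩, he⟩ := hx
  refine ⟨⟨?_, ?_⟩, ?_⟩
  · obtain ⟨u, hu, rfl⟩ := hl
    refine ⟨Units.map (inclCl p q : Cl p q →* Cl (p + 1) q) u, ?_, rfl⟩
    change u ∈ Subgroup.closure _ at hu
    change _ ∈ Subgroup.closure _
    have := Subgroup.mem_map_of_mem (Units.map (inclCl p q : Cl p q →* Cl (p + 1) q)) hu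
    rw [MonoidHom.map_closure] at this
    refine Subgroup.closure_mono ?_ this
    rintro _ ⟨w, ⟨v, hv⟩, rfl⟩
    exact ⟨consIdx 0 v, by
      change vec _ = inclCl p q (w : Cl p q)
      rw [← inclCl_vec, ← hv]; rfl⟩
  · obtain ⟨h1, h2⟩ := Unitary.mem_iff.1 hun
    refine Unitary.mem_iff.2 ⟨?_, ?_⟩
    · rw [← inclCl_star, ← map_mul, h1, map_one]
    · rw [← inclCl_star, ← map_mul, h2, map_one]
  · change x ∈ CliffordAlgebra.even _ at he
    change _ ∈ CliffordAlgebra.even _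
    exact inclCl_mem_even he

theorem vec_mul_vec_of_left {p q : ℕ} (v : Idx p q → ℝ) :
    vec (Pi.single zeroIdx 1 : Idx (p + 1) q → ℝ) * vec (consIdx 0 v) =
      -(vec (consIdx 0 v) * vec (Pi.single zeroIdx 1 : Idx (p + 1) q → ℝ)) := by
  rw [eq_neg_iff_add_eq_zero]
  refine (CliffordAlgebra.ι_mul_ι_add_swap _ _).trans ?_
  have : QuadraticMap.polar (cliffordForm (p + 1) q) (Pi.single zeroIdx 1) (consIdx 0 v) = 0 := by
    simp only [QuadraticMap.polar, cliffordForm_apply, sum_idx]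
    simp [(zeroIdx_ne_succIdx _).symm]
  rw [this, map_zero]

theorem gen_zero_comm {p q : ℕ} (x : Cl p q) :
    (gen zeroIdx : Cl (p + 1) q) * inclCl p q x =
      inclCl p q (CliffordAlgebra.involute x) * gen zeroIdx := by
  induction x using CliffordAlgebra.induction with
  | algebraMap r => rw [AlgHom.commutes, AlgHom.commutes, AlgHom.commutes, Algebra.commutes]
  | ι v =>
    rw [CliffordAlgebra.involute_ι, map_neg, neg_mul]
    change vec _ * inclCl p q (vec v) = -(inclCl p q (vec v) * vec _)
    rw [inclCl_vec]
    exact vec_mul_vec_of_left v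
  | mul a b ha hb => rw [map_mul, ← mul_assoc, ha, mul_assoc, hb, map_mul, map_mul, mul_assoc]
  | add a b ha hb => rw [map_add, mul_add, ha, hb, map_add, map_add, add_mul]

theorem gen_zero_comm_of_spin {p q : ℕ} {x : Cl p q} (hx : x ∈ Spin₀ p q) :
    (gen zeroIdx : Cl (p + 1) q) * inclCl p q x = inclCl p q x * gen zeroIdx := by
  rw [gen_zero_comm, spinGroup.involute_eq hx]

section Modules

variable {𝕜 : Type*} [RCLike 𝕜] {p q : ℕ} {S : Type*} [NormedAddCommGroup S] [NormedSpace ℝ S]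
  [NormedSpace 𝕜 S] [IsScalarTower ℝ 𝕜 S]

/-- `S` is an irreducible (real, for `𝕜 = ℝ`, or complex, for `𝕜 = ℂ`) module over the Clifford
algebra. Restricted to the spin group this is the (real or complex) spinor module. -/
structure IsSpinorModule (ρ : Cl p q →ₐ[ℝ] Module.End 𝕜 S) : Prop where
  nontrivial : Nontrivial S
  irreducible : ∀ W : Submodule 𝕜 S, (∀ a : Cl p q, ∀ s ∈ W, ρ a s ∈ W) → W = ⊥ ∨ W = ⊤

/-- `W` is an irreducible submodule of the spinor module over the even part of the Clifford
algebra (the algebra generated by the spin group). -/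
structure IsEvenIrreducible (ρ : Cl p q →ₐ[ℝ] Module.End 𝕜 S) (W : Submodule 𝕜 S) : Prop where
  ne_bot : W ≠ ⊥
  invariant : ∀ a ∈ CliffordAlgebra.even (cliffordForm p q), ∀ s ∈ W, ρ a s ∈ W
  irreducible : ∀ W' ≤ W,
    (∀ a ∈ CliffordAlgebra.even (cliffordForm p q), ∀ s ∈ W', ρ a s ∈ W') → W' = ⊥ ∨ W' = W

/-- A decomposition of the spinor module into two semi-spinor modules. -/
structure IsSemiSpinorPair (ρ : Cl p q →ₐ[ℝ] Module.End 𝕜 S) (Wp Wm : Submodule 𝕜 S) : Prop where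
  isCompl : IsCompl Wp Wm
  plus : IsEvenIrreducible ρ Wp
  minus : IsEvenIrreducible ρ Wm

end Modules

/-! ## Pseudo-Riemannian metrics and the Levi-Civita connection -/

section Geometry

variable {E : Type*} [NormedAddCommGroup E] [NormedSpace ℝ E] {H : Type*} [TopologicalSpace H]
  (I : ModelWithCorners ℝ E H) (M : Type*) [TopologicalSpace M] [ChartedSpace H M]
  [IsManifold I ∞ M]

/-- A smooth pseudo-Riemannian metric of signature `(p,q)` (`p` plus signs, `q` minus signs).
Smoothness is expressed by saying that `v ↦ g(v,v)` is a smooth function on the tangent bundle. -/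
structure PseudoMetric (p q : ℕ) where
  val : ∀ x : M, TangentSpace I x →ₗ[ℝ] TangentSpace I x →ₗ[ℝ] ℝ
  symm : ∀ x u v, val x u v = val x v u
  signature : ∀ x, ∃ b : Module.Basis (Idx p q) ℝ (TangentSpace I x),
    ∀ i j, val x (b i) (b j) = if i = j then sgn i else 0
  smooth : ContMDiff I.tangent 𝓘(ℝ, ℝ) ∞ (fun v : TangentBundle I M => val v.1 v.2 v.2)

variable {I M} {p q : ℕ}

/-- The derivative of the vector-valued function `f` in the direction of the tangent vector `v`. -/
def dirDeriv {F : Type*} [NormedAddCommGroup F] [NormedSpace ℝ F] (f : M → F) (x : M)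
    (v : TangentSpace I x) : F :=
  mfderiv I 𝓘(ℝ, F) f x v

/-- The function `g(∇_X Y, Z)`, where `∇` is the Levi-Civita connection, given by the Koszul
formula. -/
def koszul (g : PseudoMetric I M p q) (X Y Z : ∀ x : M, TangentSpace I x) (x : M) : ℝ :=
  (1 / 2) * (dirDeriv (fun y => g.val y (Y y) (Z y)) x (X x)
    + dirDeriv (fun y => g.val y (Z y) (X y)) x (Y x)
    - dirDeriv (fun y => g.val y (X y) (Y y)) x (Z x)
    + g.val x (VectorField.mlieBracket I X Y x) (Z x)
    - g.val x (VectorField.mlieBracket I Y Z x) (X x)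
    + g.val x (VectorField.mlieBracket I Z X x) (Y x))

/-- The coordinates of the tangent vector `v` in the orthonormal frame `e`. -/
def coord (g : PseudoMetric I M p q) (e : Idx p q → ∀ x : M, TangentSpace I x) (x : M)
    (v : TangentSpace I x) : Idx p q → ℝ :=
  fun i => sgn i * g.val x v (e i x)

/-- The Levi-Civita connection form `g(∇_v e_j, e_k)` of the orthonormal frame `e`. -/
def connForm (g : PseudoMetric I M p q) (e : Idx p q → ∀ x : M, TangentSpace I x) (x : M)
    (v : TangentSpace I x) (j k : Idx p q) : ℝ :=
  ∑ i, coord g e x v i * koszul g (e i) (e j) (e k) x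

/-! ## Spin structures and spinor fields -/

/-- A (strong) spin structure on `(M,g)`, given by local data: an open cover by sets `U a`, on each
of them a smooth orthonormal frame, and for every pair of them a smooth map
`trans a b : U a ∩ U b → Spin₀(p,q)` which lifts the change of frames and satisfies the cocycle
condition. This is the same as a strong orientation (the frames are the local sections of the
`SO₀(p,q)`-bundle that it defines) together with a `Spin₀(p,q)`-equivariant two-fold covering of the
bundle of strongly oriented orthonormal frames, trivialised over the cover.
Smoothness of maps into the (finite-dimensional) Clifford algebra is expressed by linear
coordinates. -/
structure SpinStructure (g : PseudoMetric I M p q) (ι : Type*) where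
  U : ι → Set M
  isOpen_U : ∀ a, IsOpen (U a)
  cover : ∀ x, ∃ a, x ∈ U a
  frame : ι → Idx p q → ∀ x : M, TangentSpace I x
  frame_smooth : ∀ a i,
    ContMDiffOn I I.tangent ∞ (fun x => (⟨x, frame a i x⟩ : TangentBundle I M)) (U a)
  frame_orthonormal : ∀ a, ∀ x ∈ U a, ∀ i j,
    g.val x (frame a i x) (frame a j x) = if i = j then sgn i else 0
  trans : ι → ι → M → Cl p q
  trans_mem : ∀ a b, ∀ x ∈ U a ∩ U b, trans a b x ∈ Spin₀ p q
  trans_smooth : ∀ a b (l : Cl p q →ₗ[ℝ] ℝ),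
    ContMDiffOn I 𝓘(ℝ, ℝ) ∞ (fun x => l (trans a b x)) (U a ∩ U b)
  trans_frame : ∀ a b, ∀ x ∈ U a ∩ U b, ∀ v : TangentSpace I x,
    trans a b x * vec (coord g (frame b) x v) = vec (coord g (frame a) x v) * trans a b x
  trans_cocycle : ∀ a b c, ∀ x ∈ U a ∩ U b ∩ U c,
    trans a b x * trans b c x = trans a c x

variable {𝕜 : Type*} [RCLike 𝕜] {S : Type*} [NormedAddCommGroup S] [NormedSpace ℝ S]
  [NormedSpace 𝕜 S] [IsScalarTower ℝ 𝕜 S]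

/-- The Clifford product `v · s` of a tangent vector and a spinor, in the spin frame over the
orthonormal frame `e`. -/
def cliffordMul (g : PseudoMetric I M p q) (e : Idx p q → ∀ x : M, TangentSpace I x)
    (ρ : Cl p q →ₐ[ℝ] Module.End 𝕜 S) (x : M) (v : TangentSpace I x) (s : S) : S :=
  ρ (vec (coord g e x v)) s

/-- The covariant derivative `∇_v s` of a spinor field with components `s : M → S` in the spin
frame over the orthonormal frame `e`; the connection is the one induced by the Levi-Civita
connection:
`∇_v s = ds(v) + 1/4 ∑_{j,k} ε_j ε_k g(∇_v e_j, e_k) e_j e_k s`. -/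
def spinDeriv (g : PseudoMetric I M p q) (e : Idx p q → ∀ x : M, TangentSpace I x)
    (ρ : Cl p q →ₐ[ℝ] Module.End 𝕜 S) (s : M → S) (x : M) (v : TangentSpace I x) : S :=
  dirDeriv s x v +
    (1 / 4 : ℝ) • ∑ j, ∑ k, (sgn j * sgn k * connForm g e x v j k) • ρ (gen j * gen k) (s x)

theorem contMDiffOn_smul {f : M → S} {u : Set M} (c : 𝕜)
    (hf : ContMDiffOn I 𝓘(ℝ, S) ∞ f u) : ContMDiffOn I 𝓘(ℝ, S) ∞ (fun x => c • f x) u :=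
  (c • ContinuousLinearMap.id ℝ S).contMDiff.comp_contMDiffOn hf

theorem spinDeriv_zero (g : PseudoMetric I M p q) (e : Idx p q → ∀ x : M, TangentSpace I x)
    (ρ : Cl p q →ₐ[ℝ] Module.End 𝕜 S) (x : M) (v : TangentSpace I x) :
    spinDeriv g e ρ (fun _ => (0 : S)) x v = 0 := by
  have : dirDeriv (fun _ => (0 : S)) x v = 0 := by
    unfold dirDeriv
    rw [mfderiv_const]; rfl
  simp [spinDeriv, this]

theorem spinDeriv_add (g : PseudoMetric I M p q) (e : Idx p q → ∀ x : M, TangentSpace I x)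
    (ρ : Cl p q →ₐ[ℝ] Module.End 𝕜 S) {s t : M → S} {x : M} (v : TangentSpace I x)
    (hs : MDifferentiableAt I 𝓘(ℝ, S) s x) (ht : MDifferentiableAt I 𝓘(ℝ, S) t x) :
    spinDeriv g e ρ (fun y => s y + t y) x v = spinDeriv g e ρ s x v + spinDeriv g e ρ t x v := by
  have : dirDeriv (fun y => s y + t y) x v = dirDeriv s x v + dirDeriv t x v := by
    have := (hs.hasMFDerivAt.add ht.hasMFDerivAt).mfderiv
    unfold dirDeriv
    change mfderiv I 𝓘(ℝ, S) (s + t) x v = _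
    rw [this]; rfl
  simp only [spinDeriv, this, map_add, smul_add, Finset.sum_add_distrib]
  abel

theorem spinDeriv_smul (g : PseudoMetric I M p q) (e : Idx p q → ∀ x : M, TangentSpace I x)
    (ρ : Cl p q →ₐ[ℝ] Module.End 𝕜 S) (c : 𝕜) {s : M → S} {x : M} (v : TangentSpace I x)
    (hs : MDifferentiableAt I 𝓘(ℝ, S) s x) :
    spinDeriv g e ρ (fun y => c • s y) x v = c • spinDeriv g e ρ s x v := by
  have : dirDeriv (fun y => c • s y) x v = c • dirDeriv s x v := by
    have := ((c • ContinuousLinearMap.id ℝ S).hasMFDerivAt.comp x hs.hasMFDerivAt).mfderiv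
    unfold dirDeriv
    change mfderiv I 𝓘(ℝ, S) ((c • ContinuousLinearMap.id ℝ S) ∘ s) x v = _
    rw [this]; rfl
  simp only [spinDeriv, this, map_smul, smul_add, Finset.smul_sum]
  simp only [smul_comm c (_ : ℝ)]

/-- The space of smooth sections of the vector bundle associated with the spin structure and the
(`Spin₀(p,q)`-invariant) submodule `W` of the spinor module `S`. A section is given by its
components `s a : U a → W` (extended by zero to `M`) in the local spin frames. -/
def spinorFields {g : PseudoMetric I M p q} {ι : Type*} (σ : SpinStructure g ι)
    (ρ : Cl p q →ₐ[ℝ] Module.End 𝕜 S) (W : Submodule 𝕜 S) : Submodule 𝕜 (ι → M → S) where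
  carrier := {s | (∀ a x, s a x ∈ W) ∧ (∀ a, ∀ x ∉ σ.U a, s a x = 0) ∧
    (∀ a, ContMDiffOn I 𝓘(ℝ, S) ∞ (s a) (σ.U a)) ∧
    (∀ a b, ∀ x ∈ σ.U a ∩ σ.U b, s a x = ρ (σ.trans a b x) (s b x))}
  zero_mem' := ⟨fun _ _ => W.zero_mem, fun _ _ _ => rfl, fun _ => contMDiffOn_const,
    fun a b x _ => (map_zero (ρ (σ.trans a b x))).symm⟩
  add_mem' := by
    rintro s t ⟨hs1, hs2, hs3, hs4⟩ ⟨ht1, ht2, ht3, ht4⟩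
    refine ⟨fun a x => W.add_mem (hs1 a x) (ht1 a x), fun a x hx => ?_,
      fun a => (hs3 a).add (ht3 a), fun a b x hx => ?_⟩
    · simp [hs2 a x hx, ht2 a x hx]
    · simp [hs4 a b x hx, ht4 a b x hx]
  smul_mem' := by
    rintro c s ⟨hs1, hs2, hs3, hs4⟩
    refine ⟨fun a x => W.smul_mem c (hs1 a x), fun a x hx => ?_,
      fun a => contMDiffOn_smul c (hs3 a), fun a b x hx => ?_⟩
    · simp [hs2 a x hx]
    · simp [hs4 a b x hx]

theorem mdifferentiableAt_of_mem {g : PseudoMetric I M p q} {ι : Type*} {σ : SpinStructure g ι}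
    {ρ : Cl p q →ₐ[ℝ] Module.End 𝕜 S} {W : Submodule 𝕜 S} {s : ι → M → S}
    (hs : s ∈ spinorFields σ ρ W) {a : ι} {x : M} (hx : x ∈ σ.U a) :
    MDifferentiableAt I 𝓘(ℝ, S) (s a) x :=
  ((hs.2.2.1 a).contMDiffAt ((σ.isOpen_U a).mem_nhds hx)).mdifferentiableAt (by simp)

/-- The space of Killing spinors with Killing number `lam`: the sections `s` with
`∇_v s = lam v · s` for all tangent vectors `v`. For `lam = 0` these are the parallel sections. -/
def killingSpinors {g : PseudoMetric I M p q} {ι : Type*} (σ : SpinStructure g ι)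
    (ρ : Cl p q →ₐ[ℝ] Module.End 𝕜 S) (W : Submodule 𝕜 S) (lam : ℝ) :
    Submodule 𝕜 (ι → M → S) where
  carrier := {s | s ∈ spinorFields σ ρ W ∧ ∀ a, ∀ x ∈ σ.U a, ∀ v : TangentSpace I x,
    spinDeriv g (σ.frame a) ρ (s a) x v = lam • cliffordMul g (σ.frame a) ρ x v (s a x)}
  zero_mem' := by
    refine ⟨Submodule.zero_mem _, fun a x _ v => ?_⟩
    rw [cliffordMul, Pi.zero_apply, Pi.zero_apply, map_zero, smul_zero]
    exact spinDeriv_zero g _ ρ x v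
  add_mem' := by
    rintro s t ⟨hs, hs'⟩ ⟨ht, ht'⟩
    refine ⟨Submodule.add_mem _ hs ht, fun a x hx v => ?_⟩
    refine (spinDeriv_add g _ ρ v (mdifferentiableAt_of_mem hs hx)
      (mdifferentiableAt_of_mem ht hx)).trans ?_
    rw [hs' a x hx v, ht' a x hx v]
    simp [cliffordMul]
  smul_mem' := by
    rintro c s ⟨hs, hs'⟩
    refine ⟨Submodule.smul_mem _ c hs, fun a x hx v => ?_⟩
    refine (spinDeriv_smul g _ ρ c v (mdifferentiableAt_of_mem hs hx)).trans ?_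
    rw [hs' a x hx v, smul_comm c lam]
    simp [cliffordMul]

end Geometry

/-! ## The cone -/

section Cone

variable {E : Type*} [NormedAddCommGroup E] [NormedSpace ℝ E] {H : Type*} [TopologicalSpace H]
  {I : ModelWithCorners ℝ E H} {M : Type*} [TopologicalSpace M] [ChartedSpace H M]
  [IsManifold I ∞ M] {p q : ℕ}

/-- `ℝ⁺`, as an open submanifold of `ℝ`. -/
def posReal : TopologicalSpace.Opens ℝ := ⟨Set.Ioi 0, isOpen_Ioi⟩

/-- The point `1` of `ℝ⁺`. -/
def posOne : posReal := ⟨1, Set.mem_Ioi.2 one_pos⟩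

variable (M) in
/-- The manifold `ℝ⁺ × M`. Its tangent space at `(r,x)` is `ℝ × T_x M`. -/
abbrev ConeSpace : Type _ := posReal × M

variable (I) in
/-- The model of the manifold `ℝ⁺ × M`. -/
abbrev coneModel : ModelWithCorners ℝ (ℝ × E) (ModelProd ℝ H) := 𝓘(ℝ, ℝ).prod I

/-- The tangent vector `c ∂_r + v` of `ℝ⁺ × M`. -/
def coneVec (z : ConeSpace M) (c : ℝ) (v : TangentSpace I z.2) :
    TangentSpace (coneModel I) z := (c, v)

/-- The `∂_r`-component of a tangent vector of `ℝ⁺ × M`. -/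
def conePr (z : ConeSpace M) : TangentSpace (coneModel I) z →ₗ[ℝ] ℝ := LinearMap.fst ℝ ℝ E

/-- The component in `T_x M` of a tangent vector of `ℝ⁺ × M`. -/
def conePrM (z : ConeSpace M) : TangentSpace (coneModel I) z →ₗ[ℝ] TangentSpace I z.2 :=
  LinearMap.snd ℝ ℝ E

theorem trivializationAt_posReal (r₀ : posReal) (v : TangentBundle 𝓘(ℝ, ℝ) posReal) :
    (trivializationAt ℝ (TangentSpace 𝓘(ℝ, ℝ)) r₀ v).2 = v.2 :=
  tangentCoordChange_self (I := 𝓘(ℝ, ℝ)) (x := v.1) (z := v.1) (mem_extChartAt_source v.1)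

/-- The `∂_r`-component is a smooth function on the tangent bundle of `ℝ⁺`. -/
theorem contMDiff_posReal_comp :
    ContMDiff 𝓘(ℝ, ℝ).tangent 𝓘(ℝ, ℝ) ∞ (fun v : TangentBundle 𝓘(ℝ, ℝ) posReal => (v.2 : ℝ)) := by
  intro v
  have h := (Bundle.contMDiffAt_totalSpace (n := ∞) (IB := 𝓘(ℝ, ℝ)) (IM := 𝓘(ℝ, ℝ).tangent)
    (f := fun w : TangentBundle 𝓘(ℝ, ℝ) posReal => w) (x₀ := v)).1 contMDiffAt_id
  exact h.2.congr_of_eventuallyEq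
    (Filter.Eventually.of_forall fun w => (trivializationAt_posReal v.1 w).symm)

theorem contMDiff_posReal_section (c : ℝ) :
    ContMDiff 𝓘(ℝ, ℝ) 𝓘(ℝ, ℝ).tangent ∞
      (fun r : posReal => (⟨r, c⟩ : TangentBundle 𝓘(ℝ, ℝ) posReal)) := by
  intro r
  refine (Bundle.contMDiffAt_section (E := (TangentSpace 𝓘(ℝ, ℝ) : posReal → Type))
    (s := fun _ => c) r).2 ?_
  exact (contMDiffAt_const (c := c)).congr_of_eventuallyEq
    (Filter.Eventually.of_forall fun w => trivializationAt_posReal r ⟨w, c⟩)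

theorem contMDiff_posReal_val : ContMDiff 𝓘(ℝ, ℝ) 𝓘(ℝ, ℝ) ∞ (fun r : posReal => (r : ℝ)) :=
  contMDiff_subtype_val

@[simp] theorem conePr_coneVec (z : ConeSpace M) (c : ℝ) (v : TangentSpace I z.2) :
    conePr z (coneVec z c v) = c := rfl

@[simp] theorem conePrM_coneVec (z : ConeSpace M) (c : ℝ) (v : TangentSpace I z.2) :
    conePrM z (coneVec z c v) = v := rfl

theorem coneVec_eta (z : ConeSpace M) (w : TangentSpace (coneModel I) z) :
    coneVec z (conePr z w) (conePrM z w) = w := rfl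

theorem cone_pos (z : ConeSpace M) : (0 : ℝ) < (z.1 : ℝ) := z.1.2

/-- The frame `(∂_r, r⁻¹ e_1, …, r⁻¹ e_n)` on `ℝ⁺ × M`, orthonormal for the cone metric. -/
def coneFrame (e : Idx p q → ∀ x : M, TangentSpace I x) (i : Idx (p + 1) q) (z : ConeSpace M) :
    TangentSpace (coneModel I) z :=
  consIdx (coneVec z 1 0) (fun j => coneVec z 0 ((z.1 : ℝ)⁻¹ • e j z.2)) i

/-- The value `dr² + r² g` of the cone metric at a point. -/
def coneVal (g : PseudoMetric I M p q) (z : ConeSpace M) :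
    TangentSpace (coneModel I) z →ₗ[ℝ] TangentSpace (coneModel I) z →ₗ[ℝ] ℝ :=
  (LinearMap.mul ℝ ℝ).compl₁₂ (conePr z) (conePr z) +
    ((z.1 : ℝ) ^ 2) • (g.val z.2).compl₁₂ (conePrM z) (conePrM z)

theorem coneVal_apply (g : PseudoMetric I M p q) (z : ConeSpace M)
    (u v : TangentSpace (coneModel I) z) :
    coneVal g z u v =
      conePr z u * conePr z v + (z.1 : ℝ) ^ 2 * g.val z.2 (conePrM z u) (conePrM z v) := rfl

theorem coneVal_frame (g : PseudoMetric I M p q) (z : ConeSpace M)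
    (e : Idx p q → ∀ x : M, TangentSpace I x)
    (he : ∀ i j, g.val z.2 (e i z.2) (e j z.2) = if i = j then sgn i else 0)
    (i j : Idx (p + 1) q) :
    coneVal g z (coneFrame e i z) (coneFrame e j z) = if i = j then sgn i else 0 := by
  have hz := (cone_pos z).ne'
  rw [coneVal_apply]
  induction i using idx_cases with
  | h0 =>
    induction j using idx_cases with
    | h0 => simp [coneFrame]
    | hs j => simp [coneFrame, zeroIdx_ne_succIdx]
  | hs i =>
    induction j using idx_cases with
    | h0 => simp [coneFrame, (zeroIdx_ne_succIdx _).symm]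
    | hs j =>
      simp only [coneFrame, consIdx_succ, conePr_coneVec, conePrM_coneVec, map_smul,
        LinearMap.smul_apply, smul_eq_mul, he, succIdx_injective.eq_iff, sgn_succIdx]
      field_simp
      simp

/-- The cone metric `dr² + r² g` on `ℝ⁺ × M`, of signature `(p+1,q)`. -/
def coneMetric (g : PseudoMetric I M p q) :
    PseudoMetric (coneModel I) (ConeSpace M) (p + 1) q where
  val := coneVal g
  symm z u v := by
    rw [coneVal_apply, coneVal_apply, g.symm, mul_comm (conePr z u)]
  signature z := by
    obtain ⟨b, hb⟩ := g.signature z.2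
    have key := coneVal_frame g z (fun i _ => (b i : E)) hb
    have : Module.Finite ℝ E := Module.Finite.of_basis (b : Module.Basis (Idx p q) ℝ E)
    have hli : LinearIndependent ℝ (fun i => coneFrame (I := I) (fun i _ => (b i : E)) i z) := by
      rw [Fintype.linearIndependent_iff]
      intro c hc j
      have h := congrArg (fun w => coneVal g z w (coneFrame (I := I) (fun i _ => (b i : E)) j z)) hc
      simp only [map_sum, map_smul, LinearMap.sum_apply, LinearMap.smul_apply, key, map_zero,
        LinearMap.zero_apply, smul_eq_mul, mul_ite, mul_zero, Finset.sum_ite_eq',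
        Finset.mem_univ, if_true] at h
      have hs : sgn j ≠ 0 := by cases j <;> simp [sgn]
      exact (mul_eq_zero.1 h).resolve_right hs
    have hfr : Fintype.card (Idx (p + 1) q) = Module.finrank ℝ (TangentSpace (coneModel I) z) := by
      have hE : Module.finrank ℝ E = Fintype.card (Idx p q) := Module.finrank_eq_card_basis b
      change _ = Module.finrank ℝ (ℝ × E)
      rw [Module.finrank_prod, hE]
      simp; ring
    have : Module.Finite ℝ (TangentSpace (coneModel I) z) :=
      inferInstanceAs (Module.Finite ℝ (ℝ × E))
    refine ⟨basisOfLinearIndependentOfCardEqFinrank hli hfr, fun i j => ?_⟩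
    rw [coe_basisOfLinearIndependentOfCardEqFinrank]
    exact key i j
  smooth := by
    have h := contMDiff_equivTangentBundleProd (n := ∞) (I := 𝓘(ℝ, ℝ)) (M := posReal) (I' := I)
      (M' := M)
    have h1 := contMDiff_posReal_comp.comp (contMDiff_fst.comp h)
    have h2 := g.smooth.comp (contMDiff_snd.comp h)
    have h3 : ContMDiff (coneModel I).tangent 𝓘(ℝ, ℝ) ∞
        (fun v : TangentBundle (coneModel I) (ConeSpace M) => (v.1.1 : ℝ)) :=
      contMDiff_posReal_val.comp (contMDiff_fst.comp (Bundle.contMDiff_proj _))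
    exact (h1.mul h1).add ((h3.pow 2).mul h2)

/-- The coordinates of a tangent vector of the cone in the frame `(∂_r, r⁻¹ e_1, …, r⁻¹ e_n)`. -/
theorem coord_coneFrame (g : PseudoMetric I M p q) (z : ConeSpace M)
    (e : Idx p q → ∀ x : M, TangentSpace I x) (w : TangentSpace (coneModel I) z) :
    coord (coneMetric g) (coneFrame e) z w =
      conePr z w • Pi.single zeroIdx 1 + (z.1 : ℝ) • consIdx 0 (coord g e z.2 (conePrM z w)) := by
  have hz := (cone_pos z).ne'
  funext i
  change sgn i * coneVal g z w (coneFrame e i z) = _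
  rw [coneVal_apply]
  induction i using idx_cases with
  | h0 => simp [coneFrame]
  | hs i =>
    simp [coneFrame, coord, (zeroIdx_ne_succIdx _).symm]
    field_simp

theorem contMDiffOn_coneVec {u : Set M} (c : ℝ) (X : ∀ x : M, TangentSpace I x)
    (hX : ContMDiffOn I I.tangent ∞ (fun x => (⟨x, X x⟩ : TangentBundle I M)) u) :
    ContMDiffOn (coneModel I) (coneModel I).tangent ∞
      (fun z => (⟨z, coneVec z c (X z.2)⟩ : TangentBundle (coneModel I) (ConeSpace M)))
      {z | z.2 ∈ u} := by
  have h := contMDiff_equivTangentBundleProd_symm (n := ∞) (I := 𝓘(ℝ, ℝ)) (M := posReal) (I' := I)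
      (M' := M)
  have h1 : ContMDiffOn (coneModel I) 𝓘(ℝ, ℝ).tangent ∞
      (fun z : ConeSpace M => (⟨z.1, c⟩ : TangentBundle 𝓘(ℝ, ℝ) posReal)) {z | z.2 ∈ u} :=
    ((contMDiff_posReal_section c).comp contMDiff_fst).contMDiffOn
  have h2 : ContMDiffOn (coneModel I) I.tangent ∞
      (fun z : ConeSpace M => (⟨z.2, X z.2⟩ : TangentBundle I M)) {z | z.2 ∈ u} :=
    hX.comp contMDiff_snd.contMDiffOn (fun z hz => hz)
  exact h.comp_contMDiffOn (h1.prodMk h2)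

theorem contMDiffOn_coneFrame {u : Set M} (e : Idx p q → ∀ x : M, TangentSpace I x)
    (he : ∀ i, ContMDiffOn I I.tangent ∞ (fun x => (⟨x, e i x⟩ : TangentBundle I M)) u)
    (i : Idx (p + 1) q) :
    ContMDiffOn (coneModel I) (coneModel I).tangent ∞
      (fun z => (⟨z, coneFrame e i z⟩ : TangentBundle (coneModel I) (ConeSpace M)))
      {z | z.2 ∈ u} := by
  induction i using idx_cases with
  | h0 =>
    refine contMDiffOn_coneVec 1 (fun _ => 0) ?_
    exact (Bundle.contMDiff_zeroSection ℝ (TangentSpace I : M → Type _)).contMDiffOn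
  | hs i =>
    have h1 := contMDiffOn_coneVec 0 (e i) (he i)
    have h2 : ContMDiffOn (coneModel I) 𝓘(ℝ, ℝ) ∞ (fun z : ConeSpace M => (z.1 : ℝ)⁻¹)
        {z | z.2 ∈ u} := by
      have : ContMDiffOn (coneModel I) 𝓘(ℝ, ℝ) ∞ (fun z : ConeSpace M => (z.1 : ℝ))
          {z | z.2 ∈ u} := (contMDiff_posReal_val.comp contMDiff_fst).contMDiffOn
      exact this.inv₀ fun z _ => (cone_pos z).ne'
    refine (h2.smul_section h1).congr fun z _ => ?_
    refine congrArg (Bundle.TotalSpace.mk z) ?_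
    rw [coneFrame, consIdx_succ]
    refine Prod.ext ?_ rfl
    exact (mul_zero (z.1 : ℝ)⁻¹).symm

/-- The spin structure induced on the cone: over `ℝ⁺ × U a` one takes the frame
`(∂_r, r⁻¹ e_1, …, r⁻¹ e_n)`, and the transition functions are pulled back from `M`, considered
with values in `Spin₀(p,q) ⊂ Spin₀(p+1,q)`. -/
def coneSpin {g : PseudoMetric I M p q} {ι : Type*} (σ : SpinStructure g ι) :
    SpinStructure (coneMetric g) ι where
  U a := {z | z.2 ∈ σ.U a}
  isOpen_U a := (σ.isOpen_U a).preimage continuous_snd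
  cover z := σ.cover z.2
  frame a := coneFrame (σ.frame a)
  frame_smooth a i := contMDiffOn_coneFrame _ (σ.frame_smooth a) i
  frame_orthonormal a z hz i j := coneVal_frame g z _ (σ.frame_orthonormal a z.2 hz) i j
  trans a b z := inclCl p q (σ.trans a b z.2)
  trans_mem a b z hz := inclCl_mem_spin (σ.trans_mem a b z.2 hz)
  trans_smooth a b l :=
    (σ.trans_smooth a b (l.comp (inclCl p q).toLinearMap)).comp contMDiff_snd.contMDiffOn
      (fun z hz => hz)
  trans_frame a b z hz w := by
    have h := congrArg (inclCl p q) (σ.trans_frame a b z.2 hz (conePrM z w))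
    rw [map_mul, map_mul, inclCl_vec, inclCl_vec] at h
    have h0 := gen_zero_comm_of_spin (σ.trans_mem a b z.2 hz)
    rw [coord_coneFrame, coord_coneFrame, map_add, map_add, map_smul, map_smul, map_smul,
      mul_add, add_mul, mul_smul_comm, mul_smul_comm, smul_mul_assoc, smul_mul_assoc, h]
    congr 2
    exact h0.symm
  trans_cocycle a b c z hz := by
    rw [← map_mul, σ.trans_cocycle a b c z.2 hz]

/-! ## Restriction of spinors from the cone to `M` -/

variable {𝕜 : Type*} [RCLike 𝕜] {S : Type*} [NormedAddCommGroup S] [NormedSpace ℝ S]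
  [NormedSpace 𝕜 S] [IsScalarTower ℝ 𝕜 S] {S' : Type*} [NormedAddCommGroup S'] [NormedSpace ℝ S']
  [NormedSpace 𝕜 S'] [IsScalarTower ℝ 𝕜 S']

/-- `Φ` restricts to an isomorphism from the submodule `W` of the spinor module of `ℝ^{p+1,q}` onto
the spinor module of `ℝ^{p,q}` which, up to the sign `ε`, is compatible with the isomorphism
`Cl⁰_{p+1,q} ≅ Cl_{p,q}`, `e_i e_0 ↦ e_i`. (In particular `Φ` commutes with
`Spin₀(p,q) ⊂ Spin₀(p+1,q)`, since `e_i e_j = (e_i e_0) (e_j e_0)`.) It induces the identification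
of the bundle associated with `W`, restricted to `M = {1} × M`, with the spinor bundle of `M`. -/
structure IsIdentification (ρ : Cl p q →ₐ[ℝ] Module.End 𝕜 S)
    (ρ' : Cl (p + 1) q →ₐ[ℝ] Module.End 𝕜 S') (W : Submodule 𝕜 S') (ε : ℝ)
    (Φ : S' →ₗ[𝕜] S) : Prop where
  bijOn : Set.BijOn Φ (W : Set S') Set.univ
  map_mul : ∀ i : Idx p q, ∀ w ∈ W,
    Φ (ρ' (gen (succIdx i) * gen zeroIdx) w) = ε • ρ (gen i) (Φ w)

/-- Restriction to `M = {1} × M` (followed by `Φ`) defines an isomorphism from the space of parallel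
sections on the cone of the bundle associated with `W` onto the space of Killing spinors on `M`
with Killing number `lam`. -/
def RestrictionIsIso {g : PseudoMetric I M p q} {ι : Type*} (σ : SpinStructure g ι)
    (ρ : Cl p q →ₐ[ℝ] Module.End 𝕜 S) (ρ' : Cl (p + 1) q →ₐ[ℝ] Module.End 𝕜 S')
    (W : Submodule 𝕜 S') (Φ : S' →ₗ[𝕜] S) (lam : ℝ) : Prop :=
  ∃ f : killingSpinors (coneSpin σ) ρ' W 0 ≃ₗ[𝕜] killingSpinors σ ρ ⊤ lam,
    ∀ (s : killingSpinors (coneSpin σ) ρ' W 0) (a : ι) (x : M),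
      (f s : ι → M → S) a x = Φ ((s : ι → ConeSpace M → S') a (posOne, x))

/-- The bundle associated with `W`, restricted to `M`, can be identified with the spinor bundle of
`M` (with sign `ε`), and under every such identification restriction to `M` defines an isomorphism
from the parallel sections on the cone onto the Killing spinors on `M` with Killing number
`ε / 2`. -/
def RestrictsToKilling {g : PseudoMetric I M p q} {ι : Type*} (σ : SpinStructure g ι)
    (ρ : Cl p q →ₐ[ℝ] Module.End 𝕜 S) (ρ' : Cl (p + 1) q →ₐ[ℝ] Module.End 𝕜 S')
    (W : Submodule 𝕜 S') (ε : ℝ) : Prop :=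
  (∃ Φ : S' →ₗ[𝕜] S, IsIdentification ρ ρ' W ε Φ) ∧
    ∀ Φ : S' →ₗ[𝕜] S, IsIdentification ρ ρ' W ε Φ → RestrictionIsIso σ ρ ρ' W Φ (ε / 2)

end Cone

end ConeSpin

end

open scoped Manifold ContDiff Topology
open VectorField

set_option linter.unusedSectionVars false

noncomputable section

namespace ConeSpin

section LieBracketProd

variable {E₁ : Type*} [NormedAddCommGroup E₁] [NormedSpace ℝ E₁]
  {H₁ : Type*} [TopologicalSpace H₁] {I₁ : ModelWithCorners ℝ E₁ H₁} {M₁ : Type*}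
  [TopologicalSpace M₁] [ChartedSpace H₁ M₁]
  {E₂ : Type*} [NormedAddCommGroup E₂] [NormedSpace ℝ E₂]
  {H₂ : Type*} [TopologicalSpace H₂] {I₂ : ModelWithCorners ℝ E₂ H₂} {M₂ : Type*}
  [TopologicalSpace M₂] [ChartedSpace H₂ M₂]

/-- The vector field on a product of manifolds whose components are vector fields on the
factors. -/
def prodField (X₁ : ∀ x : M₁, TangentSpace I₁ x) (X₂ : ∀ x : M₂, TangentSpace I₂ x)
    (z : M₁ × M₂) : TangentSpace (I₁.prod I₂) z := (X₁ z.1, X₂ z.2)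

theorem inverse_prodMap {f₁ : E₁ →L[ℝ] E₁} {f₂ : E₂ →L[ℝ] E₂} (h₁ : f₁.IsInvertible)
    (h₂ : f₂.IsInvertible) : (f₁.prodMap f₂).inverse = f₁.inverse.prodMap f₂.inverse := by
  obtain ⟨e₁, rfl⟩ := h₁
  obtain ⟨e₂, rfl⟩ := h₂
  change ((e₁.prodCongr e₂ : E₁ × E₂ →L[ℝ] E₁ × E₂)).inverse = _
  simp only [ContinuousLinearMap.inverse_equiv]
  rfl

/-- A vector field in the chart at `x`. -/
def chartField (x : M₁) (X : ∀ x : M₁, TangentSpace I₁ x) : E₁ → E₁ :=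
  mpullbackWithin 𝓘(ℝ, E₁) I₁ (extChartAt I₁ x).symm X (Set.range I₁)

theorem mlieBracket_eq_chart [I₁.Boundaryless] [IsManifold I₁ 1 M₁]
    (X Y : ∀ x : M₁, TangentSpace I₁ x) (x : M₁) :
    mlieBracket I₁ X Y x =
      lieBracket ℝ (chartField x X) (chartField x Y) (extChartAt I₁ x x) := by
  have h : (mfderiv I₁ 𝓘(ℝ, E₁) (extChartAt I₁ x) x : E₁ →L[ℝ] E₁) = ContinuousLinearMap.id ℝ E₁ :=
    mfderiv_extChartAt_self
  refine (congrArg (fun L : E₁ →L[ℝ] E₁ => L.inverse (lieBracketWithin ℝ (chartField x X)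
    (chartField x Y) ((extChartAt I₁ x).symm ⁻¹' Set.univ ∩ Set.range I₁)
    (extChartAt I₁ x x))) h).trans ?_
  rw [ContinuousLinearMap.inverse_id, Set.preimage_univ, Set.univ_inter, I₁.range_eq_univ,
    lieBracketWithin_univ]
  rfl

theorem chartField_prod [I₁.Boundaryless] [IsManifold I₁ 1 M₁] [I₂.Boundaryless]
    [IsManifold I₂ 1 M₂] (X₁ : ∀ x : M₁, TangentSpace I₁ x) (X₂ : ∀ x : M₂, TangentSpace I₂ x)
    (z : M₁ × M₂) :
    chartField z (prodField X₁ X₂) =ᶠ[𝓝 (extChartAt (I₁.prod I₂) z z)]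
      fun y => (chartField z.1 X₁ y.1, chartField z.2 X₂ y.2) := by
  filter_upwards [extChartAt_target_mem_nhds (I := I₁.prod I₂) z] with y hy
  rw [extChartAt_prod] at hy
  have hy1 : y.1 ∈ (extChartAt I₁ z.1).target := hy.1
  have hy2 : y.2 ∈ (extChartAt I₂ z.2).target := hy.2
  have d1 := mdifferentiableWithinAt_extChartAt_symm (I := I₁) hy1
  have d2 := mdifferentiableWithinAt_extChartAt_symm (I := I₂) hy2
  have i1 := isInvertible_mfderivWithin_extChartAt_symm (I := I₁) hy1
  have i2 := isInvertible_mfderivWithin_extChartAt_symm (I := I₂) hy2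
  have i := inverse_prodMap (E₁ := E₁) (E₂ := E₂) i1 i2
  unfold chartField
  simp only [mpullbackWithin_apply, I₁.range_eq_univ, I₂.range_eq_univ,
    (I₁.prod I₂).range_eq_univ, mfderivWithin_univ, mdifferentiableWithinAt_univ] at *
  have key : HasMFDerivAt (𝓘(ℝ, E₁ × E₂)) (I₁.prod I₂) (extChartAt (I₁.prod I₂) z).symm y
      ((mfderiv 𝓘(ℝ, E₁) I₁ (extChartAt I₁ z.1).symm y.1).prodMap
        (mfderiv 𝓘(ℝ, E₂) I₂ (extChartAt I₂ z.2).symm y.2)) := by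
    rw [extChartAt_prod, modelWithCornersSelf_prod, ← chartedSpaceSelf_prod]
    exact d1.hasMFDerivAt.prodMap d2.hasMFDerivAt
  rw [key.mfderiv]
  refine (congrArg (fun L : E₁ × E₂ →L[ℝ] E₁ × E₂ =>
    L (prodField X₁ X₂ ((extChartAt (I₁.prod I₂) z).symm y))) i).trans ?_
  rw [extChartAt_prod]
  rfl

theorem differentiableAt_chartField [I₁.Boundaryless] [IsManifold I₁ 2 M₁] [CompleteSpace E₁]
    {X : ∀ x : M₁, TangentSpace I₁ x} {x : M₁}
    (hX : MDifferentiableAt I₁ I₁.tangent (fun x => (⟨x, X x⟩ : TangentBundle I₁ M₁)) x) :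
    DifferentiableAt ℝ (chartField x X) (extChartAt I₁ x x) := by
  have : DifferentiableWithinAt ℝ (chartField x X)
      ((extChartAt I₁ x).symm ⁻¹' Set.univ ∩ Set.range I₁) (extChartAt I₁ x x) :=
    (mdifferentiableWithinAt_univ.2 hX).differentiableWithinAt_mpullbackWithin_vectorField
  rw [Set.preimage_univ, Set.univ_inter, I₁.range_eq_univ, differentiableWithinAt_univ] at this
  exact this

theorem mlieBracket_prodField [I₁.Boundaryless] [IsManifold I₁ 2 M₁] [I₂.Boundaryless]
    [IsManifold I₂ 2 M₂] [CompleteSpace E₁] [CompleteSpace E₂] [IsManifold (I₁.prod I₂) 1 (M₁ × M₂)]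
    [IsManifold I₁ 1 M₁] [IsManifold I₂ 1 M₂]
    {X₁ Y₁ : ∀ x : M₁, TangentSpace I₁ x}
    {X₂ Y₂ : ∀ x : M₂, TangentSpace I₂ x} (z : M₁ × M₂)
    (hX₁ : MDifferentiableAt I₁ I₁.tangent (fun x => (⟨x, X₁ x⟩ : TangentBundle I₁ M₁)) z.1)
    (hY₁ : MDifferentiableAt I₁ I₁.tangent (fun x => (⟨x, Y₁ x⟩ : TangentBundle I₁ M₁)) z.1)
    (hX₂ : MDifferentiableAt I₂ I₂.tangent (fun x => (⟨x, X₂ x⟩ : TangentBundle I₂ M₂)) z.2)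
    (hY₂ : MDifferentiableAt I₂ I₂.tangent (fun x => (⟨x, Y₂ x⟩ : TangentBundle I₂ M₂)) z.2) :
    mlieBracket (I₁.prod I₂) (prodField X₁ X₂) (prodField Y₁ Y₂) z =
      prodField (mlieBracket I₁ X₁ Y₁) (mlieBracket I₂ X₂ Y₂) z := by
  rw [mlieBracket_eq_chart, (chartField_prod X₁ X₂ z).lieBracket_vectorField_eq
    (chartField_prod Y₁ Y₂ z), prodField, mlieBracket_eq_chart, mlieBracket_eq_chart, lieBracket]
  have aux : ∀ {V : E₁ → E₁} {W : E₂ → E₂} {a : E₁ × E₂} (v : E₁ × E₂), DifferentiableAt ℝ V a.1 →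
      DifferentiableAt ℝ W a.2 → fderiv ℝ (fun y : E₁ × E₂ => (V y.1, W y.2)) a v =
        (fderiv ℝ V a.1 v.1, fderiv ℝ W a.2 v.2) := by
    intro V W a v hV hW
    have := (hV.hasFDerivAt.prodMap a hW.hasFDerivAt).fderiv
    exact congrArg (fun L => L v) this
  have e : extChartAt (I₁.prod I₂) z z = (extChartAt I₁ z.1 z.1, extChartAt I₂ z.2 z.2) := by
    rw [extChartAt_prod]; rfl
  rw [e, aux _ (differentiableAt_chartField hY₁) (differentiableAt_chartField hY₂),
    aux _ (differentiableAt_chartField hX₁) (differentiableAt_chartField hX₂)]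
  rfl

end LieBracketProd

section ConeBracket

variable {E : Type*} [NormedAddCommGroup E] [NormedSpace ℝ E] {H : Type*} [TopologicalSpace H]
  {I : ModelWithCorners ℝ E H} {M : Type*} [TopologicalSpace M] [ChartedSpace H M]
  [IsManifold I ∞ M] {p q : ℕ}

theorem hasMFDerivAt_posReal_val (r : posReal) :
    HasMFDerivAt 𝓘(ℝ, ℝ) 𝓘(ℝ, ℝ) (fun r : posReal => (r : ℝ)) r (ContinuousLinearMap.id ℝ ℝ) := by
  have h : MDifferentiableAt 𝓘(ℝ, ℝ) 𝓘(ℝ, ℝ) (fun r : posReal => (r : ℝ)) r :=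
    (contMDiff_posReal_val r).mdifferentiableAt (by simp)
  have h' := h.hasMFDerivAt
  have e : mfderiv 𝓘(ℝ, ℝ) 𝓘(ℝ, ℝ) (fun r : posReal => (r : ℝ)) r = ContinuousLinearMap.id ℝ ℝ :=
    mfderiv_extChartAt_self (I := 𝓘(ℝ, ℝ)) (x := r)
  rwa [e] at h'

theorem hasMFDerivAt_cone_inv (z : ConeSpace M) :
    HasMFDerivAt (coneModel I) 𝓘(ℝ, ℝ) (fun z : ConeSpace M => (z.1 : ℝ)⁻¹) z
      ((-((z.1 : ℝ) ^ 2)⁻¹) • ContinuousLinearMap.fst ℝ ℝ E) := by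
  have h1 := (hasMFDerivAt_posReal_val z.1).comp z (hasMFDerivAt_fst (I := 𝓘(ℝ, ℝ)) (I' := I) z)
  have h2 := (hasDerivAt_inv (cone_pos z).ne').hasFDerivAt.hasMFDerivAt.comp z h1
  refine h2.congr_mfderiv ?_
  refine ContinuousLinearMap.ext fun w => ?_
  change (w : ℝ × E).1 * (-((z.1 : ℝ) ^ 2)⁻¹) = (-((z.1 : ℝ) ^ 2)⁻¹) * (w : ℝ × E).1
  ring

theorem mvfderiv_cone_inv (z : ConeSpace M) (w : TangentSpace (coneModel I) z) :
    mvfderiv (coneModel I) (fun z : ConeSpace M => (z.1 : ℝ)⁻¹) z w =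
      -((z.1 : ℝ) ^ 2)⁻¹ * conePr z w := by
  have h := (hasMFDerivAt_cone_inv (I := I) z).mfderiv
  exact congrArg (fun L : ℝ × E →L[ℝ] ℝ => L w) h

theorem smul_coneVec (z : ConeSpace M) (a c : ℝ) (v : TangentSpace I z.2) :
    a • coneVec z c v = coneVec z (a * c) (a • v) := rfl

theorem add_coneVec (z : ConeSpace M) (c d : ℝ) (v w : TangentSpace I z.2) :
    coneVec z c v + coneVec z d w = coneVec z (c + d) (v + w) := rfl

theorem mdifferentiableAt_coneVec (c : ℝ) (X : ∀ x : M, TangentSpace I x) (z : ConeSpace M)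
    (hX : ContMDiffAt I I.tangent ∞ (fun x => (⟨x, X x⟩ : TangentBundle I M)) z.2) :
    MDifferentiableAt (coneModel I) (coneModel I).tangent
      (fun z => (⟨z, coneVec z c (X z.2)⟩ : TangentBundle (coneModel I) (ConeSpace M))) z := by
  have h := contMDiff_equivTangentBundleProd_symm (n := ∞) (I := 𝓘(ℝ, ℝ)) (M := posReal) (I' := I)
      (M' := M)
  have h1 : ContMDiffAt (coneModel I) 𝓘(ℝ, ℝ).tangent ∞
      (fun z : ConeSpace M => (⟨z.1, c⟩ : TangentBundle 𝓘(ℝ, ℝ) posReal)) z :=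
    ((contMDiff_posReal_section c).comp contMDiff_fst).contMDiffAt
  have h2 : ContMDiffAt (coneModel I) I.tangent ∞
      (fun z : ConeSpace M => (⟨z.2, X z.2⟩ : TangentBundle I M)) z :=
    hX.comp z contMDiffAt_snd
  exact (h.contMDiffAt.comp z (h1.prodMk h2)).mdifferentiableAt (by simp)

variable [I.Boundaryless] [CompleteSpace E]

theorem mlieBracket_coneVec (c d : ℝ) (hc : c = d ∨ c = 0 ∨ d = 0)
    (X Y : ∀ x : M, TangentSpace I x) (z : ConeSpace M)
    (hX : ContMDiffAt I I.tangent ∞ (fun x => (⟨x, X x⟩ : TangentBundle I M)) z.2)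
    (hY : ContMDiffAt I I.tangent ∞ (fun x => (⟨x, Y x⟩ : TangentBundle I M)) z.2) :
    mlieBracket (coneModel I) (fun z => coneVec z c (X z.2)) (fun z => coneVec z d (Y z.2)) z =
      coneVec z 0 (mlieBracket I X Y z.2) := by
  have : IsManifold I 2 M := IsManifold.of_le (n := ∞) (by norm_cast)
  have : IsManifold I 1 M := IsManifold.of_le (n := ∞) (by norm_cast)
  have : IsManifold (coneModel I) 1 (ConeSpace M) := IsManifold.of_le (n := ∞) (by norm_cast)
  refine (mlieBracket_prodField (I₁ := 𝓘(ℝ, ℝ)) (M₁ := posReal) (I₂ := I) (M₂ := M) 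
    (X₁ := fun _ => c) (Y₁ := fun _ => d) (X₂ := X) (Y₂ := Y) z
    ((contMDiff_posReal_section c _).mdifferentiableAt (by simp))
    ((contMDiff_posReal_section d _).mdifferentiableAt (by simp))
    (hX.mdifferentiableAt (by simp)) (hY.mdifferentiableAt (by simp))).trans ?_
  refine Prod.ext ?_ rfl
  change mlieBracket 𝓘(ℝ, ℝ) (fun r : posReal => c) (fun r => d) z.1 = (0 : ℝ)
  rcases hc with rfl | rfl | rfl
  · exact congrFun mlieBracket_self z.1
  · exact congrFun mlieBracket_zero_left z.1
  · exact congrFun mlieBracket_zero_right z.1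

theorem coneFrame_succ (e : Idx p q → ∀ x : M, TangentSpace I x) (i : Idx p q) :
    coneFrame e (succIdx i) =
      (fun z : ConeSpace M => (z.1 : ℝ)⁻¹) • (fun z => coneVec z 0 (e i z.2)) := by
  funext z
  rw [coneFrame, consIdx_succ]
  exact Prod.ext (mul_zero (z.1 : ℝ)⁻¹).symm rfl

theorem mlieBracket_coneFrame_zero_succ (e : Idx p q → ∀ x : M, TangentSpace I x) (i : Idx p q)
    (z : ConeSpace M)
    (he : ContMDiffAt I I.tangent ∞ (fun x => (⟨x, e i x⟩ : TangentBundle I M)) z.2) :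
    mlieBracket (coneModel I) (coneFrame e zeroIdx) (coneFrame e (succIdx i)) z =
      -(z.1 : ℝ)⁻¹ • coneFrame e (succIdx i) z := by
  have : IsManifold (coneModel I) 2 (ConeSpace M) := IsManifold.of_le (n := ∞) (by norm_cast)
  have h0 : ContMDiffAt I I.tangent ∞ (fun x => (⟨x, 0⟩ : TangentBundle I M)) z.2 :=
    (Bundle.contMDiff_zeroSection ℝ (TangentSpace I : M → Type _)).contMDiffAt
  rw [coneFrame_succ, mlieBracket_smul_right (hasMFDerivAt_cone_inv z).mdifferentiableAt
    (mdifferentiableAt_coneVec 0 _ z he)]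
  have h1 : mlieBracket (coneModel I) (coneFrame e zeroIdx) (fun z => coneVec z 0 (e i z.2)) z =
      coneVec z 0 (mlieBracket I 0 (e i) z.2) :=
    mlieBracket_coneVec 1 0 (Or.inr (Or.inr rfl)) _ _ z h0 he
  rw [h1, mlieBracket_zero_left, mvfderiv_cone_inv]
  simp only [coneFrame, consIdx_zero, conePr_coneVec, smul_coneVec, add_coneVec, Pi.smul_apply',
    Pi.zero_apply, smul_zero, mul_zero, add_zero, mul_one, smul_smul]
  congr 2
  ring

theorem mlieBracket_coneFrame_succ_succ (e : Idx p q → ∀ x : M, TangentSpace I x) (i j : Idx p q)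
    (z : ConeSpace M)
    (hi : ContMDiffAt I I.tangent ∞ (fun x => (⟨x, e i x⟩ : TangentBundle I M)) z.2)
    (hj : ContMDiffAt I I.tangent ∞ (fun x => (⟨x, e j x⟩ : TangentBundle I M)) z.2) :
    mlieBracket (coneModel I) (coneFrame e (succIdx i)) (coneFrame e (succIdx j)) z =
      coneVec z 0 (((z.1 : ℝ) ^ 2)⁻¹ • mlieBracket I (e i) (e j) z.2) := by
  have : IsManifold (coneModel I) 2 (ConeSpace M) := IsManifold.of_le (n := ∞) (by norm_cast)
  rw [coneFrame_succ, coneFrame_succ,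
    mlieBracket_smul_left (hasMFDerivAt_cone_inv z).mdifferentiableAt
      (mdifferentiableAt_coneVec 0 _ z hi),
    mlieBracket_smul_right (hasMFDerivAt_cone_inv z).mdifferentiableAt
      (mdifferentiableAt_coneVec 0 _ z hj),
    mlieBracket_coneVec 0 0 (Or.inl rfl) _ _ z hi hj, mvfderiv_cone_inv, mvfderiv_cone_inv]
  simp only [Pi.smul_apply', conePr_coneVec, smul_coneVec, mul_zero, neg_zero,
    zero_smul, zero_add, smul_smul]
  congr 2
  ring

theorem koszul_of_orthonormal {p q : ℕ} (g : PseudoMetric I M p q)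
    (e : Idx p q → ∀ x : M, TangentSpace I x) {x : M}
    (he : ∀ᶠ y in 𝓝 x, ∀ i j, g.val y (e i y) (e j y) = if i = j then sgn i else 0)
    (i j k : Idx p q) :
    koszul g (e i) (e j) (e k) x = (1 / 2) * (g.val x (mlieBracket I (e i) (e j) x) (e k x)
      - g.val x (mlieBracket I (e j) (e k) x) (e i x)
      + g.val x (mlieBracket I (e k) (e i) x) (e j x)) := by
  have h : ∀ (i j : Idx p q) (v : TangentSpace I x),
      dirDeriv (fun y => g.val y (e i y) (e j y)) x v = 0 := by
    intro i j v
    have : (fun y => g.val y (e i y) (e j y)) =ᶠ[𝓝 x] fun _ => if i = j then sgn i else 0 :=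
      he.mono fun y hy => hy i j
    rw [dirDeriv, this.mfderiv_eq, mfderiv_const]
    rfl
  rw [koszul, h, h, h]
  ring

end ConeBracket

section ConeConnection

variable {E : Type*} [NormedAddCommGroup E] [NormedSpace ℝ E] {H : Type*} [TopologicalSpace H]
  {I : ModelWithCorners ℝ E H} {M : Type*} [TopologicalSpace M] [ChartedSpace H M]
  [IsManifold I ∞ M] {p q : ℕ}

/-- The family `e` is a smooth orthonormal frame near the point `x`. -/
structure IsLocalFrame (g : PseudoMetric I M p q) (e : Idx p q → ∀ x : M, TangentSpace I x)
    (x : M) : Prop where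
  smooth : ∀ i, ContMDiffAt I I.tangent ∞ (fun x => (⟨x, e i x⟩ : TangentBundle I M)) x
  orthonormal : ∀ᶠ y in 𝓝 x, ∀ i j, g.val y (e i y) (e j y) = if i = j then sgn i else 0

theorem SpinStructure.isLocalFrame {g : PseudoMetric I M p q} {ι : Type*} (σ : SpinStructure g ι)
    {a : ι} {x : M} (hx : x ∈ σ.U a) : IsLocalFrame g (σ.frame a) x :=
  have hU := (σ.isOpen_U a).mem_nhds hx
  ⟨fun i => (σ.frame_smooth a i).contMDiffAt hU,
    Filter.eventually_of_mem hU fun y hy => σ.frame_orthonormal a y hy⟩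

theorem coord_coneFrame_succ (g : PseudoMetric I M p q) (z : ConeSpace M)
    (e : Idx p q → ∀ x : M, TangentSpace I x) (w : TangentSpace (coneModel I) z) (i : Idx p q) :
    coord (coneMetric g) (coneFrame e) z w (succIdx i) =
      (z.1 : ℝ) * coord g e z.2 (conePrM z w) i := by
  rw [coord_coneFrame]
  simp [(zeroIdx_ne_succIdx i).symm]

variable [I.Boundaryless] [CompleteSpace E] {g : PseudoMetric I M p q}
  {e : Idx p q → ∀ x : M, TangentSpace I x} {z : ConeSpace M}

theorem koszul_coneFrame (h : IsLocalFrame g e z.2) (i j k : Idx (p + 1) q) :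
    koszul (coneMetric g) (coneFrame e i) (coneFrame e j) (coneFrame e k) z = (1 / 2) *
      (coneVal g z (mlieBracket (coneModel I) (coneFrame e i) (coneFrame e j) z) (coneFrame e k z)
      - coneVal g z (mlieBracket (coneModel I) (coneFrame e j) (coneFrame e k) z) (coneFrame e i z)
      + coneVal g z (mlieBracket (coneModel I) (coneFrame e k) (coneFrame e i) z)
        (coneFrame e j z)) :=
  koszul_of_orthonormal (coneMetric g) (coneFrame e)
    ((continuousAt_snd.eventually h.orthonormal).mono fun y hy => coneVal_frame g y e hy) i j k

theorem coneVal_bracket_zero_succ (h : IsLocalFrame g e z.2) (i : Idx p q) (k : Idx (p + 1) q) :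
    coneVal g z (mlieBracket (coneModel I) (coneFrame e zeroIdx) (coneFrame e (succIdx i)) z)
      (coneFrame e k z) = if succIdx i = k then -(z.1 : ℝ)⁻¹ * sgn i else 0 := by
  rw [mlieBracket_coneFrame_zero_succ e i z (h.smooth i), map_smul, LinearMap.smul_apply,
    coneVal_frame g z e h.orthonormal.self_of_nhds, sgn_succIdx]
  simp

theorem coneVal_bracket_succ_zero (h : IsLocalFrame g e z.2) (i : Idx p q) (k : Idx (p + 1) q) :
    coneVal g z (mlieBracket (coneModel I) (coneFrame e (succIdx i)) (coneFrame e zeroIdx) z)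
      (coneFrame e k z) = if succIdx i = k then (z.1 : ℝ)⁻¹ * sgn i else 0 := by
  rw [mlieBracket_swap_apply, map_neg, LinearMap.neg_apply, coneVal_bracket_zero_succ h]
  split_ifs <;> ring

theorem coneVal_bracket_zero_zero (v : TangentSpace (coneModel I) z) :
    coneVal g z
      (mlieBracket (coneModel I) (coneFrame e zeroIdx) (coneFrame e zeroIdx) z) v = 0 := by
  rw [mlieBracket_self, Pi.zero_apply, map_zero, LinearMap.zero_apply]

theorem coneVal_bracket_succ_succ_zero (h : IsLocalFrame g e z.2) (i j : Idx p q) :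
    coneVal g z (mlieBracket (coneModel I) (coneFrame e (succIdx i)) (coneFrame e (succIdx j)) z)
      (coneFrame e zeroIdx z) = 0 := by
  rw [mlieBracket_coneFrame_succ_succ e i j z (h.smooth i) (h.smooth j), coneVal_apply]
  simp [coneFrame]

theorem coneVal_bracket_succ_succ_succ (h : IsLocalFrame g e z.2) (i j k : Idx p q) :
    coneVal g z (mlieBracket (coneModel I) (coneFrame e (succIdx i)) (coneFrame e (succIdx j)) z)
      (coneFrame e (succIdx k) z) =
        (z.1 : ℝ)⁻¹ * g.val z.2 (mlieBracket I (e i) (e j) z.2) (e k z.2) := by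
  have hz := (cone_pos z).ne'
  rw [mlieBracket_coneFrame_succ_succ e i j z (h.smooth i) (h.smooth j), coneVal_apply]
  simp only [coneFrame, consIdx_succ, conePr_coneVec, conePrM_coneVec, map_smul,
    LinearMap.smul_apply, smul_eq_mul]
  field_simp
  ring

theorem sgn_mul_self (i : Idx p q) : sgn i * sgn i = 1 := by
  rcases i with i | i <;> simp [sgn]

theorem connForm_coneFrame_succ_succ (h : IsLocalFrame g e z.2)
    (w : TangentSpace (coneModel I) z) (j k : Idx p q) :
    connForm (coneMetric g) (coneFrame e) z w (succIdx j) (succIdx k) =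
      connForm g e z.2 (conePrM z w) j k := by
  have hz := (cone_pos z).ne'
  rw [connForm, sum_idx, connForm]
  simp only [koszul_coneFrame h, koszul_of_orthonormal g e h.orthonormal,
    coneVal_bracket_zero_succ h, coneVal_bracket_succ_zero h, coneVal_bracket_succ_succ_zero h,
    coneVal_bracket_succ_succ_succ h, coord_coneFrame_succ, succIdx_injective.eq_iff]
  have h0 : (1 / 2 : ℝ) * ((if j = k then -(z.1 : ℝ)⁻¹ * sgn j else 0) - 0 +
      if k = j then (z.1 : ℝ)⁻¹ * sgn k else 0) = 0 := by
    by_cases hjk : j = k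
    · subst hjk; simp
    · simp [hjk, Ne.symm hjk]
  rw [h0, mul_zero, zero_add]
  refine Finset.sum_congr rfl fun i _ => ?_
  field_simp

theorem connForm_coneFrame_zero_zero (h : IsLocalFrame g e z.2)
    (w : TangentSpace (coneModel I) z) :
    connForm (coneMetric g) (coneFrame e) z w zeroIdx zeroIdx = 0 := by
  rw [connForm, sum_idx]
  simp only [koszul_coneFrame h, 
    coneVal_bracket_zero_succ h, coneVal_bracket_succ_zero h, coneVal_bracket_zero_zero,
    (zeroIdx_ne_succIdx _).symm, if_false]
  simp

theorem connForm_coneFrame_succ_zero (h : IsLocalFrame g e z.2)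
    (w : TangentSpace (coneModel I) z) (j : Idx p q) :
    connForm (coneMetric g) (coneFrame e) z w (succIdx j) zeroIdx =
      -(sgn j * coord g e z.2 (conePrM z w) j) := by
  have hz := (cone_pos z).ne'
  rw [connForm, sum_idx]
  simp only [koszul_coneFrame h, coord_coneFrame_succ,
    coneVal_bracket_zero_succ h, coneVal_bracket_succ_zero h, coneVal_bracket_zero_zero,
    coneVal_bracket_succ_succ_zero h, succIdx_injective.eq_iff,
    (zeroIdx_ne_succIdx _).symm, if_false]
  rw [Finset.sum_eq_single j]
  · simp; field_simp; ring
  · intro i _ hi; simp [hi, hi.symm]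
  · simp

theorem connForm_coneFrame_zero_succ (h : IsLocalFrame g e z.2)
    (w : TangentSpace (coneModel I) z) (k : Idx p q) :
    connForm (coneMetric g) (coneFrame e) z w zeroIdx (succIdx k) =
      sgn k * coord g e z.2 (conePrM z w) k := by
  have hz := (cone_pos z).ne'
  rw [connForm, sum_idx]
  simp only [koszul_coneFrame h, coord_coneFrame_succ,
    coneVal_bracket_zero_succ h, coneVal_bracket_succ_zero h, coneVal_bracket_zero_zero,
    coneVal_bracket_succ_succ_zero h, succIdx_injective.eq_iff,
    (zeroIdx_ne_succIdx _).symm, if_false]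
  rw [Finset.sum_eq_single k]
  · simp; field_simp; ring
  · intro i _ hi; simp [hi, hi.symm]
  · simp

theorem gen_mul_gen_zero {p q : ℕ} (i : Idx p q) :
    (gen zeroIdx : Cl (p + 1) q) * gen (succIdx i) = -(gen (succIdx i) * gen zeroIdx) := by
  have h := vec_mul_vec_of_left (Pi.single i 1 : Idx p q → ℝ)
  have e : (consIdx 0 (Pi.single i 1) : Idx (p + 1) q → ℝ) = Pi.single (succIdx i) 1 := by
    funext j
    induction j using idx_cases with
    | h0 => simp [zeroIdx_ne_succIdx]
    | hs j => simp [Pi.single_apply, succIdx_injective.eq_iff]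
  rwa [e] at h

variable {𝕜 : Type*} [RCLike 𝕜] {S : Type*} [NormedAddCommGroup S] [NormedSpace ℝ S]
  [NormedSpace 𝕜 S] [IsScalarTower ℝ 𝕜 S]

/-- The spin connection of the cone in terms of that of `M`. -/
theorem spinDeriv_coneFrame (h : IsLocalFrame g e z.2) (ρ : Cl (p + 1) q →ₐ[ℝ] Module.End 𝕜 S)
    (s : ConeSpace M → S) (w : TangentSpace (coneModel I) z) :
    spinDeriv (coneMetric g) (coneFrame e) ρ s z w = dirDeriv s z w +
      (1 / 4 : ℝ) • ∑ j, ∑ k, (sgn j * sgn k * connForm g e z.2 (conePrM z w) j k) •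
        ρ (gen (succIdx j) * gen (succIdx k)) (s z) -
      (1 / 2 : ℝ) • ∑ j, coord g e z.2 (conePrM z w) j •
        ρ (gen (succIdx j) * gen zeroIdx) (s z) := by
  have h1 : ∀ j : Idx p q, ∀ c : ℝ, sgn j * 1 * -(sgn j * c) = -c := fun j c => by
    linear_combination -c * sgn_mul_self j
  have h2 : ∀ j : Idx p q, ∀ c : ℝ, 1 * sgn j * (sgn j * c) = c := fun j c => by
    linear_combination c * sgn_mul_self j
  rw [spinDeriv, sum_idx]
  simp only [sum_idx (p := p), connForm_coneFrame_zero_zero h, connForm_coneFrame_zero_succ h,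
    connForm_coneFrame_succ_zero h, connForm_coneFrame_succ_succ h, sgn_zeroIdx, sgn_succIdx,
    mul_zero, zero_smul, zero_add, h1, h2, gen_mul_gen_zero, map_neg, LinearMap.neg_apply,
    Finset.sum_add_distrib, neg_smul, smul_neg, Finset.sum_neg_distrib]
  module

end ConeConnection

theorem vec_eq_sum {p q : ℕ} (v : Idx p q → ℝ) : vec v = ∑ i, v i • gen i := by
  conv_lhs => rw [pi_eq_sum_univ' v]
  rw [map_sum]
  refine Finset.sum_congr rfl fun i _ => ?_
  rw [gen, ← map_smul]

theorem vec_mul_self {p q : ℕ} (v : Idx p q → ℝ) :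
    vec v * vec v = algebraMap ℝ (Cl p q) (cliffordForm p q v) := CliffordAlgebra.ι_sq_scalar _ _

theorem gen_mul_self {p q : ℕ} (i : Idx p q) :
    (gen i : Cl p q) * gen i = algebraMap ℝ _ (-sgn i) := by
  rw [gen, vec_mul_self, cliffordForm_apply]
  simp [Pi.single_apply]

theorem gen_zero_mul_self {p q : ℕ} : (gen zeroIdx : Cl (p + 1) q) * gen zeroIdx = -1 := by
  rw [gen_mul_self, sgn_zeroIdx, map_neg, map_one]

theorem vec_consIdx_eq_sum {p q : ℕ} (v : Idx p q → ℝ) :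
    (vec (consIdx 0 v) : Cl (p + 1) q) = ∑ i, v i • gen (succIdx i) := by
  rw [vec_eq_sum, sum_idx]
  simp

theorem vec_mul_vec_eq {p q : ℕ} (u v : Idx p q → ℝ) :
    (vec (consIdx 0 u) * vec (consIdx 0 v) : Cl (p + 1) q) =
      vec (consIdx 0 u) * gen zeroIdx * (vec (consIdx 0 v) * gen zeroIdx) := by
  have h : (gen zeroIdx : Cl (p + 1) q) * vec (consIdx 0 v) = -(vec (consIdx 0 v) * gen zeroIdx) :=
    vec_mul_vec_of_left v
  rw [mul_assoc, ← mul_assoc (gen zeroIdx), h, neg_mul, mul_assoc (vec (consIdx 0 v)),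
    gen_zero_mul_self]
  simp

section LinearInverse

variable {𝕜 : Type*} [Field 𝕜] {V : Type*} [AddCommGroup V] [Module 𝕜 V] {S : Type*}
  [AddCommGroup S] [Module 𝕜 S] {W : Submodule 𝕜 V} {Φ : V →ₗ[𝕜] S}

theorem exists_linearInverse (hΦ : Set.BijOn Φ (W : Set V) Set.univ) :
    ∃ Ψ : S →ₗ[𝕜] V, (∀ y, Ψ y ∈ W) ∧ (∀ y, Φ (Ψ y) = y) ∧ ∀ w ∈ W, Ψ (Φ w) = w := by
  have hb : Function.Bijective (Φ.domRestrict W) := by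
    refine ⟨fun u v huv => Subtype.ext (hΦ.injOn u.2 v.2 huv), fun y => ?_⟩
    obtain ⟨w, hw, rfl⟩ := hΦ.surjOn (Set.mem_univ y)
    exact ⟨⟨w, hw⟩, rfl⟩
  let e := LinearEquiv.ofBijective _ hb
  refine ⟨W.subtype.comp e.symm.toLinearMap, fun y => (e.symm y).2, fun y => e.apply_symm_apply y,
    fun w hw => ?_⟩
  have : e.symm (e ⟨w, hw⟩) = ⟨w, hw⟩ := e.symm_apply_apply _
  exact congrArg Subtype.val this

end LinearInverse

section Identification

variable {𝕜 : Type*} [RCLike 𝕜] {p q : ℕ} {S : Type*} [NormedAddCommGroup S] [NormedSpace ℝ S]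
  [NormedSpace 𝕜 S] [IsScalarTower ℝ 𝕜 S] {S' : Type*} [NormedAddCommGroup S'] [NormedSpace ℝ S']
  [NormedSpace 𝕜 S'] [IsScalarTower ℝ 𝕜 S'] {ρ : Cl p q →ₐ[ℝ] Module.End 𝕜 S}
  {ρ' : Cl (p + 1) q →ₐ[ℝ] Module.End 𝕜 S'} {W : Submodule 𝕜 S'} {δ : ℝ} {Φ : S' →ₗ[𝕜] S}

theorem map_real_smul {V V' : Type*} [AddCommGroup V] [Module ℝ V] [Module 𝕜 V]
    [IsScalarTower ℝ 𝕜 V] [AddCommGroup V'] [Module ℝ V'] [Module 𝕜 V'] [IsScalarTower ℝ 𝕜 V']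
    (L : V →ₗ[𝕜] V') (c : ℝ) (x : V) : L (c • x) = c • L x := by
  rw [← algebraMap_smul 𝕜 c x, map_smul, algebraMap_smul]

theorem real_smul_mem {V : Type*} [AddCommGroup V] [Module ℝ V] [Module 𝕜 V]
    [IsScalarTower ℝ 𝕜 V] (W : Submodule 𝕜 V) (c : ℝ) {x : V} (hx : x ∈ W) : c • x ∈ W := by
  rw [← algebraMap_smul 𝕜 c x]
  exact W.smul_mem _ hx

theorem map_vec_mul (ρ' : Cl (p + 1) q →ₐ[ℝ] Module.End 𝕜 S') (u : Idx p q → ℝ) (w : S') :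
    ρ' (vec (consIdx 0 u) * gen zeroIdx) w =
      ∑ i, u i • ρ' (gen (succIdx i) * gen zeroIdx) w := by
  rw [vec_consIdx_eq_sum, Finset.sum_mul, map_sum, LinearMap.sum_apply]
  refine Finset.sum_congr rfl fun i _ => ?_
  rw [smul_mul_assoc, map_smul, LinearMap.smul_apply]

theorem map_vec (ρ : Cl p q →ₐ[ℝ] Module.End 𝕜 S) (u : Idx p q → ℝ) (w : S) :
    ρ (vec u) w = ∑ i, u i • ρ (gen i) w := by
  rw [vec_eq_sum, map_sum, LinearMap.sum_apply]
  refine Finset.sum_congr rfl fun i _ => ?_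
  rw [map_smul, LinearMap.smul_apply]

/-- `W` is invariant under the products `e_i e_0`. -/
def ConeInvariant (ρ' : Cl (p + 1) q →ₐ[ℝ] Module.End 𝕜 S') (W : Submodule 𝕜 S') : Prop :=
  ∀ i : Idx p q, ∀ w ∈ W, ρ' (gen (succIdx i) * gen zeroIdx) w ∈ W

theorem ConeInvariant.vec_mem (hW : ConeInvariant ρ' W) (u : Idx p q → ℝ) {w : S'} (hw : w ∈ W) :
    ρ' (vec (consIdx 0 u) * gen zeroIdx) w ∈ W := by
  rw [map_vec_mul]
  exact W.sum_mem fun i _ => real_smul_mem W _ (hW i w hw)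

theorem IsIdentification.map_vec_mul (hΦ : IsIdentification ρ ρ' W δ Φ) (u : Idx p q → ℝ)
    {w : S'} (hw : w ∈ W) :
    Φ (ρ' (vec (consIdx 0 u) * gen zeroIdx) w) = δ • ρ (vec u) (Φ w) := by
  rw [ConeSpin.map_vec_mul, map_vec, map_sum, Finset.smul_sum]
  refine Finset.sum_congr rfl fun i _ => ?_
  rw [map_real_smul, hΦ.map_mul i w hw, smul_comm]

theorem IsIdentification.map_even (hΦ : IsIdentification ρ ρ' W δ Φ) (hδ : δ * δ = 1)
    (hW : ConeInvariant ρ' W) {x : Cl p q} (hx : x ∈ CliffordAlgebra.even (cliffordForm p q))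
    {w : S'} (hw : w ∈ W) :
    ρ' (inclCl p q x) w ∈ W ∧ Φ (ρ' (inclCl p q x) w) = ρ x (Φ w) := by
  change x ∈ CliffordAlgebra.evenOdd (cliffordForm p q) 0 at hx
  induction x, hx using CliffordAlgebra.even_induction with
  | algebraMap r =>
    simp only [AlgHom.commutes, Module.algebraMap_end_apply, map_real_smul]
    exact ⟨real_smul_mem W r hw, trivial⟩
  | add x y hx hy ihx ihy =>
    simp only [map_add, LinearMap.add_apply, ihx.2, ihy.2]
    exact ⟨W.add_mem ihx.1 ihy.1, trivial⟩
  | ι_mul_ι_mul u v x hx ih =>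
    have h1 := hW.vec_mem v ih.1
    have e : ρ' (inclCl p q (vec u * vec v * x)) w =
        ρ' (vec (consIdx 0 u) * gen zeroIdx) (ρ' (vec (consIdx 0 v) * gen zeroIdx)
          (ρ' (inclCl p q x) w)) := by
      rw [_root_.map_mul, _root_.map_mul, _root_.map_mul, inclCl_vec, inclCl_vec,
        vec_mul_vec_eq, _root_.map_mul, _root_.map_mul]
      rfl
    change ρ' (inclCl p q (vec u * vec v * x)) w ∈ W ∧ Φ (ρ' (inclCl p q (vec u * vec v * x)) w) =
      ρ (vec u * vec v * x) (Φ w)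
    rw [e]
    refine ⟨hW.vec_mem u h1, ?_⟩
    rw [hΦ.map_vec_mul u h1, hΦ.map_vec_mul v ih.1, ih.2, map_real_smul, smul_smul, hδ, one_smul,
      _root_.map_mul, _root_.map_mul]
    rfl

theorem IsIdentification.map_gen_mul_gen (hΦ : IsIdentification ρ ρ' W δ Φ) (hδ : δ * δ = 1)
    (hW : ConeInvariant ρ' W) (i j : Idx p q) {w : S'} (hw : w ∈ W) :
    ρ' (gen (succIdx i) * gen (succIdx j)) w ∈ W ∧
      Φ (ρ' (gen (succIdx i) * gen (succIdx j)) w) = ρ (gen i * gen j) (Φ w) := by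
  have h := hΦ.map_even hδ hW (x := gen i * gen j)
    (CliffordAlgebra.ι_mul_ι_mem_evenOdd_zero _ _ _) hw
  have hg : ∀ i : Idx p q, inclCl p q (gen i) = gen (succIdx i) := fun i => by
    rw [gen, inclCl_vec, vec_consIdx_eq_sum, Finset.sum_eq_single i]
    · simp
    · intro j _ hj; simp [hj]
    · simp
  rwa [_root_.map_mul, hg, hg] at h

end Identification

section Restriction

variable {E : Type*} [NormedAddCommGroup E] [NormedSpace ℝ E] {H : Type*} [TopologicalSpace H]
  {I : ModelWithCorners ℝ E H} {M : Type*} [TopologicalSpace M] [ChartedSpace H M]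
  [IsManifold I ∞ M] {p q : ℕ} {g : PseudoMetric I M p q}
  {S : Type*} [NormedAddCommGroup S] [NormedSpace ℝ S]
  {S' : Type*} [NormedAddCommGroup S'] [NormedSpace ℝ S']

theorem dirDeriv_clm_comp (L : S' →L[ℝ] S) {f : M → S'} {x : M}
    (hf : MDifferentiableAt I 𝓘(ℝ, S') f x) (v : TangentSpace I x) :
    dirDeriv (fun y => L (f y)) x v = L (dirDeriv f x v) := by
  have h := (L.hasMFDerivAt.comp x hf.hasMFDerivAt).mfderiv
  exact congrArg (fun A : E →L[ℝ] S => A v) h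

theorem dirDeriv_comp_snd {f : M → S} (z : ConeSpace M) (hf : MDifferentiableAt I 𝓘(ℝ, S) f z.2)
    (w : TangentSpace (coneModel I) z) :
    dirDeriv (fun y : ConeSpace M => f y.2) z w = dirDeriv f z.2 (conePrM z w) := by
  have h := (hf.hasMFDerivAt.comp z (hasMFDerivAt_snd (I := 𝓘(ℝ, ℝ)) (I' := I) z)).mfderiv
  exact congrArg (fun A : ℝ × E →L[ℝ] S => A w) h

theorem dirDeriv_comp_posOne {f : ConeSpace M → S} (x : M)
    (hf : MDifferentiableAt (coneModel I) 𝓘(ℝ, S) f (posOne, x)) (v : TangentSpace I x) :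
    dirDeriv (fun y : M => f (posOne, y)) x v =
      dirDeriv f (posOne, x) (coneVec (posOne, x) 0 v) := by
  have h0 : HasMFDerivAt I (coneModel I) (fun y : M => (posOne, y)) x
      (ContinuousLinearMap.inr ℝ ℝ E) := 
    (hasMFDerivAt_const (I := I) (I' := 𝓘(ℝ, ℝ)) posOne x).prodMk (hasMFDerivAt_id x)
  have h := (hf.hasMFDerivAt.comp x h0).mfderiv
  exact congrArg (fun A : E →L[ℝ] S => A v) h

/-- The exponential function as a map to `ℝ⁺`. -/
def expPos (t : ℝ) : posReal := ⟨Real.exp t, Real.exp_pos t⟩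

theorem contMDiff_expPos : ContMDiff 𝓘(ℝ, ℝ) 𝓘(ℝ, ℝ) ∞ expPos := by
  rw [← ContMDiff.subtypeVal_comp_iff]
  exact Real.contDiff_exp.contMDiff

theorem eq_of_dirDeriv_radial_eq_zero {f : ConeSpace M → S} {x : M}
    (hf : ∀ r, MDifferentiableAt (coneModel I) 𝓘(ℝ, S) f (r, x))
    (h : ∀ r c, dirDeriv f (r, x) (coneVec (I := I) (r, x) c 0) = 0) (r : posReal) :
    f (r, x) = f (posOne, x) := by
  have hd : ∀ t : ℝ, HasMFDerivAt 𝓘(ℝ, ℝ) 𝓘(ℝ, S) (fun t => f (expPos t, x)) t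
      (0 : ℝ →L[ℝ] S) := by
    intro t
    have h1 := ((contMDiff_expPos t).mdifferentiableAt (by simp)).hasMFDerivAt
    have h2 := h1.prodMk (hasMFDerivAt_const (I := 𝓘(ℝ, ℝ)) (I' := I) x t)
    have h3 := (hf (expPos t)).hasMFDerivAt.comp t h2
    refine h3.congr_mfderiv ?_
    refine ContinuousLinearMap.ext fun c => ?_
    exact h (expPos t) _
  have hd' : ∀ t : ℝ, HasFDerivAt (fun t => f (expPos t, x)) (0 : ℝ →L[ℝ] S) t :=
    fun t => (hd t).hasFDerivAt
  have hc : ∀ t, f (expPos t, x) = f (expPos 0, x) := fun t =>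
    is_const_of_fderiv_eq_zero (𝕜 := ℝ) (fun t => (hd' t).differentiableAt)
      (fun t => (hd' t).fderiv) t 0
  have e1 : expPos (Real.log r) = r := Subtype.ext (Real.exp_log r.2)
  have e2 : expPos 0 = posOne := Subtype.ext Real.exp_zero
  rw [← e1, hc, e2]

end Restriction

section RestrictionIso

variable {E : Type*} [NormedAddCommGroup E] [NormedSpace ℝ E] {H : Type*} [TopologicalSpace H]
  {I : ModelWithCorners ℝ E H} {M : Type*} [TopologicalSpace M] [ChartedSpace H M]
  [IsManifold I ∞ M] {p q : ℕ} {g : PseudoMetric I M p q} [I.Boundaryless] [CompleteSpace E]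
  {ι : Type*} {σ : SpinStructure g ι}
  {𝕜 : Type*} [RCLike 𝕜] {S : Type*} [NormedAddCommGroup S] [NormedSpace ℝ S]
  [NormedSpace 𝕜 S] [IsScalarTower ℝ 𝕜 S] {S' : Type*} [NormedAddCommGroup S'] [NormedSpace ℝ S']
  [NormedSpace 𝕜 S'] [IsScalarTower ℝ 𝕜 S'] {ρ : Cl p q →ₐ[ℝ] Module.End 𝕜 S}
  {ρ' : Cl (p + 1) q →ₐ[ℝ] Module.End 𝕜 S'} {W : Submodule 𝕜 S'} {δ : ℝ} {Φ : S' →ₗ[𝕜] S}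

theorem cliffordMul_eq_sum (e : Idx p q → ∀ x : M, TangentSpace I x) (x : M)
    (v : TangentSpace I x) (s : S) :
    cliffordMul g e ρ x v s = ∑ j, coord g e x v j • ρ (gen j) s := map_vec ρ _ s

/-- Under an identification, the derivative of a spinor on the cone in a direction tangent to `M`
corresponds to the operator in the Killing equation. -/
theorem IsIdentification.map_spinDeriv (hΦ : IsIdentification ρ ρ' W δ Φ) (hδ : δ * δ = 1)
    (hW : ConeInvariant ρ' W) {e : Idx p q → ∀ x : M, TangentSpace I x} {z : ConeSpace M}
    (he : IsLocalFrame g e z.2) {s : ConeSpace M → S'} (hs : s z ∈ W)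
    (w : TangentSpace (coneModel I) z) :
    Φ (spinDeriv (coneMetric g) (coneFrame e) ρ' s z w) = Φ (dirDeriv s z w) +
      (1 / 4 : ℝ) • ∑ j, ∑ k, (sgn j * sgn k * connForm g e z.2 (conePrM z w) j k) •
        ρ (gen j * gen k) (Φ (s z)) - (δ / 2) • cliffordMul g e ρ z.2 (conePrM z w) (Φ (s z)) := by
  rw [spinDeriv_coneFrame he, map_sub, map_add, map_real_smul, map_real_smul, map_sum, map_sum,
    cliffordMul_eq_sum]
  congr 1
  · congr 2
    refine Finset.sum_congr rfl fun j _ => ?_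
    rw [map_sum]
    refine Finset.sum_congr rfl fun k _ => ?_
    rw [map_real_smul, (hΦ.map_gen_mul_gen hδ hW j k hs).2]
  · rw [Finset.smul_sum, Finset.smul_sum]
    refine Finset.sum_congr rfl fun j _ => ?_
    rw [map_real_smul, hΦ.map_mul j _ hs]
    module

theorem spinDeriv_radial {e : Idx p q → ∀ x : M, TangentSpace I x} {z : ConeSpace M}
    (he : IsLocalFrame g e z.2) (s : ConeSpace M → S') (c : ℝ) :
    spinDeriv (coneMetric g) (coneFrame e) ρ' s z (coneVec z c 0) =
      dirDeriv s z (coneVec (I := I) z c 0) := by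
  have h0 : ∀ i, coord g e z.2 0 i = 0 := fun i => by simp [coord]
  have h1 : ∀ j k, connForm g e z.2 0 j k = 0 := fun j k => by simp [connForm, h0]
  rw [spinDeriv_coneFrame he]
  simp [h0, h1]

theorem parallel_eq_posOne {s : ι → ConeSpace M → S'} (hs : s ∈ killingSpinors (coneSpin σ) ρ' W 0)
    {a : ι} {x : M} (hx : x ∈ σ.U a) (r : posReal) : s a (r, x) = s a (posOne, x) := by
  refine eq_of_dirDeriv_radial_eq_zero (I := I)
    (fun r => mdifferentiableAt_of_mem hs.1 (show (r, x) ∈ (coneSpin σ).U a from hx))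
    (fun r c => ?_) r
  rw [← spinDeriv_radial (ρ' := ρ') (σ.isLocalFrame hx)]
  refine (hs.2 a (r, x) hx _).trans ?_
  rw [zero_smul]

variable [FiniteDimensional 𝕜 S] [FiniteDimensional 𝕜 S']

/-- A `𝕜`-linear map between finite-dimensional spaces as a continuous real linear map. -/
def realCLM (L : S' →ₗ[𝕜] S) : S' →L[ℝ] S :=
  ⟨{ toFun := L, map_add' := L.map_add, map_smul' := fun c x => map_real_smul L c x },
    (LinearMap.toContinuousLinearMap L).continuous⟩

theorem restriction_mem (hΦ : IsIdentification ρ ρ' W δ Φ) (hδ : δ * δ = 1)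
    (hW : ConeInvariant ρ' W) {s : ι → ConeSpace M → S'}
    (hs : s ∈ killingSpinors (coneSpin σ) ρ' W 0) :
    (fun a x => Φ (s a (posOne, x))) ∈ killingSpinors σ ρ ⊤ (δ / 2) := by
  obtain ⟨⟨hs1, hs2, hs3, hs4⟩, hs5⟩ := id hs
  refine ⟨⟨fun a x => trivial, fun a x hx => ?_, fun a => ?_, fun a b x hx => ?_⟩,
    fun a x hx v => ?_⟩
  · exact (congrArg Φ (hs2 a (posOne, x) hx)).trans (map_zero Φ)
  · have h : ContMDiffOn I (coneModel I) ∞ (fun x : M => (posOne, x)) (σ.U a) :=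
      (contMDiff_const.prodMk contMDiff_id).contMDiffOn
    exact (realCLM Φ).contMDiff.comp_contMDiffOn ((hs3 a).comp h fun x hx => hx)
  · refine (congrArg Φ (hs4 a b (posOne, x) hx)).trans ?_
    exact (hΦ.map_even hδ hW (σ.trans_mem a b x hx).2 (hs1 b _)).2
  · have hx' : (posOne, x) ∈ (coneSpin σ).U a := hx
    have h := hs5 a (posOne, x) hx (coneVec (posOne, x) 0 v)
    rw [zero_smul] at h
    have h' := hΦ.map_spinDeriv hδ hW (σ.isLocalFrame hx) (z := (posOne, x)) (hs1 a _)
      (coneVec (posOne, x) 0 v)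
    have hd : dirDeriv (fun x => Φ (s a (posOne, x))) x v =
        Φ (dirDeriv (s a) (posOne, x) (coneVec (I := I) (posOne, x) 0 v)) := by
      have hm := mdifferentiableAt_of_mem hs.1 hx'
      rw [← dirDeriv_comp_posOne x hm]
      refine dirDeriv_clm_comp (realCLM Φ) ?_ v
      exact hm.comp x (mdifferentiableAt_const.prodMk mdifferentiableAt_id)
    rw [spinDeriv, hd, ← sub_eq_zero]
    refine h'.symm.trans ?_
    exact (congrArg Φ h).trans (map_zero Φ)

theorem extension_mem (hΦ : IsIdentification ρ ρ' W δ Φ) (hδ : δ * δ = 1)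
    (hW : ConeInvariant ρ' W) {Ψ : S →ₗ[𝕜] S'} (hΨ : ∀ y, Ψ y ∈ W) (hΦΨ : ∀ y, Φ (Ψ y) = y)
    {t : ι → M → S} (ht : t ∈ killingSpinors σ ρ ⊤ (δ / 2)) :
    (fun a (z : ConeSpace M) => Ψ (t a z.2)) ∈ killingSpinors (coneSpin σ) ρ' W 0 := by
  obtain ⟨⟨ht1, ht2, ht3, ht4⟩, ht5⟩ := id ht
  have inj : ∀ {u v : S'}, u ∈ W → v ∈ W → Φ u = Φ v → u = v := fun hu hv h =>
    hΦ.bijOn.injOn hu hv h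
  refine ⟨⟨fun a z => hΨ _, fun a z hz => ?_, fun a => ?_, fun a b z hz => ?_⟩,
    fun a z hz w => ?_⟩
  · exact (congrArg Ψ (ht2 a z.2 hz)).trans (map_zero Ψ)
  · exact (realCLM Ψ).contMDiff.comp_contMDiffOn ((ht3 a).comp contMDiff_snd.contMDiffOn
      fun z hz => hz)
  · have h := hΦ.map_even hδ hW (σ.trans_mem a b z.2 hz).2 (hΨ (t b z.2))
    refine inj (hΨ _) h.1 ?_
    refine Eq.trans ?_ h.2.symm
    rw [hΦΨ, hΦΨ, ht4 a b z.2 hz]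
  · have hm := mdifferentiableAt_of_mem ht.1 hz
    have hd : dirDeriv (fun z : ConeSpace M => Ψ (t a z.2)) z w =
        Ψ (dirDeriv (t a) z.2 (conePrM z w)) := by
      rw [← dirDeriv_comp_snd z hm]
      exact dirDeriv_clm_comp (realCLM Ψ) (hm.comp z mdifferentiableAt_snd) w
    have h' := hΦ.map_spinDeriv hδ hW (σ.isLocalFrame hz) (z := z)
      (s := fun z => Ψ (t a z.2)) (hΨ _) w
    have hk := ht5 a z.2 hz (conePrM z w)
    rw [hd, hΦΨ, hΦΨ] at h'
    rw [spinDeriv, ← sub_eq_zero] at hk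
    rw [hk] at h'
    rw [zero_smul]
    refine inj ?_ W.zero_mem (h'.trans (map_zero Φ).symm)
    change spinDeriv (coneMetric g) (coneFrame (σ.frame a)) ρ' _ z w ∈ W
    rw [spinDeriv_coneFrame (σ.isLocalFrame hz), hd]
    refine W.sub_mem (W.add_mem (hΨ _) (real_smul_mem W _ (W.sum_mem fun j _ => W.sum_mem
      fun k _ => real_smul_mem W _ ?_))) (real_smul_mem W _ (W.sum_mem
      fun j _ => real_smul_mem W _ (hW j _ (hΨ _))))
    exact (hΦ.map_gen_mul_gen hδ hW j k (hΨ _)).1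

theorem IsIdentification.restrictionIsIso (hΦ : IsIdentification ρ ρ' W δ Φ) (hδ : δ * δ = 1)
    (hW : ConeInvariant ρ' W) (σ : SpinStructure g ι) :
    RestrictionIsIso σ ρ ρ' W Φ (δ / 2) := by
  obtain ⟨Ψ, hΨ, hΦΨ, hΨΦ⟩ := exists_linearInverse hΦ.bijOn
  refine ⟨{
    toFun := fun s => ⟨fun a x => Φ (s.1 a (posOne, x)), restriction_mem hΦ hδ hW s.2⟩
    map_add' := fun s t => Subtype.ext <| by funext a x; exact map_add Φ _ _
    map_smul' := fun c s => Subtype.ext <| by funext a x; exact map_smul Φ c _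
    invFun := fun t => ⟨fun a z => Ψ (t.1 a z.2), extension_mem hΦ hδ hW hΨ hΦΨ t.2⟩
    left_inv := fun s => Subtype.ext <| by
      funext a z
      change Ψ (Φ (s.1 a (posOne, z.2))) = s.1 a z
      rw [hΨΦ _ (s.2.1.1 a _)]
      by_cases hz : z.2 ∈ σ.U a
      · exact (parallel_eq_posOne s.2 hz z.1).symm
      · rw [s.2.1.2.1 a z hz, s.2.1.2.1 a (posOne, z.2) hz]
    right_inv := fun t => Subtype.ext <| by
      funext a x
      exact hΦΨ _ }, fun s a x => rfl⟩

end RestrictionIso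

section CliffordFamily

variable {ι : Type*} {R : Type*} [Ring R]

/-- Pairwise anticommuting elements whose squares are the integers `c i = ±1`. -/
structure IsCliffordFamily (c : ι → ℤ) (e : ι → R) : Prop where
  sq : ∀ i, e i * e i = c i
  anti : ∀ i j, i ≠ j → e i * e j = -(e j * e i)
  sign : ∀ i, c i * c i = 1

namespace IsCliffordFamily

variable {c : ι → ℤ} {e : ι → R}

theorem map {R' : Type*} [Ring R'] (h : IsCliffordFamily c e) (f : R →+* R') :
    IsCliffordFamily c (fun i => f (e i)) where
  sq i := by rw [← map_mul, h.sq, map_intCast]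
  anti i j hij := by rw [← map_mul, h.anti i j hij, map_neg, map_mul]
  sign := h.sign

theorem prod_notMem (h : IsCliffordFamily c e) (i : ι) (l : List ι) (hi : i ∉ l) :
    e i * (l.map e).prod = (-1) ^ l.length * ((l.map e).prod * e i) := by
  induction l with
  | nil => simp
  | cons j l ih =>
    rw [List.mem_cons, not_or] at hi
    rw [List.map_cons, List.prod_cons, List.length_cons, ← mul_assoc, h.anti i j hi.1, neg_mul,
      mul_assoc, ih hi.2, pow_succ]
    rcases neg_one_pow_eq_or R l.length with hl | hl <;> simp [hl, mul_assoc]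

theorem prod_mem (h : IsCliffordFamily c e) (i : ι) (l : List ι) (hl : l.Nodup) (hi : i ∈ l) :
    e i * (l.map e).prod = -((-1) ^ l.length * ((l.map e).prod * e i)) := by
  induction l with
  | nil => simp at hi
  | cons j l ih =>
    rw [List.nodup_cons] at hl
    rw [List.map_cons, List.prod_cons, List.length_cons, pow_succ]
    rcases List.mem_cons.1 hi with rfl | hi
    · have h1 := h.prod_notMem i l hl.1
      rw [h1]
      rcases neg_one_pow_eq_or R l.length with hl | hl <;> simp [hl, mul_assoc]
      · rw [hl, one_mul] at h1; rw [← mul_assoc, h1, mul_assoc]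
      · rw [hl, neg_one_mul] at h1; rw [← mul_assoc, h1, neg_mul, neg_neg, mul_assoc]
    · have hij : i ≠ j := fun hij => hl.1 (hij ▸ hi)
      rw [← mul_assoc, h.anti i j hij, neg_mul, mul_assoc, ih hl.2 hi]
      rcases neg_one_pow_eq_or R l.length with hl | hl <;> simp [hl, mul_assoc]

/-- The sign of the square of the volume element of signature `s = p - q`. -/
def volSign (s : ℤ) : ℤ := if s % 4 = 0 ∨ s % 4 = 3 then 1 else -1

theorem prod_sq (h : IsCliffordFamily c e) (l : List ι) (hl : l.Nodup) :
    (l.map e).prod * (l.map e).prod = (volSign (-(l.map c).sum) : ℤ) ∧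
      (l.length : ℤ) % 2 = (l.map c).sum % 2 := by
  induction l with
  | nil => simp [volSign]
  | cons j l ih =>
    rw [List.nodup_cons] at hl
    obtain ⟨ih1, ih2⟩ := ih hl.2
    have h1 := h.prod_notMem j l hl.1
    simp only [List.map_cons, List.prod_cons, List.length_cons, List.sum_cons, Nat.cast_add,
      Nat.cast_one]
    set P := (l.map e).prod
    set s := (l.map c).sum
    have hcj : c j = 1 ∨ c j = -1 := mul_self_eq_one_iff.1 (h.sign j)
    refine ⟨?_, by rcases hcj with hc | hc <;> rw [hc] <;> omega⟩
    have h2 : e j * P * (e j * P) = ((-1) ^ l.length * c j * volSign (-s) : ℤ) := by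
      rw [mul_assoc, ← mul_assoc P, ← mul_assoc (e j)]
      have h3 : P * e j = (-1) ^ l.length * (e j * P) := by
        rw [h1, ← mul_assoc, ← pow_add, ← two_mul, pow_mul]; simp
      rw [h3]
      push_cast
      rw [← ih1, ← h.sq]
      rcases neg_one_pow_eq_or R l.length with hl | hl <;> simp [hl, mul_assoc]
    rw [h2]
    congr 1
    have h5 : s % 4 = 0 ∨ s % 4 = 1 ∨ s % 4 = 2 ∨ s % 4 = 3 := by omega
    rcases Nat.even_or_odd l.length with hp | hp
    · rw [hp.neg_one_pow]
      have : (l.length : ℤ) % 2 = 0 := by obtain ⟨k, hk⟩ := hp; omega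
      unfold volSign
      rcases hcj with hc | hc <;> rw [hc] <;> split_ifs <;> omega
    · rw [hp.neg_one_pow]
      have : (l.length : ℤ) % 2 = 1 := by obtain ⟨k, hk⟩ := hp; omega
      unfold volSign
      rcases hcj with hc | hc <;> rw [hc] <;> split_ifs <;> omega

end IsCliffordFamily

end CliffordFamily

section Averaging

variable {ι : Type*} {𝕜 : Type*} [Field 𝕜] {V : Type*} [AddCommGroup V] [Module 𝕜 V]

/-- The product of the operators `1 + η L_i` for `i` in a list. For commuting involutions `L_i` this
is a multiple of the projection onto the common eigenspace for the eigenvalue `η`. -/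
def averaging (η : 𝕜) (L : ι → Module.End 𝕜 V) : List ι → Module.End 𝕜 V
  | [] => 1
  | i :: l => averaging η L l * (1 + η • L i)

theorem averaging_mem {η : 𝕜} (hη : η * η = 1) {L : ι → Module.End 𝕜 V}
    (hsq : ∀ i, L i * L i = 1) (hcomm : ∀ i j, L i * L j = L j * L i) (l : List ι) (i : ι)
    (hi : i ∈ l) : L i * averaging η L l = η • averaging η L l := by
  have hc : ∀ l : List ι, L i * averaging η L l = averaging η L l * L i := by
    intro l
    induction l with
    | nil => simp [averaging]
    | cons j l ih =>
      rw [averaging, ← mul_assoc, ih, mul_assoc, mul_assoc, mul_add, add_mul, mul_smul_comm,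
        smul_mul_assoc, hcomm i j, mul_one, one_mul]
  induction l with
  | nil => simp at hi
  | cons j l ih =>
    rcases List.mem_cons.1 hi with rfl | hi
    · rw [averaging, ← mul_assoc, hc, mul_assoc, ← mul_smul_comm]
      congr 1
      rw [mul_add, mul_smul_comm, hsq, mul_one, smul_add, smul_smul, hη, one_smul, add_comm]
    · rw [averaging, ← mul_assoc, ih hi, smul_mul_assoc]

theorem averaging_apply {η : 𝕜} (hη : η * η = 1) {L : ι → Module.End 𝕜 V} {v : V}
    (hv : ∀ i, L i v = η • v) (l : List ι) : averaging η L l v = (2 : 𝕜) ^ l.length • v := by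
  induction l with
  | nil => simp [averaging]
  | cons j l ih =>
    have : (1 + η • L j) v = (2 : 𝕜) • v := by
      rw [LinearMap.add_apply, LinearMap.smul_apply, hv, smul_smul, hη, Module.End.one_apply,
        two_smul, one_smul]
    rw [averaging, Module.End.mul_apply, this, map_smul, ih, smul_smul, List.length_cons, pow_succ,
      mul_comm]

end Averaging

section Trace

variable {𝕜 : Type*} [Field 𝕜] {m n : Type*} [Fintype m] [Fintype n] [DecidableEq m] [DecidableEq n]

theorem trace_end_matrix (f : Module.End 𝕜 (Matrix m n 𝕜)) :
    LinearMap.trace 𝕜 _ f = ∑ i, ∑ j, f (Matrix.single i j 1) i j := by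
  rw [LinearMap.trace_eq_matrix_trace 𝕜 (Matrix.stdBasis 𝕜 m n), Matrix.trace,
    Fintype.sum_prod_type]
  refine Finset.sum_congr rfl fun i _ => Finset.sum_congr rfl fun j _ => ?_
  rw [Matrix.diag_apply, LinearMap.toMatrix_apply, Matrix.stdBasis_eq_single]
  rfl

/-- The operator `T ↦ X T Y` on matrices. -/
def mulLR (X : Matrix m m 𝕜) (Y : Matrix n n 𝕜) : Module.End 𝕜 (Matrix m n 𝕜) where
  toFun T := X * T * Y
  map_add' S T := by rw [Matrix.mul_add, Matrix.add_mul]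
  map_smul' c T := by rw [Matrix.mul_smul, Matrix.smul_mul]; rfl

theorem mulLR_apply (X : Matrix m m 𝕜) (Y : Matrix n n 𝕜) (T : Matrix m n 𝕜) :
    mulLR X Y T = X * T * Y := rfl

theorem mulLR_mul (X X' : Matrix m m 𝕜) (Y Y' : Matrix n n 𝕜) :
    mulLR X Y * mulLR X' Y' = mulLR (X * X') (Y' * Y) :=
  LinearMap.ext fun T => by simp [mulLR_apply, Matrix.mul_assoc]

theorem mulLR_one : mulLR (1 : Matrix m m 𝕜) (1 : Matrix n n 𝕜) = 1 :=
  LinearMap.ext fun T => by simp [mulLR_apply]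

theorem trace_mulLR (X : Matrix m m 𝕜) (Y : Matrix n n 𝕜) :
    LinearMap.trace 𝕜 _ (mulLR X Y) = X.trace * Y.trace := by
  rw [trace_end_matrix, Matrix.trace, Matrix.trace, Finset.sum_mul_sum]
  refine Finset.sum_congr rfl fun i _ => Finset.sum_congr rfl fun j _ => ?_
  rw [mulLR_apply]
  simp [Matrix.mul_apply, Matrix.single_apply, ite_and, Finset.sum_ite_eq]

end Trace

section Intertwiner

variable {𝕜 : Type*} [Field 𝕜] [CharZero 𝕜] {m n : Type*} [Fintype m] [Fintype n] [DecidableEq m]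
  [DecidableEq n] {ι : Type*} {c : ι → ℤ} {e₁ : ι → Matrix n n 𝕜} {e₂ : ι → Matrix m m 𝕜}

theorem IsCliffordFamily.sq_smul {A : Type*} [Ring A] [Algebra 𝕜 A] {e : ι → A}
    (h : IsCliffordFamily c e) (i : ι) : e i * e i = (c i : 𝕜) • (1 : A) := by
  rw [h.sq, ← Int.smul_one_eq_cast, Int.cast_smul_eq_zsmul]

/-- Conjugation of matrices by the elements of two Clifford families. -/
def conjLR (c : ι → ℤ) (e₁ : ι → Matrix n n 𝕜) (e₂ : ι → Matrix m m 𝕜) (i : ι) :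
    Module.End 𝕜 (Matrix m n 𝕜) := mulLR (e₂ i) ((c i : 𝕜) • e₁ i)

theorem IsCliffordFamily.trace_eq_zero (h₂ : IsCliffordFamily c e₂) {X : Matrix m m 𝕜} {i : ι}
    (hX : e₂ i * X = -(X * e₂ i)) : X.trace = 0 := by
  have h1 : (e₂ i * X * e₂ i).trace = (c i : 𝕜) * X.trace := by
    rw [Matrix.trace_mul_comm, ← Matrix.mul_assoc, h₂.sq]
    rw [← Int.smul_one_eq_cast, smul_mul_assoc, Matrix.one_mul, Matrix.trace_smul, zsmul_eq_mul]
  have h2 : (e₂ i * X * e₂ i).trace = -((c i : 𝕜) * X.trace) := by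
    rw [hX, Matrix.neg_mul, Matrix.trace_neg, Matrix.mul_assoc, h₂.sq,
      ← Int.smul_one_eq_cast, mul_smul_comm, Matrix.mul_one, Matrix.trace_smul, zsmul_eq_mul]
  have h3 : (c i : 𝕜) * X.trace = 0 := self_eq_neg.1 (h1.symm.trans h2)
  refine (mul_eq_zero.1 h3).resolve_left fun h0 => ?_
  have := h₂.sign i
  rw [Int.cast_eq_zero] at h0
  simp [h0] at this

theorem trace_averaging_cons (η : 𝕜) (i : ι) (l : List ι) (X : Matrix m m 𝕜) (Y : Matrix n n 𝕜) :
    LinearMap.trace 𝕜 _ (averaging η (conjLR c e₁ e₂) (i :: l) * mulLR X Y) =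
      LinearMap.trace 𝕜 _ (averaging η (conjLR c e₁ e₂) l * mulLR X Y) +
      η * LinearMap.trace 𝕜 _
        (averaging η (conjLR c e₁ e₂) l * mulLR (e₂ i * X) (Y * ((c i : 𝕜) • e₁ i))) := by
  rw [averaging, mul_assoc, add_mul, one_mul, smul_mul_assoc, conjLR, mulLR_mul, mul_add, map_add,
    mul_smul_comm, map_smul, smul_eq_mul]

/-- Products of an even number of elements of a Clifford family are traceless. -/
theorem trace_averaging_of_anti (h₂ : IsCliffordFamily c e₂) (l : List ι) (hl : l.Nodup)
    (X : Matrix m m 𝕜) (Y : Matrix n n 𝕜) (κ : 𝕜) (hκ : κ = 1 ∨ κ = -1) {i₀ : ι} (hi₀ : i₀ ∉ l)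
    (h0 : e₂ i₀ * X = -κ • (X * e₂ i₀)) (hX : ∀ i ∈ l, e₂ i * X = κ • (X * e₂ i)) :
    LinearMap.trace 𝕜 _ (averaging 1 (conjLR c e₁ e₂) l * mulLR X Y) +
      κ * LinearMap.trace 𝕜 _ (averaging (-1) (conjLR c e₁ e₂) l * mulLR X Y) = 0 := by
  induction l generalizing X Y κ with
  | nil =>
    rw [averaging, averaging, one_mul, trace_mulLR]
    rcases hκ with rfl | rfl
    · rw [h₂.trace_eq_zero (X := X) (i := i₀) (by rw [h0, neg_smul, one_smul])]
      simp
    · simp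
  | cons j l ih =>
    rw [List.nodup_cons] at hl
    rw [List.mem_cons, not_or] at hi₀
    have hκ' : -κ = 1 ∨ -κ = -1 := by rcases hκ with rfl | rfl <;> simp
    have step : ∀ i, ∀ a : 𝕜, i ≠ j → e₂ i * X = a • (X * e₂ i) →
        e₂ i * (e₂ j * X) = -a • (e₂ j * X * e₂ i) := by
      intro i a hij ha
      rw [← Matrix.mul_assoc, h₂.anti i j hij, Matrix.neg_mul, Matrix.mul_assoc, ha,
        Matrix.mul_smul, neg_smul, Matrix.mul_assoc]
    have h1 := ih hl.2 X Y κ hκ hi₀.2 h0 fun i hi => hX i (List.mem_cons_of_mem _ hi)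
    have h2 := ih hl.2 (e₂ j * X) (Y * ((c j : 𝕜) • e₁ j)) (-κ) hκ' hi₀.2 (step i₀ _ hi₀.1 h0)
      fun i hi => step i _ (fun hij => hl.1 (hij ▸ hi)) (hX i (List.mem_cons_of_mem _ hi))
    rw [trace_averaging_cons, trace_averaging_cons]
    linear_combination h1 + h2

theorem trace_averaging_one (h₂ : IsCliffordFamily c e₂) (l : List ι) (hl : l.Nodup) :
    LinearMap.trace 𝕜 _ (averaging 1 (conjLR c e₁ e₂) l) +
      LinearMap.trace 𝕜 _ (averaging (-1) (conjLR c e₁ e₂) l) =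
        2 * ((Fintype.card m : 𝕜) * Fintype.card n) := by
  suffices h : LinearMap.trace 𝕜 _ (averaging 1 (conjLR c e₁ e₂) l * mulLR 1 1) +
      LinearMap.trace 𝕜 _ (averaging (-1) (conjLR c e₁ e₂) l * mulLR 1 1) =
        2 * ((Fintype.card m : 𝕜) * Fintype.card n) by
    simpa only [mulLR_one, mul_one] using h
  induction l with
  | nil =>
    rw [averaging, averaging, one_mul, trace_mulLR, Matrix.trace_one, Matrix.trace_one]
    ring
  | cons j l ih =>
    rw [List.nodup_cons] at hl
    have h := trace_averaging_of_anti (e₁ := e₁) h₂ l hl.2 (e₂ j * 1) (1 * ((c j : 𝕜) • e₁ j)) (-1)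
      (Or.inr rfl) hl.1 (by simp) fun i hi => by
        have := h₂.anti i j fun hij => hl.1 (hij ▸ hi)
        simp [this]
    rw [trace_averaging_cons, trace_averaging_cons]
    linear_combination ih hl.2 + h

theorem conjLR_sq (h₁ : IsCliffordFamily c e₁) (h₂ : IsCliffordFamily c e₂) (i : ι) :
    conjLR c e₁ e₂ i * conjLR c e₁ e₂ i = 1 := by
  have hc : (c i : 𝕜) * c i = 1 := by exact_mod_cast congrArg (Int.cast : ℤ → 𝕜) (h₁.sign i)
  rw [conjLR, mulLR_mul, smul_mul_smul_comm, h₁.sq_smul (𝕜 := 𝕜), h₂.sq_smul (𝕜 := 𝕜)]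
  ext1 T
  simp [mulLR_apply, smul_smul, hc]

theorem conjLR_comm (h₁ : IsCliffordFamily c e₁) (h₂ : IsCliffordFamily c e₂) (i j : ι) :
    conjLR c e₁ e₂ i * conjLR c e₁ e₂ j = conjLR c e₁ e₂ j * conjLR c e₁ e₂ i := by
  by_cases hij : i = j
  · rw [hij]
  · rw [conjLR, conjLR, mulLR_mul, mulLR_mul, h₂.anti i j hij, smul_mul_smul_comm,
      smul_mul_smul_comm, h₁.anti i j hij, mul_comm (c i : 𝕜)]
    ext1 T
    simp [mulLR_apply]

theorem conjLR_eq_smul_iff (h₁ : IsCliffordFamily c e₁) {i : ι} {η : 𝕜} {T : Matrix m n 𝕜} :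
    conjLR c e₁ e₂ i T = η • T ↔ e₂ i * T = η • (T * e₁ i) := by
  have hc : (c i : 𝕜) * c i = 1 := by exact_mod_cast congrArg (Int.cast : ℤ → 𝕜) (h₁.sign i)
  have hs := h₁.sq_smul (𝕜 := 𝕜) i
  rw [conjLR, mulLR_apply]
  constructor
  · intro h
    have := congrArg (· * e₁ i) h
    simpa [Matrix.mul_assoc, hs, smul_smul, hc] using this
  · intro h
    rw [h]
    simp [Matrix.mul_assoc, hs, smul_smul]
    rw [mul_comm (c i : 𝕜), mul_assoc, hc, mul_one]

theorem exists_matrix_intertwiner [Fintype ι] [Nonempty m] [Nonempty n]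
    (h₁ : IsCliffordFamily c e₁) (h₂ : IsCliffordFamily c e₂) :
    ∃ η : 𝕜, (η = 1 ∨ η = -1) ∧ ∃ T : Matrix m n 𝕜, T ≠ 0 ∧
      ∀ i, e₂ i * T = η • (T * e₁ i) := by
  have hl : ∀ i, i ∈ (Finset.univ : Finset ι).toList := by simp
  have h := trace_averaging_one (e₁ := e₁) h₂ (Finset.univ : Finset ι).toList
    (Finset.nodup_toList _)
  have hne : (2 : 𝕜) * ((Fintype.card m : 𝕜) * Fintype.card n) ≠ 0 := by
    simp [Fintype.card_ne_zero]
  have : ∃ η : 𝕜, (η = 1 ∨ η = -1) ∧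
      averaging η (conjLR c e₁ e₂) (Finset.univ : Finset ι).toList ≠ 0 := by
    by_contra! hcon
    rw [hcon 1 (Or.inl rfl), hcon (-1) (Or.inr rfl)] at h
    simp [eq_comm] at h
  obtain ⟨η, hη, hA⟩ := this
  obtain ⟨T, hT⟩ : ∃ T, averaging η (conjLR c e₁ e₂) (Finset.univ : Finset ι).toList T ≠ 0 := by
    by_contra! hcon
    exact hA (LinearMap.ext hcon)
  have hη2 : η * η = 1 := by rcases hη with rfl | rfl <;> simp
  refine ⟨η, hη, _, hT, fun i => (conjLR_eq_smul_iff h₁).1 ?_⟩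
  exact congrArg (fun f => f T)
    (averaging_mem hη2 (conjLR_sq h₁ h₂) (conjLR_comm h₁ h₂) _ i (hl i))

/-- Two modules over the same Clifford algebra are related by a nonzero map which commutes with
Clifford multiplication up to a sign. -/
theorem exists_intertwiner [Fintype ι] {S₁ S₂ : Type*} [AddCommGroup S₁] [Module 𝕜 S₁]
    [FiniteDimensional 𝕜 S₁] [Nontrivial S₁] [AddCommGroup S₂] [Module 𝕜 S₂]
    [FiniteDimensional 𝕜 S₂] [Nontrivial S₂] {e₁ : ι → Module.End 𝕜 S₁} {e₂ : ι → Module.End 𝕜 S₂}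
    (h₁ : IsCliffordFamily c e₁) (h₂ : IsCliffordFamily c e₂) :
    ∃ η : ℤ, (η = 1 ∨ η = -1) ∧ ∃ T : S₁ →ₗ[𝕜] S₂, T ≠ 0 ∧
      ∀ i x, e₂ i (T x) = η • T (e₁ i x) := by
  let b₁ := Module.finBasis 𝕜 S₁
  let b₂ := Module.finBasis 𝕜 S₂
  have : Nonempty (Fin (Module.finrank 𝕜 S₁)) := ⟨⟨0, Module.finrank_pos⟩⟩
  have : Nonempty (Fin (Module.finrank 𝕜 S₂)) := ⟨⟨0, Module.finrank_pos⟩⟩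
  have m₁ : IsCliffordFamily c fun i => LinearMap.toMatrix b₁ b₁ (e₁ i) :=
    h₁.map (LinearMap.toMatrixAlgEquiv b₁).toRingEquiv.toRingHom
  have m₂ : IsCliffordFamily c fun i => LinearMap.toMatrix b₂ b₂ (e₂ i) :=
    h₂.map (LinearMap.toMatrixAlgEquiv b₂).toRingEquiv.toRingHom
  obtain ⟨η, hη, T, hT, h⟩ := exists_matrix_intertwiner m₁ m₂
  have key : ∀ i, e₂ i ∘ₗ Matrix.toLin b₁ b₂ T = η • (Matrix.toLin b₁ b₂ T ∘ₗ e₁ i) := by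
    intro i
    have := congrArg (Matrix.toLin b₁ b₂) (h i)
    rw [Matrix.toLin_mul b₁ b₂ b₂, map_smul, Matrix.toLin_mul b₁ b₁ b₂] at this
    simpa using this
  have h0 : Matrix.toLin b₁ b₂ T ≠ 0 := fun h => hT ((Matrix.toLin b₁ b₂).map_eq_zero_iff.1 h)
  rcases hη with rfl | rfl
  · exact ⟨1, Or.inl rfl, _, h0, fun i x => by simpa using LinearMap.congr_fun (key i) x⟩
  · exact ⟨-1, Or.inr rfl, _, h0, fun i x => by simpa using LinearMap.congr_fun (key i) x⟩

end Intertwiner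

section RingPredicates

variable {ι : Type*} {R : Type*} [Ring R]

/-- There is an element of square `-1` anticommuting with the family. -/
def HasAntiUnit (e : ι → R) : Prop := ∃ J : R, J * J = -1 ∧ ∀ i, e i * J = -(J * e i)

/-- The conclusion of Schur's lemma. -/
def IsSchur (e : ι → R) : Prop := ∀ T : R, (∀ i, e i * T = T * e i) → T = 0 ∨ IsUnit T

theorem HasAntiUnit.map {R' : Type*} [Ring R'] {e : ι → R} (h : HasAntiUnit e) (f : R →+* R') :
    HasAntiUnit fun i => f (e i) := by
  obtain ⟨J, hJ, h⟩ := h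
  exact ⟨f J, by rw [← map_mul, hJ, map_neg, map_one], fun i => by
    rw [← map_mul, h, map_neg, map_mul]⟩

theorem HasAntiUnit.of_map {R' : Type*} [Ring R'] {e : ι → R} (f : R ≃+* R')
    (h : HasAntiUnit fun i => f (e i)) : HasAntiUnit e := by
  simpa using h.map f.symm.toRingHom

theorem IsSchur.map {R' : Type*} [Ring R'] {e : ι → R} (h : IsSchur e) (f : R ≃+* R') :
    IsSchur fun i => f (e i) := by
  intro T hT
  rcases h (f.symm T) fun i => f.injective (by simpa using hT i) with h | h
  · exact Or.inl (by simpa using h)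
  · exact Or.inr (by simpa using h.map f)

end RingPredicates

section FrobeniusSchur

open Complex Matrix

variable {n : Type*} [Fintype n] [DecidableEq n] {ι : Type*} {c : ι → ℤ} {e : ι → Matrix n n ℝ}

/-- Transposition of square matrices. -/
def transposeEnd (n : Type*) : Module.End ℝ (Matrix n n ℝ) where
  toFun T := Tᵀ
  map_add' := Matrix.transpose_add
  map_smul' := Matrix.transpose_smul

theorem transposeEnd_apply (T : Matrix n n ℝ) : transposeEnd n T = Tᵀ := rfl

theorem trace_mulLR_transposeEnd (X Y : Matrix n n ℝ) :
    LinearMap.trace ℝ _ (mulLR X Y * transposeEnd n) = (X * Yᵀ).trace := by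
  rw [trace_end_matrix, Matrix.trace]
  refine Finset.sum_congr rfl fun i _ => ?_
  rw [Matrix.diag_apply, Matrix.mul_apply]
  refine Finset.sum_congr rfl fun j _ => ?_
  rw [Module.End.mul_apply, transposeEnd_apply, mulLR_apply]
  simp [Matrix.mul_apply, Matrix.single_apply, ite_and, Finset.sum_ite_eq]

/-- The Frobenius–Schur number of a Clifford family. -/
def fsNumber (η : ℝ) (c : ι → ℤ) (l : List ι) : ℂ :=
  (1 + I) * (l.map fun i => 1 - I * η * c i).prod

theorem IsCliffordFamily.transpose_eq (h : IsCliffordFamily c e)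
    (ho : ∀ i, (e i)ᵀ * e i = 1) (i : ι) : (e i)ᵀ = (c i : ℝ) • e i := by
  have hc : (c i : ℝ) * c i = 1 := by exact_mod_cast congrArg (Int.cast : ℤ → ℝ) (h.sign i)
  have h1 : (e i)ᵀ * (e i * e i) = e i := by rw [← mul_assoc, ho, one_mul]
  rw [h.sq_smul (𝕜 := ℝ), mul_smul_comm, mul_one] at h1
  conv_rhs => rw [← h1]
  rw [smul_smul, hc, one_smul]

theorem trace_averaging_transpose_aux (h : IsCliffordFamily c e) (ho : ∀ i, (e i)ᵀ * e i = 1)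
    (η : ℝ) (l : List ι) (hl : l.Nodup) (X : Matrix n n ℝ) (a : ℝ) (hX : X * X = a • 1) :
    ((∀ i ∈ l, e i * X = X * e i) →
      LinearMap.trace ℝ _ (averaging η (conjLR c e e) l * (mulLR X Xᵀ * transposeEnd n)) =
        Fintype.card n * a * (fsNumber η c l).re) ∧
    ((∀ i ∈ l, e i * X = -(X * e i)) →
      LinearMap.trace ℝ _ (averaging η (conjLR c e e) l * (mulLR X Xᵀ * transposeEnd n)) =
        Fintype.card n * a * (fsNumber η c l).im) := by
  induction l generalizing X a with
  | nil =>
    rw [averaging, one_mul, trace_mulLR_transposeEnd, Matrix.transpose_transpose, hX]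
    simp [fsNumber, mul_comm]
  | cons j l ih =>
    rw [List.nodup_cons] at hl
    have hz : fsNumber η c (j :: l) = fsNumber η c l * (1 - I * η * c j) := by
      simp only [fsNumber, List.map_cons, List.prod_cons]
      ring
    have hre : (fsNumber η c (j :: l)).re =
        (fsNumber η c l).re + η * c j * (fsNumber η c l).im := by
      rw [hz]; simp; ring
    have him : (fsNumber η c (j :: l)).im =
        (fsNumber η c l).im - η * c j * (fsNumber η c l).re := by
      rw [hz]; simp; ring
    have hstep : LinearMap.trace ℝ _
        (averaging η (conjLR c e e) (j :: l) * (mulLR X Xᵀ * transposeEnd n)) =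
        LinearMap.trace ℝ _ (averaging η (conjLR c e e) l * (mulLR X Xᵀ * transposeEnd n)) +
        η * LinearMap.trace ℝ _ (averaging η (conjLR c e e) l *
          (mulLR (e j * X) (e j * X)ᵀ * transposeEnd n)) := by
      rw [averaging, mul_assoc, add_mul, one_mul, smul_mul_assoc, ← mul_assoc (conjLR c e e j),
        conjLR, mulLR_mul, ← h.transpose_eq ho, ← Matrix.transpose_mul, mul_add, map_add,
        mul_smul_comm, map_smul, smul_eq_mul]
    have hij : ∀ i ∈ l, i ≠ j := fun i hi hij => hl.1 (hij ▸ hi)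
    have hs := h.sq_smul (𝕜 := ℝ) j
    refine ⟨fun hcomm => ?_, fun hcomm => ?_⟩
    · have h1 := (ih hl.2 X a hX).1 fun i hi => hcomm i (List.mem_cons_of_mem _ hi)
      have hXj := hcomm j List.mem_cons_self
      have h2 := (ih hl.2 (e j * X) (c j * a) (by
        rw [mul_assoc, ← mul_assoc X, ← hXj, mul_assoc (e j) X, hX, mul_smul_comm, mul_one,
          mul_smul_comm, hs, smul_smul, mul_comm])).2 fun i hi => by
        rw [← mul_assoc, h.anti i j (hij i hi), neg_mul, mul_assoc,
          hcomm i (List.mem_cons_of_mem _ hi), mul_assoc]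
      rw [hstep, h1, h2, hre]
      ring
    · have h1 := (ih hl.2 X a hX).2 fun i hi => hcomm i (List.mem_cons_of_mem _ hi)
      have hXj : X * e j = -(e j * X) := by rw [hcomm j List.mem_cons_self, neg_neg]
      have h2 := (ih hl.2 (e j * X) (-(c j * a)) (by
        rw [mul_assoc, ← mul_assoc X, hXj, neg_mul, mul_assoc (e j) X, hX, mul_neg, mul_smul_comm,
          mul_one, mul_smul_comm, hs, smul_smul, mul_comm, neg_smul])).1 fun i hi => by
        rw [← mul_assoc, h.anti i j (hij i hi), neg_mul, mul_assoc,
          hcomm i (List.mem_cons_of_mem _ hi), mul_neg, neg_neg, mul_assoc]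
      rw [hstep, h1, h2, him]
      ring

theorem trace_averaging_transpose (h : IsCliffordFamily c e) (ho : ∀ i, (e i)ᵀ * e i = 1)
    (η : ℝ) (l : List ι) (hl : l.Nodup) :
    LinearMap.trace ℝ _ (averaging η (conjLR c e e) l * transposeEnd n) =
        Fintype.card n * (fsNumber η c l).re := by
  have := (trace_averaging_transpose_aux h ho η l hl 1 1 (by simp)).1 (by simp)
  simpa [mulLR_one] using this

/-- The matrices commuting (`η = 1`) or anticommuting (`η = -1`) with the family which are
symmetric (`κ = 1`) or skew-symmetric (`κ = -1`). -/
def intertwinerSub (e : ι → Matrix n n ℝ) (η κ : ℝ) : Submodule ℝ (Matrix n n ℝ) where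
  carrier := {T | (∀ i, e i * T = η • (T * e i)) ∧ Tᵀ = κ • T}
  zero_mem' := by simp
  add_mem' := by
    rintro S T ⟨hS, hS'⟩ ⟨hT, hT'⟩
    exact ⟨fun i => by rw [mul_add, hS, hT, add_mul, smul_add],
      by rw [Matrix.transpose_add, hS', hT', smul_add]⟩
  smul_mem' := by
    rintro a T ⟨hT, hT'⟩
    exact ⟨fun i => by rw [mul_smul_comm, hT, smul_mul_assoc, smul_comm],
      by rw [Matrix.transpose_smul, hT', smul_comm]⟩

theorem transposeEnd_comm_conjLR (h : IsCliffordFamily c e) (ho : ∀ i, (e i)ᵀ * e i = 1) (i : ι) :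
    transposeEnd n * conjLR c e e i = conjLR c e e i * transposeEnd n := by
  ext1 T
  simp only [Module.End.mul_apply, transposeEnd_apply, conjLR, ← h.transpose_eq ho, mulLR_apply,
    Matrix.transpose_mul, Matrix.transpose_transpose, mul_assoc]

variable [Fintype ι]

theorem finrank_intertwinerSub (h : IsCliffordFamily c e) (ho : ∀ i, (e i)ᵀ * e i = 1) (η κ : ℝ)
    (hη : η * η = 1) (hκ : κ * κ = 1) :
    (Module.finrank ℝ (intertwinerSub e η κ) : ℝ) = (2 * 2 ^ Fintype.card ι)⁻¹ *
      (LinearMap.trace ℝ _ (averaging η (conjLR c e e) (Finset.univ : Finset ι).toList) +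
        κ * (Fintype.card n * (fsNumber η c (Finset.univ : Finset ι).toList).re)) := by
  set l := (Finset.univ : Finset ι).toList with hl
  have hmem : ∀ i, i ∈ l := by simp [hl]
  have hlen : l.length = Fintype.card ι := by simp [hl, Finset.card_univ]
  rw [← trace_averaging_transpose h ho η l (Finset.nodup_toList _), ← smul_eq_mul κ, ← map_smul,
    ← map_add, ← smul_eq_mul, ← map_smul]
  refine (LinearMap.IsProj.trace (p := intertwinerSub e η κ) ⟨fun T => ?_, fun T hT => ?_⟩).symm
  · have hA : ∀ i, conjLR c e e i * averaging η (conjLR c e e) l =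
        η • averaging η (conjLR c e e) l :=
      fun i => averaging_mem hη (conjLR_sq h h) (conjLR_comm h h) l i (hmem i)
    have hτ : ∀ l : List ι, transposeEnd n * averaging η (conjLR c e e) l =
        averaging η (conjLR c e e) l * transposeEnd n := by
      intro l
      induction l with
      | nil => simp [averaging]
      | cons j l ih =>
        rw [averaging, ← mul_assoc, ih, mul_assoc, mul_assoc, mul_add, add_mul, mul_smul_comm,
          smul_mul_assoc, transposeEnd_comm_conjLR h ho, mul_one, one_mul]
    refine Submodule.smul_mem _ _ ⟨fun i => (conjLR_eq_smul_iff h).1 ?_, ?_⟩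
    · have : conjLR c e e i * (averaging η (conjLR c e e) l +
          κ • (averaging η (conjLR c e e) l * transposeEnd n)) =
          η • (averaging η (conjLR c e e) l +
          κ • (averaging η (conjLR c e e) l * transposeEnd n)) := by
        rw [mul_add, mul_smul_comm, ← mul_assoc, hA, smul_add, smul_mul_assoc, smul_comm κ]
      exact congrArg (fun f => f T) this
    · have h1 := congrArg (fun f => f T) (hτ l)
      have h2 := congrArg (fun f => f Tᵀ) (hτ l)
      simp only [Module.End.mul_apply, transposeEnd_apply, Matrix.transpose_transpose] at h1 h2
      simp only [LinearMap.add_apply, LinearMap.smul_apply, Module.End.mul_apply,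
        transposeEnd_apply, Matrix.transpose_add, Matrix.transpose_smul, h1, h2, smul_add,
        smul_smul, hκ, one_smul]
      rw [add_comm]
  · have h1 : averaging η (conjLR c e e) l T = (2 : ℝ) ^ l.length • T :=
      averaging_apply hη (fun i => (conjLR_eq_smul_iff h).2 (hT.1 i)) l
    simp only [LinearMap.add_apply, LinearMap.smul_apply, Module.End.mul_apply, transposeEnd_apply,
      hT.2, map_smul, smul_smul, h1, hlen, ← add_smul]
    rw [← mul_assoc κ, hκ, one_mul, show (2 * (2 : ℝ) ^ Fintype.card ι)⁻¹ *
      (2 ^ Fintype.card ι + 2 ^ Fintype.card ι) = 1 by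
      field_simp; norm_num, one_smul]

theorem finrank_sub_finrank (h : IsCliffordFamily c e) (ho : ∀ i, (e i)ᵀ * e i = 1) (η : ℝ)
    (hη : η * η = 1) :
    (Module.finrank ℝ (intertwinerSub e η 1) : ℝ) - Module.finrank ℝ (intertwinerSub e η (-1)) =
      (2 ^ Fintype.card ι)⁻¹ *
        (Fintype.card n * (fsNumber η c (Finset.univ : Finset ι).toList).re) := by
  rw [finrank_intertwinerSub h ho η 1 hη (by simp), finrank_intertwinerSub h ho η (-1) hη (by simp)]
  field_simp
  ring

end FrobeniusSchur

section Orthogonal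

open Complex Matrix
open scoped MatrixOrder

variable {n : Type*} [Fintype n] [DecidableEq n] {ι : Type*} {c : ι → ℤ} {e : ι → Matrix n n ℝ}

theorem IsCliffordFamily.exists_posDef (h : IsCliffordFamily c e) (l : List ι) :
    ∃ P : Matrix n n ℝ, P.PosDef ∧ ∀ i ∈ l, (e i)ᵀ * P * e i = P := by
  induction l with
  | nil => exact ⟨1, Matrix.PosDef.one, by simp⟩
  | cons j l ih =>
    obtain ⟨P, hP, hl⟩ := ih
    have hc : (c j : ℝ) * c j = 1 := by exact_mod_cast congrArg (Int.cast : ℤ → ℝ) (h.sign j)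
    have hj : (e j)ᵀ * ((e j)ᵀ * P * e j) * e j = P := by
      have hs := h.sq_smul (𝕜 := ℝ) j
      have : (e j)ᵀ * ((e j)ᵀ * P * e j) * e j = (e j * e j)ᵀ * P * (e j * e j) := by
        simp only [Matrix.transpose_mul, mul_assoc]
      rw [this, hs]
      simp [smul_smul, hc]
    refine ⟨P + (e j)ᵀ * P * e j, hP.add_posSemidef ?_, fun i hi => ?_⟩
    · have := hP.posSemidef.conjTranspose_mul_mul_same (e j)
      rwa [Matrix.conjTranspose_eq_transpose_of_trivial] at this
    · by_cases hij : i = j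
      · subst hij
        rw [mul_add, add_mul, hj, add_comm]
      · have hil := (List.mem_cons.1 hi).resolve_left hij
        have : (e i)ᵀ * ((e j)ᵀ * P * e j) * e i = (e j * e i)ᵀ * P * (e j * e i) := by
          simp only [Matrix.transpose_mul, mul_assoc]
        rw [mul_add, add_mul, hl i hil, this, h.anti j i (Ne.symm hij), Matrix.transpose_neg,
          neg_mul, neg_mul_neg, Matrix.transpose_mul]
        have hji : (e j)ᵀ * P * e j = (e j)ᵀ * ((e i)ᵀ * P * e i) * e j := by rw [hl i hil]
        rw [hji]
        simp only [mul_assoc]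

/-- Every real Clifford family of matrices is conjugate to a family of orthogonal matrices. -/
theorem IsCliffordFamily.exists_orthogonal [Fintype ι] (h : IsCliffordFamily c e) :
    ∃ f : Matrix n n ℝ ≃+* Matrix n n ℝ, ∀ i, (f (e i))ᵀ * f (e i) = 1 := by
  obtain ⟨P, hP, hl⟩ := h.exists_posDef (Finset.univ : Finset ι).toList
  obtain ⟨C, hC⟩ := CStarAlgebra.nonneg_iff_eq_star_mul_self.mp hP.posSemidef.nonneg
  rw [Matrix.star_eq_conjTranspose, Matrix.conjTranspose_eq_transpose_of_trivial] at hC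
  have hu : IsUnit C := by
    have := hP.isUnit
    rw [hC, Matrix.isUnit_iff_isUnit_det, Matrix.det_mul] at this
    exact (Matrix.isUnit_iff_isUnit_det _).2 (isUnit_of_mul_isUnit_right this)
  obtain ⟨u, rfl⟩ := hu
  refine ⟨{
    toFun := fun T => u * T * (u⁻¹ : (Matrix n n ℝ)ˣ)
    invFun := fun T => (u⁻¹ : (Matrix n n ℝ)ˣ) * T * u
    left_inv := fun T => by simp [mul_assoc]
    right_inv := fun T => by simp [mul_assoc]
    map_mul' := fun S T => by simp [mul_assoc]
    map_add' := fun S T => by simp [mul_add, add_mul] }, fun i => ?_⟩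
  have hi := hl i (by simp)
  set D : Matrix n n ℝ := ((u⁻¹ : (Matrix n n ℝ)ˣ) : Matrix n n ℝ) with hD
  have hUD : (u : Matrix n n ℝ) * D = 1 := u.mul_inv
  have hDU : Dᵀ * (u : Matrix n n ℝ)ᵀ = 1 := by
    rw [← Matrix.transpose_mul, hUD, Matrix.transpose_one]
  change ((u : Matrix n n ℝ) * e i * D)ᵀ * ((u : Matrix n n ℝ) * e i * D) = 1
  calc ((u : Matrix n n ℝ) * e i * D)ᵀ * ((u : Matrix n n ℝ) * e i * D)
      = Dᵀ * ((e i)ᵀ * ((u : Matrix n n ℝ)ᵀ * u) * e i) * D := by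
        simp only [Matrix.transpose_mul, mul_assoc]
    _ = Dᵀ * (u : Matrix n n ℝ)ᵀ * (u * D) := by
        rw [← hC, hi, hC]; simp only [mul_assoc]
    _ = 1 := by rw [hDU, hUD, one_mul]

variable [Nonempty n]

theorem IsSchur.eq_smul_one (hS : IsSchur e) {T : Matrix n n ℝ} (hT : ∀ i, e i * T = T * e i)
    (hs : Tᵀ = T) : ∃ a : ℝ, T = a • 1 := by
  have hh : T.IsHermitian := by
    rwa [Matrix.IsHermitian, Matrix.conjTranspose_eq_transpose_of_trivial]
  let j : n := Classical.arbitrary n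
  refine ⟨hh.eigenvalues j, ?_⟩
  rcases hS (T - hh.eigenvalues j • 1) fun i => by simp [mul_sub, sub_mul, hT] with h | h
  · exact sub_eq_zero.1 h
  · exfalso
    have hv : (T - hh.eigenvalues j • 1) *ᵥ ⇑(hh.eigenvectorBasis j) = 0 := by
      rw [Matrix.sub_mulVec, hh.mulVec_eigenvectorBasis, Matrix.smul_mulVec, Matrix.one_mulVec,
        sub_self]
    have h0 : (⇑(hh.eigenvectorBasis j) : n → ℝ) = 0 :=
      (Matrix.mulVec_injective_of_isUnit h) (hv.trans (Matrix.mulVec_zero _).symm)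
    exact hh.eigenvectorBasis.toBasis.ne_zero j (by
      rw [OrthonormalBasis.coe_toBasis]
      exact WithLp.ofLp_injective 2 h0)

theorem trace_transpose_mul_self_pos {T : Matrix n n ℝ} (hT : T ≠ 0) : 0 < (Tᵀ * T).trace := by
  have h := (Matrix.posSemidef_conjTranspose_mul_self T).trace_nonneg
  have h0 := (Matrix.trace_conjTranspose_mul_self_eq_zero_iff (A := T)).not.2 hT
  rw [Matrix.conjTranspose_eq_transpose_of_trivial] at h h0
  exact lt_of_le_of_ne h (Ne.symm h0)

/-- A nonzero matrix anticommuting with an irreducible orthogonal family is orthogonal up to a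
positive factor. -/
theorem IsSchur.transpose_mul_self (hS : IsSchur e) (h : IsCliffordFamily c e)
    (ho : ∀ i, (e i)ᵀ * e i = 1) {T : Matrix n n ℝ} (hT : ∀ i, e i * T = -(T * e i)) (h0 : T ≠ 0) :
    ∃ a : ℝ, 0 < a ∧ Tᵀ * T = a • 1 := by
  have hT' : ∀ i, e i * Tᵀ = -(Tᵀ * e i) := by
    intro i
    have hc : (c i : ℝ) ≠ 0 := fun h0 => by
      have := h.sign i
      rw [Int.cast_eq_zero.1 h0] at this
      simp at this
    have h1 := congrArg Matrix.transpose (hT i)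
    rw [Matrix.transpose_mul, Matrix.transpose_neg, Matrix.transpose_mul, h.transpose_eq ho,
      mul_smul_comm, smul_mul_assoc, ← smul_neg] at h1
    rw [smul_right_injective _ hc h1, neg_neg]
  obtain ⟨a, ha⟩ := hS.eq_smul_one (T := Tᵀ * T) (fun i => by
    rw [← mul_assoc, hT', neg_mul, mul_assoc, hT, mul_neg, neg_neg, mul_assoc])
    (by rw [Matrix.transpose_mul, Matrix.transpose_transpose])
  refine ⟨a, ?_, ha⟩
  have hpos := trace_transpose_mul_self_pos h0
  rw [ha, Matrix.trace_smul, Matrix.trace_one, smul_eq_mul] at hpos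
  exact pos_of_mul_pos_left hpos (Nat.cast_nonneg _)

variable [Fintype ι]

theorem hasAntiUnit_of_fsNumber_neg (hS : IsSchur e) (h : IsCliffordFamily c e)
    (ho : ∀ i, (e i)ᵀ * e i = 1) (hneg : (fsNumber (-1) c (Finset.univ : Finset ι).toList).re < 0) :
    HasAntiUnit e := by
  have hd := finrank_sub_finrank h ho (-1) (by simp)
  have hn : (0 : ℝ) < Fintype.card n := by exact_mod_cast Fintype.card_pos
  have hlt : (Module.finrank ℝ (intertwinerSub e (-1) 1) : ℝ) -
      Module.finrank ℝ (intertwinerSub e (-1) (-1)) < 0 := by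
    rw [hd]
    exact mul_neg_of_pos_of_neg (by positivity) (mul_neg_of_pos_of_neg hn hneg)
  have hne : intertwinerSub e (-1) (-1) ≠ ⊥ := by
    intro hbot
    rw [hbot, finrank_bot] at hlt
    have : (0 : ℝ) ≤ (Module.finrank ℝ (intertwinerSub e (-1) 1) : ℝ) := Nat.cast_nonneg _
    simp at hlt
    linarith
  obtain ⟨T, ⟨hT, hT'⟩, h0⟩ := Submodule.exists_mem_ne_zero_of_ne_bot hne
  simp only [neg_smul, one_smul] at hT hT'
  obtain ⟨a, ha, hTT⟩ := hS.transpose_mul_self h ho hT h0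
  rw [hT', neg_mul, neg_eq_iff_eq_neg] at hTT
  refine ⟨(Real.sqrt a)⁻¹ • T, ?_, fun i => ?_⟩
  · rw [smul_mul_smul_comm, hTT, smul_neg, smul_smul, ← mul_inv, Real.mul_self_sqrt ha.le,
      inv_mul_cancel₀ ha.ne', one_smul]
  · rw [mul_smul_comm, hT, smul_mul_assoc, smul_neg]

theorem not_hasAntiUnit_of_fsNumber (hS : IsSchur e) (h : IsCliffordFamily c e)
    (ho : ∀ i, (e i)ᵀ * e i = 1) (hpos : 0 ≤ (fsNumber 1 c (Finset.univ : Finset ι).toList).re)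
    (hpos' : 0 < (fsNumber (-1) c (Finset.univ : Finset ι).toList).re) : ¬HasAntiUnit e := by
  rintro ⟨J, hJ, hJe⟩
  have hn : (0 : ℝ) < Fintype.card n := by exact_mod_cast Fintype.card_pos
  have hJ0 : J ≠ 0 := by rintro rfl; simp at hJ
  -- `J` is skew-symmetric
  obtain ⟨a, ha, hJJ⟩ := hS.transpose_mul_self h ho hJe hJ0
  have h1 : Jᵀ = -a • J := by
    have := congrArg (· * J) hJJ
    simp only [mul_assoc, hJ, mul_neg, mul_one, smul_mul_assoc, one_mul] at this
    rw [neg_smul, ← this, neg_neg]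
  have h2 : (a * a) • J = (1 : ℝ) • J := by
    conv_rhs => rw [one_smul, ← Matrix.transpose_transpose J, h1, Matrix.transpose_smul, h1,
      smul_smul]
    simp
  have h3 : a = 1 := by
    have := smul_left_injective ℝ hJ0 h2
    nlinarith
  have hJmem : J ∈ intertwinerSub e (-1) (-1) :=
    ⟨fun i => by rw [hJe, neg_smul, one_smul], by rw [h1, h3]⟩
  -- dimension count
  have hA : Module.finrank ℝ (intertwinerSub e 1 1) ≤ 1 := by
    refine finrank_le_one (⟨1, by simp, by simp⟩ : intertwinerSub e 1 1) fun w => ?_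
    obtain ⟨a, ha⟩ := hS.eq_smul_one (T := w.1) (fun i => by simpa using w.2.1 i)
      (by simpa using w.2.2)
    exact ⟨a, Subtype.ext ha.symm⟩
  have hAB := finrank_sub_finrank h ho 1 (by simp)
  have hCD := finrank_sub_finrank h ho (-1) (by simp)
  have hB : Module.finrank ℝ (intertwinerSub e 1 (-1)) ≤
      Module.finrank ℝ (intertwinerSub e 1 1) := by
    have : (0 : ℝ) ≤ (Module.finrank ℝ (intertwinerSub e 1 1) : ℝ) -
        Module.finrank ℝ (intertwinerSub e 1 (-1)) := by rw [hAB]; positivity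
    exact_mod_cast sub_nonneg.1 this
  have hC : Module.finrank ℝ (intertwinerSub e (-1) (-1)) <
      Module.finrank ℝ (intertwinerSub e (-1) 1) := by
    have : (0 : ℝ) < (Module.finrank ℝ (intertwinerSub e (-1) 1) : ℝ) -
        Module.finrank ℝ (intertwinerSub e (-1) (-1)) := by rw [hCD]; positivity
    exact_mod_cast sub_pos.1 this
  have hD : 1 ≤ Module.finrank ℝ (intertwinerSub e (-1) (-1)) := by
    rw [Nat.one_le_iff_ne_zero, ← Nat.pos_iff_ne_zero]
    have : Nontrivial (intertwinerSub e (-1) (-1)) :=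
      ⟨⟨J, hJmem⟩, 0, fun h => hJ0 (congrArg Subtype.val h)⟩
    exact Module.finrank_pos
  have hdisj : intertwinerSub e (-1) 1 ⊓ intertwinerSub e (-1) (-1) = ⊥ := by
    rw [eq_bot_iff]
    rintro T ⟨⟨-, hT⟩, ⟨-, hT'⟩⟩
    rw [one_smul] at hT
    rw [hT, neg_smul, one_smul] at hT'
    refine (Submodule.mem_bot ℝ).2 (Matrix.ext fun a b => ?_)
    have := congrFun (congrFun hT' a) b
    rw [Matrix.neg_apply] at this
    rw [Matrix.zero_apply]
    linarith
  have hsup := Submodule.finrank_sup_add_finrank_inf_eq (intertwinerSub e (-1) 1)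
    (intertwinerSub e (-1) (-1))
  rw [hdisj, finrank_bot, add_zero] at hsup
  have hinj : Function.Injective (LinearMap.mulLeft ℝ J) := by
    intro S T hST
    have := congrArg (J * ·) hST
    simpa [← mul_assoc, hJ] using this
  have hmap : (intertwinerSub e (-1) 1 ⊔ intertwinerSub e (-1) (-1)).map (LinearMap.mulLeft ℝ J) ≤
      intertwinerSub e 1 1 ⊔ intertwinerSub e 1 (-1) := by
    have key : ∀ T : Matrix n n ℝ, (∀ i, e i * T = -(T * e i)) →
        J * T ∈ intertwinerSub e 1 1 ⊔ intertwinerSub e 1 (-1) := by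
      intro T hT
      have hc : ∀ i, e i * (J * T) = J * T * e i := fun i => by
        rw [← mul_assoc, hJe, neg_mul, mul_assoc, hT, mul_neg, neg_neg, mul_assoc]
      have hc' : ∀ i, e i * (J * T)ᵀ = (J * T)ᵀ * e i := by
        intro i
        have hci : (c i : ℝ) ≠ 0 := fun h0 => by
          have := h.sign i
          rw [Int.cast_eq_zero.1 h0] at this
          simp at this
        have h1 := congrArg Matrix.transpose (hc i)
        rw [Matrix.transpose_mul, Matrix.transpose_mul (J * T), h.transpose_eq ho, mul_smul_comm,
          smul_mul_assoc] at h1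
        exact (smul_right_injective _ hci h1).symm
      have hsplit : J * T = (1 / 2 : ℝ) • (J * T + (J * T)ᵀ) +
          (1 / 2 : ℝ) • (J * T - (J * T)ᵀ) := by
        module
      rw [hsplit]
      refine Submodule.add_mem_sup (Submodule.smul_mem _ _ ⟨fun i => ?_, ?_⟩)
        (Submodule.smul_mem _ _ ⟨fun i => ?_, ?_⟩)
      · rw [mul_add, hc, hc', one_smul, add_mul]
      · rw [Matrix.transpose_add, Matrix.transpose_transpose, one_smul, add_comm]
      · rw [mul_sub, hc, hc', one_smul, sub_mul]
      · rw [Matrix.transpose_sub, Matrix.transpose_transpose, neg_smul, one_smul, neg_sub]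
    rw [Submodule.map_sup, sup_le_iff]
    constructor
    · rintro _ ⟨T, hT, rfl⟩
      exact key T fun i => by simpa using hT.1 i
    · rintro _ ⟨T, hT, rfl⟩
      exact key T fun i => by simpa using hT.1 i
  have h5 := Submodule.finrank_mono hmap
  rw [← (Submodule.equivMapOfInjective _ hinj _).finrank_eq] at h5
  have h6 := Submodule.finrank_add_le_finrank_add_finrank (intertwinerSub e 1 1)
    (intertwinerSub e 1 (-1))
  omega

end Orthogonal

section SpinorModules

/-- The squares of the generators of the Clifford algebra. -/
def genSq {p q : ℕ} : Idx p q → ℤ := Sum.elim (fun _ => -1) (fun _ => 1)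

theorem cast_genSq {p q : ℕ} (i : Idx p q) : (genSq i : ℝ) = -sgn i := by
  rcases i with i | i <;> simp [genSq, sgn]

theorem gen_mul_gen {p q : ℕ} {i j : Idx p q} (hij : i ≠ j) :
    (gen i : Cl p q) * gen j = -(gen j * gen i) := by
  rw [eq_neg_iff_add_eq_zero]
  refine (CliffordAlgebra.ι_mul_ι_add_swap _ _).trans ?_
  have : QuadraticMap.polar (cliffordForm p q) (Pi.single i 1) (Pi.single j 1) = 0 := by
    simp only [QuadraticMap.polar, cliffordForm_apply, ← Finset.sum_sub_distrib]
    refine Finset.sum_eq_zero fun k _ => ?_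
    by_cases h1 : k = i <;> by_cases h2 : k = j <;> simp_all
  rw [this, map_zero]

theorem gen_isCliffordFamily (p q : ℕ) : IsCliffordFamily genSq (gen : Idx p q → Cl p q) where
  sq i := by rw [gen_mul_self, ← cast_genSq, map_intCast]
  anti i j hij := gen_mul_gen hij
  sign i := by rcases i with i | i <;> simp [genSq]

theorem sum_genSq (p q : ℕ) :
    ((Finset.univ : Finset (Idx p q)).toList.map genSq).sum = (q : ℤ) - p := by
  rw [Finset.sum_map_toList, Fintype.sum_sum_type]
  simp [genSq]
  ring

open Complex in
theorem fsNumber_genSq (p q : ℕ) (η : ℝ) :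
    fsNumber η genSq (Finset.univ : Finset (Idx p q)).toList =
      (1 + I) * ((1 + I * η) ^ p * (1 - I * η) ^ q) := by
  rw [fsNumber, Finset.prod_map_toList, Fintype.prod_sum_type]
  simp [genSq]

open Complex in
theorem one_add_I_pow_mul (a b : ℕ) (r : ℕ) (h : ((a : ℤ) - b) % 8 = r) :
    ∃ k : ℝ, 0 < k ∧ (1 + I) ^ a * (1 - I) ^ b = k * (1 + I) ^ r := by
  have h4 : (1 + I) ^ 4 = -4 := by
    rw [show (1 + I) ^ 4 = ((1 + I) ^ 2) ^ 2 by ring, show (1 + I) ^ 2 = 2 * I by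
      linear_combination I_mul_I]
    linear_combination 4 * I_mul_I
  have h8 : (1 + I) ^ 8 = 16 := by
    rw [show (1 + I) ^ 8 = ((1 + I) ^ 4) ^ 2 by ring, h4]; norm_num
  have h7 : 1 - I = (8 : ℂ)⁻¹ * (1 + I) ^ 7 := by
    have : (1 + I) ^ 7 = 8 * (1 - I) := by
      rw [show (1 + I) ^ 7 = (1 + I) ^ 4 * (1 + I) * (1 + I) ^ 2 by ring, h4]
      linear_combination (-4 * I - 12) * I_mul_I
    rw [this]; ring
  obtain ⟨k, hk⟩ : ∃ k : ℕ, a + 7 * b = 8 * k + r := ⟨(a + 7 * b - r) / 8, by omega⟩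
  refine ⟨(8 ^ b)⁻¹ * 16 ^ k, by positivity, ?_⟩
  rw [h7, mul_pow, ← pow_mul, mul_left_comm, ← pow_add, hk, pow_add, pow_mul, h8]
  push_cast
  rw [inv_pow]
  ring

theorem fsNumber_neg_one_neg {p q : ℕ}
    (h : ((p : ℤ) - q) % 8 = 4 ∨ ((p : ℤ) - q) % 8 = 5) :
    (fsNumber (-1) genSq (Finset.univ : Finset (Idx p q)).toList).re < 0 := by
  have e : fsNumber (-1) genSq (Finset.univ : Finset (Idx p q)).toList =
      (1 + Complex.I) ^ (q + 1) * (1 - Complex.I) ^ p := by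
    rw [fsNumber_genSq]; push_cast; ring
  rw [e]
  rcases h with h | h
  · obtain ⟨k, hk, h⟩ := one_add_I_pow_mul (q + 1) p 5 (by omega)
    rw [h]
    simp [pow_succ]
    linarith
  · obtain ⟨k, hk, h⟩ := one_add_I_pow_mul (q + 1) p 4 (by omega)
    rw [h]
    simp [pow_succ]
    linarith

theorem fsNumber_neg_one_pos {p q : ℕ}
    (h : ((p : ℤ) - q) % 8 = 0 ∨ ((p : ℤ) - q) % 8 = 1) :
    0 < (fsNumber (-1) genSq (Finset.univ : Finset (Idx p q)).toList).re := by
  have e : fsNumber (-1) genSq (Finset.univ : Finset (Idx p q)).toList =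
      (1 + Complex.I) ^ (q + 1) * (1 - Complex.I) ^ p := by
    rw [fsNumber_genSq]; push_cast; ring
  rw [e]
  rcases h with h | h
  · obtain ⟨k, hk, h⟩ := one_add_I_pow_mul (q + 1) p 1 (by omega)
    rw [h]
    simp [hk]
  · obtain ⟨k, hk, h⟩ := one_add_I_pow_mul (q + 1) p 0 (by omega)
    rw [h]
    simp [hk]

theorem fsNumber_one_nonneg {p q : ℕ}
    (h : ((p : ℤ) - q) % 8 = 0 ∨ ((p : ℤ) - q) % 8 = 1) :
    0 ≤ (fsNumber 1 genSq (Finset.univ : Finset (Idx p q)).toList).re := by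
  have e : fsNumber 1 genSq (Finset.univ : Finset (Idx p q)).toList =
      (1 + Complex.I) ^ (p + 1) * (1 - Complex.I) ^ q := by
    rw [fsNumber_genSq]; push_cast; ring
  rw [e]
  rcases h with h | h
  · obtain ⟨k, hk, h⟩ := one_add_I_pow_mul (p + 1) q 1 (by omega)
    rw [h]
    simp [hk.le]
  · obtain ⟨k, hk, h⟩ := one_add_I_pow_mul (p + 1) q 2 (by omega)
    rw [h]
    simp [pow_succ]

/-! ### Endomorphisms anticommuting with Clifford multiplication -/

theorem list_prod_mul_anti {ι R : Type*} [Ring R] {e : ι → R} {J : R}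
    (h : ∀ i, e i * J = -(J * e i)) (l : List ι) :
    (l.map e).prod * J = (-1) ^ l.length * (J * (l.map e).prod) := by
  induction l with
  | nil => simp
  | cons j l ih =>
    rw [List.map_cons, List.prod_cons, List.length_cons, mul_assoc, ih, pow_succ]
    rcases neg_one_pow_eq_or R l.length with hl | hl <;> simp [hl, ← mul_assoc, h]

section Volume

variable {𝕜 : Type*} [Field 𝕜] [CharZero 𝕜] {R : Type*} [Ring R] [Algebra 𝕜 R] {p q : ℕ}
  {e : Idx p q → R}

/-- The volume element. -/
def volume (e : Idx p q → R) : R := ((Finset.univ : Finset (Idx p q)).toList.map e).prod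

theorem length_univ_toList (p q : ℕ) :
    (Finset.univ : Finset (Idx p q)).toList.length = p + q := by
  simp

theorem volume_sq (h : IsCliffordFamily genSq e) :
    volume e * volume e = (IsCliffordFamily.volSign ((p : ℤ) - q) : ℤ) := by
  have := (h.prod_sq (Finset.univ : Finset (Idx p q)).toList (Finset.nodup_toList _)).1
  rwa [sum_genSq, neg_sub] at this

theorem gen_mul_volume (h : IsCliffordFamily genSq e) (i : Idx p q) :
    e i * volume e = -((-1) ^ (p + q) * (volume e * e i)) := by
  have := h.prod_mem i (Finset.univ : Finset (Idx p q)).toList (Finset.nodup_toList _) (by simp)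
  rwa [length_univ_toList] at this

theorem hasAntiUnit_of_even (h : IsCliffordFamily genSq e) (hn : Even (p + q)) (a : 𝕜)
    (ha : a * a * (IsCliffordFamily.volSign ((p : ℤ) - q) : ℤ) = -1) : HasAntiUnit e := by
  refine ⟨a • volume e, ?_, fun i => ?_⟩
  · rw [smul_mul_smul_comm, volume_sq h, ← Int.smul_one_eq_cast, ← Int.cast_smul_eq_zsmul 𝕜,
      smul_smul, ha, neg_smul, one_smul]
  · rw [mul_smul_comm, gen_mul_volume h, hn.neg_one_pow, one_mul, smul_mul_assoc, smul_neg]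

theorem not_hasAntiUnit_of_odd [Nontrivial R] (h : IsCliffordFamily genSq e) (hS : IsSchur e)
    (hn : Odd (p + q)) (a : 𝕜)
    (ha : a * a * (IsCliffordFamily.volSign ((p : ℤ) - q) : ℤ) = 1) : ¬HasAntiUnit e := by
  rintro ⟨J, hJ, hJe⟩
  have hc : ∀ i, e i * (a • volume e) = a • volume e * e i := fun i => by
    rw [mul_smul_comm, gen_mul_volume h, hn.neg_one_pow, neg_one_mul, neg_neg, smul_mul_assoc]
  have hsq : (a • volume e) * (a • volume e) = 1 := by
    rw [smul_mul_smul_comm, volume_sq h, ← Int.smul_one_eq_cast, ← Int.cast_smul_eq_zsmul 𝕜,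
      smul_smul, ha, one_smul]
  have hω : a • volume e = 1 ∨ a • volume e = -1 := by
    rcases hS (a • volume e - 1) fun i => by rw [mul_sub, sub_mul, hc, mul_one, one_mul]
      with h0 | h0
    · exact Or.inl (sub_eq_zero.1 h0)
    · right
      have : (a • volume e - 1) * (a • volume e + 1) = 0 := by
        rw [sub_mul, mul_add, hsq, one_mul, mul_one, add_comm, sub_self]
      exact eq_neg_of_add_eq_zero_left (h0.mul_right_eq_zero.1 this)
  have hanti : (a • volume e) * J = -(J * (a • volume e)) := by
    have := list_prod_mul_anti hJe (Finset.univ : Finset (Idx p q)).toList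
    rw [length_univ_toList, hn.neg_one_pow, neg_one_mul] at this
    rw [smul_mul_assoc, mul_smul_comm, ← smul_neg]
    exact congrArg (a • ·) this
  have h2 : (2 : 𝕜) • J = 0 := by
    rw [two_smul]
    rcases hω with hω | hω <;> rw [hω] at hanti
    · rw [one_mul, mul_one] at hanti
      nth_rw 1 [hanti]; simp
    · rw [neg_mul, mul_neg, one_mul, mul_one, neg_neg] at hanti
      nth_rw 1 [← hanti]; simp
  have hJ0 : J = 0 := by
    have := congrArg ((2 : 𝕜)⁻¹ • ·) h2
    simpa using this
  rw [hJ0, mul_zero] at hJ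
  exact one_ne_zero (neg_eq_zero.1 hJ.symm)

end Volume

section Real

variable {S : Type*} [AddCommGroup S] [Module ℝ S] [FiniteDimensional ℝ S] [Nontrivial S]
  {p q : ℕ} {e : Idx p q → Module.End ℝ S}

theorem exists_orthogonal_model (h : IsCliffordFamily genSq e) :
    ∃ f : Module.End ℝ S ≃+* Matrix (Fin (Module.finrank ℝ S)) (Fin (Module.finrank ℝ S)) ℝ,
      ∀ i, (f (e i)).transpose * f (e i) = 1 := by
  let b := Module.finBasis ℝ S
  have m : IsCliffordFamily genSq fun i => (LinearMap.toMatrixAlgEquiv b).toRingEquiv (e i) :=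
    h.map (LinearMap.toMatrixAlgEquiv b).toRingEquiv.toRingHom
  obtain ⟨f, hf⟩ := m.exists_orthogonal
  exact ⟨(LinearMap.toMatrixAlgEquiv b).toRingEquiv.trans f, hf⟩

theorem hasAntiUnit_real (h : IsCliffordFamily genSq e) (hS : IsSchur e)
    (hs : ((p : ℤ) - q) % 8 = 2 ∨ ((p : ℤ) - q) % 8 = 4 ∨
      ((p : ℤ) - q) % 8 = 5 ∨ ((p : ℤ) - q) % 8 = 6) : HasAntiUnit e := by
  by_cases h2 : ((p : ℤ) - q) % 4 = 2
  · refine hasAntiUnit_of_even (𝕜 := ℝ) h (by rw [Nat.even_iff]; omega) 1 ?_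
    rw [IsCliffordFamily.volSign, if_neg (by omega)]
    simp
  · have : Nonempty (Fin (Module.finrank ℝ S)) := ⟨⟨0, Module.finrank_pos⟩⟩
    obtain ⟨f, hf⟩ := exists_orthogonal_model h
    exact HasAntiUnit.of_map f (hasAntiUnit_of_fsNumber_neg (hS.map f) (h.map f.toRingHom) hf
      (fsNumber_neg_one_neg (by omega)))

theorem not_hasAntiUnit_real (h : IsCliffordFamily genSq e) (hS : IsSchur e)
    (hs : ((p : ℤ) - q) % 8 = 0 ∨ ((p : ℤ) - q) % 8 = 1 ∨
      ((p : ℤ) - q) % 8 = 3 ∨ ((p : ℤ) - q) % 8 = 7) : ¬HasAntiUnit e := by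
  by_cases h3 : ((p : ℤ) - q) % 4 = 3
  · refine not_hasAntiUnit_of_odd (𝕜 := ℝ) h hS (by rw [Nat.odd_iff]; omega) 1 ?_
    rw [IsCliffordFamily.volSign, if_pos (by omega)]
    simp
  · have : Nonempty (Fin (Module.finrank ℝ S)) := ⟨⟨0, Module.finrank_pos⟩⟩
    obtain ⟨f, hf⟩ := exists_orthogonal_model h
    intro hJ
    exact not_hasAntiUnit_of_fsNumber (hS.map f) (h.map f.toRingHom) hf
      (fsNumber_one_nonneg (by omega)) (fsNumber_neg_one_pos (by omega)) (hJ.map f.toRingHom)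

end Real

section Complex

variable {S : Type*} [AddCommGroup S] [Module ℂ S] {p q : ℕ} {e : Idx p q → Module.End ℂ S}

theorem hasAntiUnit_complex (h : IsCliffordFamily genSq e) (hn : Even (p + q)) :
    HasAntiUnit e := by
  by_cases hs : ((p : ℤ) - q) % 4 = 0 ∨ ((p : ℤ) - q) % 4 = 3
  · refine hasAntiUnit_of_even (𝕜 := ℂ) h hn Complex.I ?_
    rw [IsCliffordFamily.volSign, if_pos hs]
    simp
  · refine hasAntiUnit_of_even (𝕜 := ℂ) h hn 1 ?_
    rw [IsCliffordFamily.volSign, if_neg hs]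
    simp

theorem not_hasAntiUnit_complex [Nontrivial S] (h : IsCliffordFamily genSq e) (hS : IsSchur e)
    (hn : Odd (p + q)) : ¬HasAntiUnit e := by
  by_cases hs : ((p : ℤ) - q) % 4 = 0 ∨ ((p : ℤ) - q) % 4 = 3
  · refine not_hasAntiUnit_of_odd (𝕜 := ℂ) h hS hn 1 ?_
    rw [IsCliffordFamily.volSign, if_pos hs]
    simp
  · refine not_hasAntiUnit_of_odd (𝕜 := ℂ) h hS hn Complex.I ?_
    rw [IsCliffordFamily.volSign, if_neg hs]
    simp

end Complex

end SpinorModules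

section CliffordModules

variable {ι : Type*} {𝕜 : Type*} [Field 𝕜] {V : Type*} [AddCommGroup V] [Module 𝕜 V]
  {S : Type*} [AddCommGroup S] [Module 𝕜 S] {c : ι → ℤ} {f : ι → Module.End 𝕜 V}
  {e : ι → Module.End 𝕜 S} {J : Module.End 𝕜 V} {W : Submodule 𝕜 V} {η : ℤ} {Φ : V →ₗ[𝕜] S}

/-- `W` is a simple submodule for the operators `f i`. -/
structure IsIrreducibleSub (f : ι → Module.End 𝕜 V) (W : Submodule 𝕜 V) : Prop where
  ne_bot : W ≠ ⊥
  invariant : ∀ i, ∀ w ∈ W, f i w ∈ W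
  irreducible : ∀ W' ≤ W, (∀ i, ∀ w ∈ W', f i w ∈ W') → W' = ⊥ ∨ W' = W

/-- `Φ` restricts to an isomorphism from `W` onto `S` intertwining `f i` and `η e i`. -/
structure IsTwistedIso (f : ι → Module.End 𝕜 V) (e : ι → Module.End 𝕜 S) (W : Submodule 𝕜 V)
    (η : ℤ) (Φ : V →ₗ[𝕜] S) : Prop where
  bijOn : Set.BijOn Φ (W : Set V) Set.univ
  map_apply : ∀ i, ∀ w ∈ W, Φ (f i w) = η • e i (Φ w)

theorem exists_isIrreducibleSub [FiniteDimensional 𝕜 V] [Nontrivial V]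
    (f : ι → Module.End 𝕜 V) : ∃ W, IsIrreducibleSub f W := by
  obtain ⟨W, ⟨h0, h1⟩, h2⟩ := (wellFounded_lt (α := Submodule 𝕜 V)).has_min
    {W | W ≠ ⊥ ∧ ∀ i, ∀ w ∈ W, f i w ∈ W} ⟨⊤, top_ne_bot, fun _ _ _ => trivial⟩
  refine ⟨W, h0, h1, fun W' hW' hinv => ?_⟩
  by_cases hb : W' = ⊥
  · exact Or.inl hb
  · exact Or.inr (eq_of_le_of_not_lt hW' (h2 W' ⟨hb, hinv⟩))

theorem IsIrreducibleSub.isSchur [FiniteDimensional 𝕜 S] (he : IsIrreducibleSub e ⊤) :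
    IsSchur e := by
  intro T hT
  rcases he.irreducible (LinearMap.ker T) le_top fun i w hw => by
    have := congrArg (fun A => A w) (hT i)
    simp only [Module.End.mul_apply] at this
    rw [LinearMap.mem_ker] at hw ⊢
    rw [← this, hw, map_zero] with h | h
  · exact Or.inr ((LinearMap.isUnit_iff_ker_eq_bot _).2 h)
  · exact Or.inl (LinearMap.ker_eq_top.1 h)

theorem IsIrreducibleSub.exists_isTwistedIso [CharZero 𝕜] [Fintype ι] [FiniteDimensional 𝕜 V]
    [FiniteDimensional 𝕜 S] (hf : IsCliffordFamily c f) (he : IsCliffordFamily c e)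
    (hW : IsIrreducibleSub f W) (hS : IsIrreducibleSub e ⊤) :
    ∃ η : ℤ, (η = 1 ∨ η = -1) ∧ ∃ Φ, IsTwistedIso f e W η Φ := by
  have : Nontrivial W := Submodule.nontrivial_iff_ne_bot.2 hW.ne_bot
  have : Nontrivial S := (Submodule.nontrivial_iff 𝕜).1 ⟨⊤, ⊥, hS.ne_bot⟩
  have hr : IsCliffordFamily c fun i => (f i).restrict (hW.invariant i) := by
    refine ⟨fun i => ?_, fun i j hij => ?_, hf.sign⟩
    · ext w
      have := congrArg (fun A => A (w : V)) (hf.sq i)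
      rcases mul_self_eq_one_iff.1 (hf.sign i) with hc | hc <;> rw [hc] at this ⊢ <;>
        simpa using this
    · ext w
      have := congrArg (fun A => A (w : V)) (hf.anti i j hij)
      simpa using this
  obtain ⟨η, hη, T, hT, hTe⟩ := exists_intertwiner hr he
  have hηη : η * η = 1 := by rcases hη with rfl | rfl <;> rfl
  have hTe' : ∀ i x, T ((f i).restrict (hW.invariant i) x) = η • e i (T x) := fun i x => by
    rw [hTe, smul_smul, hηη, one_smul]
  obtain ⟨Φ, hΦ⟩ := T.exists_extend
  have hΦT : ∀ w : W, Φ w = T w := fun w => congrArg (fun A => A w) hΦ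
  have hker : LinearMap.ker T = ⊥ := by
    rcases hW.irreducible ((LinearMap.ker T).map W.subtype) (Submodule.map_subtype_le _ _) (by
      rintro i _ ⟨w, hw, rfl⟩
      refine ⟨(f i).restrict (hW.invariant i) w, ?_, rfl⟩
      rw [SetLike.mem_coe, LinearMap.mem_ker] at hw ⊢
      rw [hTe', hw, map_zero, smul_zero]) with h | h
    · exact (Submodule.map_injective_of_injective W.injective_subtype)
        (h.trans (Submodule.map_bot _).symm)
    · refine absurd (LinearMap.ker_eq_top.1 (eq_top_iff.2 fun w _ => ?_)) hT
      have hw : (w : V) ∈ (LinearMap.ker T).map W.subtype := h.ge w.2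
      obtain ⟨u, hu, huw⟩ := hw
      rwa [← Subtype.ext huw]
  have hran : LinearMap.range T = ⊤ := by
    rcases hS.irreducible (LinearMap.range T) le_top (by
      rintro i _ ⟨w, rfl⟩
      rw [hTe]
      exact zsmul_mem (LinearMap.mem_range_self T _) η) with h | h
    · exact absurd (LinearMap.range_eq_bot.1 h) hT
    · exact h
  refine ⟨η, hη, Φ, ⟨⟨fun _ _ => trivial, fun u hu v hv huv => ?_, fun y _ => ?_⟩,
    fun i w hw => ?_⟩⟩
  · have : T ⟨u, hu⟩ = T ⟨v, hv⟩ := by rw [← hΦT, ← hΦT]; exact huv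
    exact congrArg Subtype.val (LinearMap.ker_eq_bot.1 hker this)
  · obtain ⟨w, rfl⟩ := LinearMap.range_eq_top.1 hran y
    exact ⟨w, w.2, hΦT w⟩
  · have := hTe' i ⟨w, hw⟩
    rwa [← hΦT, ← hΦT] at this

theorem apply_apply_of_mul_self (hJ : J * J = -1) (v : V) : J (J v) = -v :=
  congrArg (fun A => A v) hJ

theorem apply_anti (hfJ : ∀ i, f i * J = -(J * f i)) (i : ι) (v : V) :
    f i (J v) = -J (f i v) :=
  congrArg (fun A => A v) (hfJ i)

theorem IsTwistedIso.comp_antiUnit (hJ : J * J = -1) (hfJ : ∀ i, f i * J = -(J * f i))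
    (hΦ : IsTwistedIso f e ⊤ η Φ) : IsTwistedIso f e ⊤ (-η) (Φ.comp J) := by
  have hJ2 := apply_apply_of_mul_self hJ
  refine ⟨⟨fun _ _ => trivial, fun u _ v _ huv => ?_, fun y _ => ?_⟩, fun i w _ => ?_⟩
  · have h := congrArg J (hΦ.bijOn.injOn (x₁ := J u) (x₂ := J v) trivial trivial huv)
    rwa [hJ2, hJ2, neg_inj] at h
  · obtain ⟨w, _, rfl⟩ := hΦ.bijOn.surjOn (Set.mem_univ y)
    exact ⟨-J w, trivial, by simp [hJ2]⟩
  · have h := hΦ.map_apply i (J w) trivial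
    rw [apply_anti hfJ, map_neg, neg_eq_iff_eq_neg] at h
    simpa using h

theorem IsTwistedIso.antiUnit_comp {K : Module.End 𝕜 S} (hK : Function.Bijective K)
    (heK : ∀ i, e i * K = -(K * e i)) (hΦ : IsTwistedIso f e W η Φ) :
    IsTwistedIso f e W (-η) (K.comp Φ) := by
  refine ⟨⟨fun _ _ => trivial, fun u hu v hv huv => hΦ.bijOn.injOn hu hv (hK.1 huv),
    fun y _ => ?_⟩, fun i w hw => ?_⟩
  · obtain ⟨z, rfl⟩ := hK.2 y
    obtain ⟨w, hw, rfl⟩ := hΦ.bijOn.surjOn (Set.mem_univ z)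
    exact ⟨w, hw, rfl⟩
  · rw [LinearMap.comp_apply, hΦ.map_apply i w hw, map_zsmul, LinearMap.comp_apply, apply_anti heK]
    simp

/-- If the operators `f i` and `J` act irreducibly on `V`, and `S` has an operator like `J`, then
the operators `f i` alone act irreducibly on `V`. -/
theorem IsTwistedIso.eq_top [FiniteDimensional 𝕜 V] (hJ : J * J = -1)
    (hfJ : ∀ i, f i * J = -(J * f i))
    (hV : ∀ W : Submodule 𝕜 V, (∀ i, ∀ w ∈ W, f i w ∈ W) → (∀ w ∈ W, J w ∈ W) → W = ⊥ ∨ W = ⊤)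
    (hW : IsIrreducibleSub f W) (hΦ : IsTwistedIso f e W η Φ) (he : HasAntiUnit e) : W = ⊤ := by
  obtain ⟨K, hK, heK⟩ := he
  obtain ⟨Ψ, hΨW, hΦΨ, hΨΦ⟩ := exists_linearInverse hΦ.bijOn
  have hJ2 := apply_apply_of_mul_self hJ
  have hK2 := apply_apply_of_mul_self hK
  let L : V →ₗ[𝕜] V := Ψ.comp (K.comp Φ)
  have hLW : ∀ v, L v ∈ W := fun v => hΨW _
  have hLL : ∀ w ∈ W, L (L w) = -w := fun w hw => by
    simp only [L, LinearMap.comp_apply, hΦΨ, hK2, map_neg, hΨΦ w hw]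
  have hLf : ∀ i, ∀ w ∈ W, L (f i w) = -f i (L w) := fun i w hw => by
    refine hΦ.bijOn.injOn (hLW _) (W.neg_mem (hW.invariant i _ (hLW w))) ?_
    rw [map_neg, hΦ.map_apply i _ (hLW w)]
    simp only [L, LinearMap.comp_apply, hΦΨ, hΦ.map_apply i w hw, map_zsmul, apply_anti heK,
      smul_neg, neg_neg]
  rcases hV (W.map (LinearMap.id + J.comp L)) (by
    rintro i _ ⟨w, hw, rfl⟩
    refine ⟨f i w, hW.invariant i w hw, ?_⟩
    simp only [LinearMap.add_apply, LinearMap.id_apply, LinearMap.comp_apply, map_add,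
      hLf i w hw, apply_anti hfJ, map_neg]) (by
    rintro _ ⟨w, hw, rfl⟩
    refine ⟨-L w, W.neg_mem (hLW w), ?_⟩
    simp only [LinearMap.add_apply, LinearMap.id_apply, LinearMap.comp_apply, map_add,
      map_neg, hLL w hw, hJ2]
    abel) with h | h
  · refine (hV W hW.invariant fun w hw => ?_).resolve_left hW.ne_bot
    have h0 : L w + J (L (L w)) = 0 := by
      rw [← Submodule.mem_bot 𝕜, ← h]
      exact ⟨L w, hLW w, rfl⟩
    rw [hLL w hw, map_neg, ← sub_eq_add_neg, sub_eq_zero] at h0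
    exact h0 ▸ hLW w
  · have h1 := Submodule.finrank_map_le (LinearMap.id + J.comp L) W
    rw [h, finrank_top] at h1
    exact Submodule.eq_top_of_finrank_eq (le_antisymm (Submodule.finrank_le W) h1)

theorem IsIrreducibleSub.map_antiUnit (hJ : J * J = -1) (hfJ : ∀ i, f i * J = -(J * f i))
    (hW : IsIrreducibleSub f W) : IsIrreducibleSub f (W.map J) := by
  have hJ2 := apply_apply_of_mul_self hJ
  have hmap : ∀ U : Submodule 𝕜 V, (U.map J).map J = U := fun U => by
    ext v
    simp only [Submodule.mem_map, exists_exists_and_eq_and, hJ2]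
    exact ⟨by rintro ⟨u, hu, rfl⟩; exact U.neg_mem hu, fun hv => ⟨-v, U.neg_mem hv, neg_neg v⟩⟩
  have hinv : ∀ U : Submodule 𝕜 V, (∀ i, ∀ w ∈ U, f i w ∈ U) →
      ∀ i, ∀ w ∈ U.map J, f i w ∈ U.map J := by
    rintro U hU i _ ⟨w, hw, rfl⟩
    exact ⟨-f i w, U.neg_mem (hU i w hw), by rw [apply_anti hfJ, map_neg]⟩
  refine ⟨fun h => hW.ne_bot ?_, hinv W hW.invariant, fun W' hW' hinv' => ?_⟩
  · rw [← hmap W, h, Submodule.map_bot]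
  · rcases hW.irreducible (W'.map J) ((Submodule.map_mono hW').trans (hmap W).le)
      (hinv W' hinv') with h | h
    · left; rw [← hmap W', h, Submodule.map_bot]
    · right; rw [← hmap W', h]

/-- If the operators `f i` and `J` act irreducibly on `V`, and `S` has no operator like `J`, then
`V` is the sum of `W` and `J W`. -/
theorem IsTwistedIso.isCompl_map (hη : η * η = 1) (hJ : J * J = -1)
    (hfJ : ∀ i, f i * J = -(J * f i))
    (hV : ∀ W : Submodule 𝕜 V, (∀ i, ∀ w ∈ W, f i w ∈ W) → (∀ w ∈ W, J w ∈ W) → W = ⊥ ∨ W = ⊤)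
    (hW : IsIrreducibleSub f W) (hΦ : IsTwistedIso f e W η Φ) (he : ¬HasAntiUnit e) :
    IsCompl W (W.map J) := by
  have hJ2 := apply_apply_of_mul_self hJ
  have hJW : ¬∀ w ∈ W, J w ∈ W := fun hJW => he <| by
    obtain ⟨Ψ, hΨW, hΦΨ, hΨΦ⟩ := exists_linearInverse hΦ.bijOn
    refine ⟨Φ.comp (J.comp Ψ), ?_, fun i => ?_⟩
    · ext y
      simp [hΨΦ _ (hJW _ (hΨW y)), hJ2, hΦΨ]
    · ext y
      have h1 : Ψ (e i y) = η • f i (Ψ y) := by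
        refine hΦ.bijOn.injOn (hΨW _) (zsmul_mem (hW.invariant i _ (hΨW y)) η) ?_
        rw [hΦΨ, map_zsmul, hΦ.map_apply i _ (hΨW y), hΦΨ, smul_smul, hη, one_smul]
      have h2 := hΦ.map_apply i _ (hJW _ (hΨW y))
      rw [apply_anti hfJ, map_neg] at h2
      have h3 := congrArg (η • ·) h2
      simp only [smul_smul, hη, one_smul, smul_neg] at h3
      simp [h1, ← h3]
  have hinv := (hW.map_antiUnit hJ hfJ).invariant
  constructor
  · rw [disjoint_iff]
    refine (hV _ (fun i w hw => Submodule.mem_inf.2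
      ⟨hW.invariant i w hw.1, hinv i w hw.2⟩) ?_).resolve_right fun h =>
      hJW fun w _ => ?_
    · rintro _ ⟨h1, w, hw, rfl⟩
      refine ⟨?_, ⟨_, h1, rfl⟩⟩
      rw [hJ2]
      exact W.neg_mem hw
    · exact (h.symm ▸ Submodule.mem_top : J w ∈ W ⊓ W.map J).1
  · rw [codisjoint_iff]
    refine (hV _ (fun i w hw => ?_) fun w hw => ?_).resolve_left fun h =>
      hW.ne_bot (le_bot_iff.1 (h ▸ le_sup_left))
    · obtain ⟨a, ha, b, hb, rfl⟩ := Submodule.mem_sup.1 hw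
      rw [map_add]
      exact Submodule.add_mem_sup (hW.invariant i a ha) (hinv i b hb)
    · obtain ⟨a, ha, _, ⟨b, hb, rfl⟩, rfl⟩ := Submodule.mem_sup.1 hw
      rw [map_add, hJ2, add_comm]
      exact Submodule.add_mem_sup (W.neg_mem hb) ⟨a, ha, rfl⟩

theorem IsTwistedIso.exists_of_disjoint (hJ : J * J = -1)
    (hfJ : ∀ i, f i * J = -(J * f i)) (hW : IsIrreducibleSub f W) (hΦ : IsTwistedIso f e W η Φ)
    (hc : IsCompl W (W.map J)) {W' : Submodule 𝕜 V} (hW' : IsIrreducibleSub f W')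
    (hd : Disjoint W W') : ∃ Φ', IsTwistedIso f e W' (-η) Φ' := by
  have hJ2 := apply_apply_of_mul_self hJ
  have hinv := (hW.map_antiUnit hJ hfJ).invariant
  let P : V →ₗ[𝕜] V := W.projection (W.map J) hc
  have hPW : ∀ v, P v ∈ W := Submodule.projection_apply_mem hc
  have hPl : ∀ w ∈ W, P w = w := fun w hw => Submodule.projection_apply_left hc ⟨w, hw⟩
  have hP0 : ∀ v, P v = 0 → v ∈ W.map J := fun v =>
    (Submodule.projection_apply_eq_zero_iff hc).1
  have hPr : ∀ v ∈ W.map J, P v = 0 := fun v =>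
    (Submodule.projection_apply_eq_zero_iff hc).2
  have hPf : ∀ i v, P (f i v) = f i (P v) := fun i v => by
    have hv : v ∈ W ⊔ W.map J := hc.sup_eq_top ▸ Submodule.mem_top
    obtain ⟨a, ha, b, hb, rfl⟩ := Submodule.mem_sup.1 hv
    rw [map_add, map_add, map_add, hPl _ (hW.invariant i a ha), hPr _ (hinv i b hb), hPl a ha,
      hPr b hb, add_zero, add_zero]
  have hQf : ∀ i v, P (J (f i v)) = -f i (P (J v)) := fun i v => by
    rw [← hPf, apply_anti hfJ, map_neg, neg_neg]
  have hQ0 : ∀ v ∈ W', P (J v) = 0 → v = 0 := fun v hv h0 => by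
    obtain ⟨w, hw, hwv⟩ := hP0 _ h0
    have := congrArg J hwv
    rw [hJ2, hJ2, neg_inj] at this
    exact Submodule.disjoint_def.1 hd v (this ▸ hw) hv
  have him : W'.map (P.comp J) = W := by
    refine (hW.irreducible _ ?_ ?_).resolve_left fun h => hW'.ne_bot ?_
    · rintro _ ⟨v, _, rfl⟩
      exact hPW _
    · rintro i _ ⟨v, hv, rfl⟩
      refine ⟨-f i v, W'.neg_mem (hW'.invariant i v hv), ?_⟩
      exact (map_neg _ _).trans (neg_eq_iff_eq_neg.2 (hQf i v))
    · refine (Submodule.eq_bot_iff _).2 fun v hv => hQ0 v hv ?_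
      rw [← Submodule.mem_bot 𝕜, ← h]
      exact ⟨v, hv, rfl⟩
  refine ⟨Φ.comp (P.comp J), ⟨fun _ _ => trivial, fun u hu v hv huv => ?_, fun y _ => ?_⟩,
    fun i w _ => ?_⟩
  · have h1 : P (J u) = P (J v) := hΦ.bijOn.injOn (hPW _) (hPW _) huv
    exact sub_eq_zero.1 (hQ0 _ (W'.sub_mem hu hv) (by rw [map_sub, map_sub, h1, sub_self]))
  · obtain ⟨w, hw, rfl⟩ := hΦ.bijOn.surjOn (Set.mem_univ y)
    rw [SetLike.mem_coe, ← him] at hw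
    obtain ⟨v, hv, rfl⟩ := hw
    exact ⟨v, hv, rfl⟩
  · simp only [LinearMap.comp_apply, hQf, map_neg, hΦ.map_apply i _ (hPW _), neg_smul]

end CliffordModules

section ConeModules

variable {𝕜 : Type*} [RCLike 𝕜] {p q : ℕ} {S : Type*} [NormedAddCommGroup S] [NormedSpace ℝ S]
  [NormedSpace 𝕜 S] [IsScalarTower ℝ 𝕜 S] {S' : Type*} [NormedAddCommGroup S'] [NormedSpace ℝ S']
  [NormedSpace 𝕜 S'] [IsScalarTower ℝ 𝕜 S'] {ρ : Cl p q →ₐ[ℝ] Module.End 𝕜 S}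
  {ρ' : Cl (p + 1) q →ₐ[ℝ] Module.End 𝕜 S'} {W : Submodule 𝕜 S'} {Φ : S' →ₗ[𝕜] S}

/-- The generators `e_i e_0` of the even Clifford algebra of `ℝ^{p+1,q}`. -/
def coneGen (i : Idx p q) : Cl (p + 1) q := gen (succIdx i) * gen zeroIdx

theorem coneGen_mul_coneGen (i j : Idx p q) :
    coneGen i * coneGen j = gen (succIdx i) * gen (succIdx j) := by
  rw [coneGen, coneGen, mul_assoc, ← mul_assoc (gen zeroIdx), gen_mul_gen_zero, neg_mul,
    mul_assoc (gen (succIdx j)), gen_zero_mul_self, mul_neg_one, neg_neg]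

theorem coneGen_isCliffordFamily (p q : ℕ) :
    IsCliffordFamily genSq (coneGen : Idx p q → Cl (p + 1) q) where
  sq i := by
    rw [coneGen_mul_coneGen, gen_mul_self, sgn_succIdx, ← cast_genSq, map_intCast]
  anti i j hij := by
    rw [coneGen_mul_coneGen, coneGen_mul_coneGen, gen_mul_gen (succIdx_injective.ne hij)]
  sign := (gen_isCliffordFamily p q).sign

theorem coneGen_mul_gen_zero (i : Idx p q) :
    coneGen i * gen zeroIdx = -(gen zeroIdx * coneGen i) := by
  rw [coneGen, ← mul_assoc (gen zeroIdx), gen_mul_gen_zero, neg_mul, neg_neg]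

theorem gen_succIdx_eq (i : Idx p q) : gen (succIdx i) = -(coneGen i * gen zeroIdx) := by
  rw [coneGen, mul_assoc, gen_zero_mul_self, mul_neg, mul_one, neg_neg]

theorem isCliffordFamily_rep (ρ : Cl p q →ₐ[ℝ] Module.End 𝕜 S) :
    IsCliffordFamily genSq fun i => ρ (gen i) :=
  (gen_isCliffordFamily p q).map (ρ : Cl p q →+* Module.End 𝕜 S)

theorem isCliffordFamily_coneRep (ρ' : Cl (p + 1) q →ₐ[ℝ] Module.End 𝕜 S') :
    IsCliffordFamily genSq fun i => ρ' (coneGen i) :=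
  (coneGen_isCliffordFamily p q).map (ρ' : Cl (p + 1) q →+* Module.End 𝕜 S')

theorem rep_mem_of_gen {U : Submodule 𝕜 S} (hU : ∀ i, ∀ s ∈ U, ρ (gen i) s ∈ U) (a : Cl p q) :
    ∀ s ∈ U, ρ a s ∈ U := by
  induction a using CliffordAlgebra.induction with
  | algebraMap r =>
    intro s hs
    rw [AlgHom.commutes]
    exact real_smul_mem U r hs
  | ι v =>
    intro s hs
    change ρ (vec v) s ∈ U
    rw [map_vec]
    exact U.sum_mem fun i _ => real_smul_mem U _ (hU i s hs)
  | mul a b ha hb =>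
    intro s hs
    rw [map_mul]
    exact ha _ (hb s hs)
  | add a b ha hb =>
    intro s hs
    rw [map_add]
    exact U.add_mem (ha s hs) (hb s hs)

theorem IsSpinorModule.isIrreducibleSub (h : IsSpinorModule ρ) :
    IsIrreducibleSub (fun i => ρ (gen i)) ⊤ where
  ne_bot := have := h.nontrivial; top_ne_bot
  invariant _ _ _ := trivial
  irreducible U _ hU := h.irreducible U (rep_mem_of_gen hU)

theorem IsSpinorModule.eq_bot_or_top (h : IsSpinorModule ρ') (U : Submodule 𝕜 S')
    (hU : ∀ i, ∀ w ∈ U, ρ' (coneGen i) w ∈ U) (hU0 : ∀ w ∈ U, ρ' (gen zeroIdx) w ∈ U) :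
    U = ⊥ ∨ U = ⊤ := by
  refine h.irreducible U (rep_mem_of_gen fun i => ?_)
  refine idx_cases (P := fun i => ∀ s ∈ U, ρ' (gen i) s ∈ U) hU0 (fun i s hs => ?_) i
  rw [gen_succIdx_eq, map_neg, map_mul]
  exact U.neg_mem (hU i _ (hU0 s hs))

theorem even_mem_of_coneGen {U : Submodule 𝕜 S'} (hU : ∀ i, ∀ w ∈ U, ρ' (coneGen i) w ∈ U)
    (a : Cl (p + 1) q) (ha : a ∈ CliffordAlgebra.even (cliffordForm (p + 1) q)) :
    ∀ s ∈ U, ρ' a s ∈ U := by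
  have hgen : ∀ i j : Idx (p + 1) q, ∀ w ∈ U, ρ' (gen i) (ρ' (gen j) w) ∈ U := by
    intro i j w hw
    rw [← Module.End.mul_apply, ← map_mul]
    refine idx_cases (P := fun i => ρ' (gen i * gen j) w ∈ U) ?_ (fun i => ?_) i
    · refine idx_cases (P := fun j => ρ' (gen zeroIdx * gen j) w ∈ U) ?_ (fun j => ?_) j
      · rw [gen_zero_mul_self, map_neg, map_one]
        exact U.neg_mem hw
      · rw [gen_mul_gen_zero, map_neg]
        exact U.neg_mem (hU j w hw)
    · refine idx_cases (P := fun j => ρ' (gen (succIdx i) * gen j) w ∈ U) (hU i w hw)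
        (fun j => ?_) j
      rw [← coneGen_mul_coneGen, map_mul]
      exact hU i _ (hU j w hw)
  change a ∈ CliffordAlgebra.evenOdd (cliffordForm (p + 1) q) 0 at ha
  induction a, ha using CliffordAlgebra.even_induction with
  | algebraMap r =>
    intro s hs
    rw [AlgHom.commutes]
    exact real_smul_mem U r hs
  | add x y hx hy ihx ihy =>
    intro s hs
    rw [map_add]
    exact U.add_mem (ihx s hs) (ihy s hs)
  | ι_mul_ι_mul u v x hx ih =>
    intro s hs
    change ρ' (vec u * vec v * x) s ∈ U
    rw [map_mul, map_mul]
    change ρ' (vec u) (ρ' (vec v) (ρ' x s)) ∈ U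
    rw [map_vec, map_vec]
    refine U.sum_mem fun i _ => real_smul_mem U _ ?_
    rw [map_sum]
    refine U.sum_mem fun j _ => ?_
    rw [map_real_smul]
    exact real_smul_mem U _ (hgen i j _ (ih s hs))

theorem coneGen_mem_even (i : Idx p q) :
    coneGen i ∈ CliffordAlgebra.even (cliffordForm (p + 1) q) :=
  CliffordAlgebra.ι_mul_ι_mem_evenOdd_zero _ _ _

theorem isEvenIrreducible_iff :
    IsEvenIrreducible ρ' W ↔ IsIrreducibleSub (fun i => ρ' (coneGen i)) W :=
  ⟨fun h => ⟨h.ne_bot, fun i => h.invariant _ (coneGen_mem_even i),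
    fun U hUW hU => h.irreducible U hUW (even_mem_of_coneGen hU)⟩,
  fun h => ⟨h.ne_bot, even_mem_of_coneGen h.invariant,
    fun U hUW hU => h.irreducible U hUW fun i => hU _ (coneGen_mem_even i)⟩⟩

theorem IsTwistedIso.isIdentification {η : ℤ}
    (h : IsTwistedIso (fun i => ρ' (coneGen i)) (fun i => ρ (gen i)) W η Φ) :
    IsIdentification ρ ρ' W (η : ℝ) Φ where
  bijOn := h.bijOn
  map_mul i w hw := (h.map_apply i w hw).trans (Int.cast_smul_eq_zsmul ℝ η _).symm

variable [FiniteDimensional 𝕜 S] [FiniteDimensional 𝕜 S']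

theorem rep_zero_mul_self (ρ' : Cl (p + 1) q →ₐ[ℝ] Module.End 𝕜 S') :
    ρ' (gen zeroIdx) * ρ' (gen zeroIdx) = -1 := by
  rw [← map_mul, gen_zero_mul_self, map_neg, map_one]

theorem rep_coneGen_anti (ρ' : Cl (p + 1) q →ₐ[ℝ] Module.End 𝕜 S') (i : Idx p q) :
    ρ' (coneGen i) * ρ' (gen zeroIdx) = -(ρ' (gen zeroIdx) * ρ' (coneGen i)) := by
  rw [← map_mul, coneGen_mul_gen_zero, map_neg, map_mul]

theorem exists_identification_top (hρ : IsSpinorModule ρ) (hρ' : IsSpinorModule ρ')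
    (hJ : HasAntiUnit fun i => ρ (gen i)) :
    (∃ Φ, IsIdentification ρ ρ' ⊤ 1 Φ) ∧ ∃ Φ, IsIdentification ρ ρ' ⊤ (-1) Φ := by
  have := hρ'.nontrivial
  obtain ⟨W, hW⟩ := exists_isIrreducibleSub fun i => ρ' (coneGen i)
  obtain ⟨η, hη, Φ, hΦ⟩ := hW.exists_isTwistedIso (isCliffordFamily_coneRep ρ')
    (isCliffordFamily_rep ρ) hρ.isIrreducibleSub
  obtain rfl := hΦ.eq_top (rep_zero_mul_self ρ') (rep_coneGen_anti ρ') hρ'.eq_bot_or_top hW hJ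
  have h1 := hΦ.isIdentification
  have h2 := (hΦ.comp_antiUnit (rep_zero_mul_self ρ') (rep_coneGen_anti ρ')).isIdentification
  rcases hη with rfl | rfl
  · exact ⟨⟨_, by simpa using h1⟩, ⟨_, by simpa using h2⟩⟩
  · exact ⟨⟨_, by simpa using h2⟩, ⟨_, by simpa using h1⟩⟩

theorem exists_semiSpinorPair (hρ : IsSpinorModule ρ) (hρ' : IsSpinorModule ρ')
    (hJ : ¬HasAntiUnit fun i => ρ (gen i)) : ∃ Wp Wm, IsSemiSpinorPair ρ' Wp Wm := by
  have := hρ'.nontrivial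
  obtain ⟨W, hW⟩ := exists_isIrreducibleSub fun i => ρ' (coneGen i)
  obtain ⟨η, hη, Φ, hΦ⟩ := hW.exists_isTwistedIso (isCliffordFamily_coneRep ρ')
    (isCliffordFamily_rep ρ) hρ.isIrreducibleSub
  exact ⟨W, _, hΦ.isCompl_map (by rcases hη with rfl | rfl <;> rfl) (rep_zero_mul_self ρ')
    (rep_coneGen_anti ρ') hρ'.eq_bot_or_top hW hJ, isEvenIrreducible_iff.2 hW,
    isEvenIrreducible_iff.2 (hW.map_antiUnit (rep_zero_mul_self ρ') (rep_coneGen_anti ρ'))⟩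

theorem IsSemiSpinorPair.exists_identification (hρ : IsSpinorModule ρ) (hρ' : IsSpinorModule ρ')
    (hJ : ¬HasAntiUnit fun i => ρ (gen i)) {Wp Wm : Submodule 𝕜 S'}
    (h : IsSemiSpinorPair ρ' Wp Wm) : ∃ ε : ℝ, (ε = 1 ∨ ε = -1) ∧
      (∃ Φ, IsIdentification ρ ρ' Wp ε Φ) ∧ ∃ Φ, IsIdentification ρ ρ' Wm (-ε) Φ := by
  have hW := isEvenIrreducible_iff.1 h.plus
  obtain ⟨η, hη, Φ, hΦ⟩ := hW.exists_isTwistedIso (isCliffordFamily_coneRep ρ')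
    (isCliffordFamily_rep ρ) hρ.isIrreducibleSub
  have hc := hΦ.isCompl_map (by rcases hη with rfl | rfl <;> rfl) (rep_zero_mul_self ρ')
    (rep_coneGen_anti ρ') hρ'.eq_bot_or_top hW hJ
  obtain ⟨Φ', hΦ'⟩ := hΦ.exists_of_disjoint (rep_zero_mul_self ρ') (rep_coneGen_anti ρ') hW hc
    (isEvenIrreducible_iff.1 h.minus) h.isCompl.disjoint
  refine ⟨η, by rcases hη with rfl | rfl <;> simp, ⟨Φ, hΦ.isIdentification⟩, Φ', ?_⟩
  simpa using hΦ'.isIdentification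

theorem IsEvenIrreducible.exists_identification (hρ : IsSpinorModule ρ)
    (hs : ((p : ℤ) - q) % 8 = 0) (h : IsEvenIrreducible ρ' W) :
    (∃ Φ, IsIdentification ρ ρ' W 1 Φ) ∧ ∃ Φ, IsIdentification ρ ρ' W (-1) Φ := by
  have hW := isEvenIrreducible_iff.1 h
  have he := isCliffordFamily_rep ρ
  obtain ⟨η, hη, Φ, hΦ⟩ := hW.exists_isTwistedIso (isCliffordFamily_coneRep ρ') he
    hρ.isIrreducibleSub
  have hsq : volume (fun i => ρ (gen i)) * volume (fun i => ρ (gen i)) = 1 := by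
    rw [volume_sq he, IsCliffordFamily.volSign, if_pos (by omega), Int.cast_one]
  have hanti := fun i => gen_mul_volume he i
  rw [(show Even (p + q) by rw [Nat.even_iff]; omega).neg_one_pow] at hanti
  simp only [one_mul] at hanti
  have hK : Function.Bijective (volume (fun i => ρ (gen i)) : Module.End 𝕜 S) :=
    (Module.End.isUnit_iff _).1 (IsUnit.of_mul_eq_one _ hsq)
  have h1 := hΦ.isIdentification
  have h2 := (hΦ.antiUnit_comp hK hanti).isIdentification
  rcases hη with rfl | rfl
  · exact ⟨⟨_, by simpa using h1⟩, ⟨_, by simpa using h2⟩⟩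
  · exact ⟨⟨_, by simpa using h2⟩, ⟨_, by simpa using h1⟩⟩

end ConeModules

section Main

variable {E : Type*} [NormedAddCommGroup E] [NormedSpace ℝ E] {H : Type*} [TopologicalSpace H]
  {I : ModelWithCorners ℝ E H} {M : Type*} [TopologicalSpace M] [ChartedSpace H M]
  [IsManifold I ∞ M] {p q : ℕ} {g : PseudoMetric I M p q} [I.Boundaryless] [CompleteSpace E]
  {ι : Type*} (σ : SpinStructure g ι)
  {𝕜 : Type*} [RCLike 𝕜] {S : Type*} [NormedAddCommGroup S] [NormedSpace ℝ S]
  [NormedSpace 𝕜 S] [IsScalarTower ℝ 𝕜 S] {S' : Type*} [NormedAddCommGroup S'] [NormedSpace ℝ S']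
  [NormedSpace 𝕜 S'] [IsScalarTower ℝ 𝕜 S'] {ρ : Cl p q →ₐ[ℝ] Module.End 𝕜 S}
  {ρ' : Cl (p + 1) q →ₐ[ℝ] Module.End 𝕜 S'} {W : Submodule 𝕜 S'}
  [FiniteDimensional 𝕜 S] [FiniteDimensional 𝕜 S']

theorem restrictsToKilling {δ : ℝ} (hδ : δ = 1 ∨ δ = -1) (hW : ConeInvariant ρ' W)
    (h : ∃ Φ, IsIdentification ρ ρ' W δ Φ) : RestrictsToKilling σ ρ ρ' W δ :=
  ⟨h, fun _ hΦ => hΦ.restrictionIsIso (by rcases hδ with rfl | rfl <;> norm_num) hW σ⟩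

theorem nonempty_killingSpinors_equiv (hW : ConeInvariant ρ' W)
    (h1 : ∃ Φ, IsIdentification ρ ρ' W 1 Φ) (h2 : ∃ Φ, IsIdentification ρ ρ' W (-1) Φ) :
    Nonempty (killingSpinors σ ρ ⊤ (1 / 2) ≃ₗ[𝕜] killingSpinors σ ρ ⊤ (-(1 / 2))) := by
  obtain ⟨Φ₁, h1⟩ := h1
  obtain ⟨Φ₂, h2⟩ := h2
  obtain ⟨f₁, -⟩ := h1.restrictionIsIso (by norm_num) hW σ
  obtain ⟨f₂, -⟩ := h2.restrictionIsIso (by norm_num) hW σ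
  rw [← neg_div]
  exact ⟨f₁.symm.trans f₂⟩

theorem IsEvenIrreducible.coneInvariant (h : IsEvenIrreducible ρ' W) : ConeInvariant ρ' W :=
  (isEvenIrreducible_iff.1 h).invariant

theorem restrictsToKilling_of_hasAntiUnit (hρ : IsSpinorModule ρ) (hρ' : IsSpinorModule ρ')
    (hJ : HasAntiUnit fun i => ρ (gen i)) : RestrictsToKilling σ ρ ρ' ⊤ 1 ∧
      Nonempty (killingSpinors σ ρ ⊤ (1 / 2) ≃ₗ[𝕜] killingSpinors σ ρ ⊤ (-(1 / 2))) := by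
  have h := exists_identification_top hρ hρ' hJ
  have hW : ConeInvariant ρ' (⊤ : Submodule 𝕜 S') := fun _ _ _ => trivial
  exact ⟨restrictsToKilling σ (Or.inl rfl) hW h.1, nonempty_killingSpinors_equiv σ hW h.1 h.2⟩

theorem restrictsToKilling_of_not_hasAntiUnit (hρ : IsSpinorModule ρ) (hρ' : IsSpinorModule ρ')
    (hJ : ¬HasAntiUnit fun i => ρ (gen i)) :
    (∃ Wp Wm : Submodule 𝕜 S', IsSemiSpinorPair ρ' Wp Wm) ∧
      ∀ Wp Wm : Submodule 𝕜 S', IsSemiSpinorPair ρ' Wp Wm →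
        ∃ ε : ℝ, (ε = 1 ∨ ε = -1) ∧ RestrictsToKilling σ ρ ρ' Wp ε ∧
          RestrictsToKilling σ ρ ρ' Wm (-ε) := by
  refine ⟨exists_semiSpinorPair hρ hρ' hJ, fun Wp Wm h => ?_⟩
  obtain ⟨ε, hε, hp, hm⟩ := h.exists_identification hρ hρ' hJ
  exact ⟨ε, hε, restrictsToKilling σ hε h.plus.coneInvariant hp,
    restrictsToKilling σ (by rcases hε with rfl | rfl <;> simp) h.minus.coneInvariant hm⟩

end Main

end ConeSpin

end

theorem mainTheorem8
    {E : Type*} [NormedAddCommGroup E] [NormedSpace ℝ E] [FiniteDimensional ℝ E]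
    {H : Type*} [TopologicalSpace H] (I : ModelWithCorners ℝ E H) [I.Boundaryless]
    (M : Type*) [TopologicalSpace M] [ChartedSpace H M] [IsManifold I ∞ M]
    (p q : ℕ) (g : ConeSpin.PseudoMetric I M p q)
    {ι : Type*} (σ : ConeSpin.SpinStructure g ι) :
    -- (i) real spinors; `S` is the spinor module of `M`, `S'` that of the cone
    (∀ {S S' : Type*}
      [NormedAddCommGroup S] [NormedSpace ℝ S] [FiniteDimensional ℝ S]
      [NormedAddCommGroup S'] [NormedSpace ℝ S'] [FiniteDimensional ℝ S']
      (ρ : ConeSpin.Cl p q →ₐ[ℝ] Module.End ℝ S)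
      (ρ' : ConeSpin.Cl (p + 1) q →ₐ[ℝ] Module.End ℝ S'),
      ConeSpin.IsSpinorModule ρ → ConeSpin.IsSpinorModule ρ' →
      (((p : ℤ) - q) % 8 = 2 ∨ ((p : ℤ) - q) % 8 = 4 ∨
          ((p : ℤ) - q) % 8 = 5 ∨ ((p : ℤ) - q) % 8 = 6 →
        ConeSpin.RestrictsToKilling σ ρ ρ' ⊤ 1 ∧
        Nonempty (ConeSpin.killingSpinors σ ρ ⊤ (1 / 2) ≃ₗ[ℝ]
          ConeSpin.killingSpinors σ ρ ⊤ (-(1 / 2)))) ∧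
      (((p : ℤ) - q) % 8 = 0 ∨ ((p : ℤ) - q) % 8 = 1 ∨
          ((p : ℤ) - q) % 8 = 3 ∨ ((p : ℤ) - q) % 8 = 7 →
        (∃ Wp Wm : Submodule ℝ S', ConeSpin.IsSemiSpinorPair ρ' Wp Wm) ∧
        ∀ Wp Wm : Submodule ℝ S', ConeSpin.IsSemiSpinorPair ρ' Wp Wm →
          ∃ ε : ℝ, (ε = 1 ∨ ε = -1) ∧ ConeSpin.RestrictsToKilling σ ρ ρ' Wp ε ∧
            ConeSpin.RestrictsToKilling σ ρ ρ' Wm (-ε)) ∧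
      (((p : ℤ) - q) % 8 = 0 →
        (∀ Wp Wm : Submodule ℝ S', ConeSpin.IsSemiSpinorPair ρ' Wp Wm →
          ConeSpin.RestrictsToKilling σ ρ ρ' Wp 1 ∧ ConeSpin.RestrictsToKilling σ ρ ρ' Wm 1) ∧
        Nonempty (ConeSpin.killingSpinors σ ρ ⊤ (1 / 2) ≃ₗ[ℝ]
          ConeSpin.killingSpinors σ ρ ⊤ (-(1 / 2))))) ∧
    -- (ii) complex spinors
    (∀ {S S' : Type*}
      [NormedAddCommGroup S] [NormedSpace ℂ S] [FiniteDimensional ℂ S]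
      [NormedAddCommGroup S'] [NormedSpace ℂ S'] [FiniteDimensional ℂ S']
      (ρ : ConeSpin.Cl p q →ₐ[ℝ] Module.End ℂ S)
      (ρ' : ConeSpin.Cl (p + 1) q →ₐ[ℝ] Module.End ℂ S'),
      ConeSpin.IsSpinorModule ρ → ConeSpin.IsSpinorModule ρ' →
      (Even (p + q) →
        ConeSpin.RestrictsToKilling σ ρ ρ' ⊤ 1 ∧
        Nonempty (ConeSpin.killingSpinors σ ρ ⊤ (1 / 2) ≃ₗ[ℂ]
          ConeSpin.killingSpinors σ ρ ⊤ (-(1 / 2)))) ∧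
      (Odd (p + q) →
        (∃ Wp Wm : Submodule ℂ S', ConeSpin.IsSemiSpinorPair ρ' Wp Wm) ∧
        ∀ Wp Wm : Submodule ℂ S', ConeSpin.IsSemiSpinorPair ρ' Wp Wm →
          ∃ ε : ℝ, (ε = 1 ∨ ε = -1) ∧ ConeSpin.RestrictsToKilling σ ρ ρ' Wp ε ∧
            ConeSpin.RestrictsToKilling σ ρ ρ' Wm (-ε))) := by
  refine ⟨fun {S S'} _ _ _ _ _ _ ρ ρ' hρ hρ' => ?_, fun {S S'} _ _ _ _ _ _ ρ ρ' hρ hρ' => ?_⟩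
  · have := hρ.nontrivial
    have he := ConeSpin.isCliffordFamily_rep ρ
    have hS := hρ.isIrreducibleSub.isSchur
    have hpair := fun hs => ConeSpin.restrictsToKilling_of_not_hasAntiUnit σ hρ hρ'
      (ConeSpin.not_hasAntiUnit_real he hS hs)
    refine ⟨fun hs => ConeSpin.restrictsToKilling_of_hasAntiUnit σ hρ hρ'
      (ConeSpin.hasAntiUnit_real he hS hs), hpair, fun hs => ⟨fun Wp Wm h => ⟨?_, ?_⟩, ?_⟩⟩
    · exact ConeSpin.restrictsToKilling σ (Or.inl rfl) h.plus.coneInvariant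
        (h.plus.exists_identification hρ hs).1
    · exact ConeSpin.restrictsToKilling σ (Or.inl rfl) h.minus.coneInvariant
        (h.minus.exists_identification hρ hs).1
    · obtain ⟨Wp, Wm, h⟩ := (hpair (Or.inl hs)).1
      obtain ⟨h1, h2⟩ := h.plus.exists_identification hρ hs
      exact ConeSpin.nonempty_killingSpinors_equiv σ h.plus.coneInvariant h1 h2
  · have := hρ.nontrivial
    have he := ConeSpin.isCliffordFamily_rep ρ
    have hS := hρ.isIrreducibleSub.isSchur
    exact ⟨fun hn => ConeSpin.restrictsToKilling_of_hasAntiUnit σ hρ hρ'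
      (ConeSpin.hasAntiUnit_complex he hn),
      fun hn => ConeSpin.restrictsToKilling_of_not_hasAntiUnit σ hρ hρ'
        (ConeSpin.not_hasAntiUnit_complex he hS hn)⟩
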